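/- **Notation.** Let $R$ be a commutative ring with a ring endomorphism $\varphi$. Let $R_\varphi$ be the associative ring generated by its subring $R$ and an element $\varphi$ with the relations $\varphi r=\varphi(r)\varphi$ $(r\in R)$; a left $R_\varphi$-module is an $R$-module $M$ with a $\varphi$-semilinear endomorphism $\varphi_M$. Let $D_\varphi(R)$ be the derived category of $R_\varphi$-modules. Let $D_\varphi^{\mathrm{perf}}(R)\subset D_\varphi(R)$ be the full subcategory of complexes that are perfect as complexes of $R$-modules. A complex $C$ of $R_\varphi$-modules is *nondegenerate* if the composition $L\varphi^*C\otimes\mathbb Q\to\varphi^*C\otimes\mathbb Q\to C\otimes\mathbb Q$ is a quasi-isomorphism, where the second map is the $R$-linear extension of the $\varphi$-action; $D_\varphi^{\mathrm{perf}}(R)^{\mathrm{nd}}\subset D_\varphi^{\mathrm{perf}}(R)$ is the full subcategory of nondegenerate objects. For an additive category $\mathcal A$, the category $\mathcal A\otimes\mathbb Q$ has the same objects and $\mathrm{Hom}_{\mathcal A\otimes\mathbb Q}(X,Y)=\mathrm{Hom}_{\mathcal A}(X,Y)\otimes\mathbb Q$. **Proposition 1.13.** Let $p$ be a prime and let $R$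 be a $p$-adically complete commutative ring, $R\cong\varprojlim R/p^nR$, with bounded $p$-power torsion (there is $c\ge 0$ such that every $p$-power torsion element of $R$ is killed by $p^c$). Let $\varphi$ be an endomorphism of $R$ and $I\subset R$ a $p$-adically closed ideal with $\varphi(I)\subset I$, such that $W:=R/I$ is a discrete valuation ring of mixed characteristic $(0,p)$ and the induced endomorphism $\varphi_W$ of $W$ is bijective. Assume that $\varphi$ is strongly topologically nilpotent on $I$: for every $m>0$ there is a finite filtration $I=F_0\supseteq F_1\supseteq\dots\supseteq F_L=0$ by closed $\varphi$-invariant ideals with $\varphi(\mathrm{gr}^\cdot I)\subset p^m\,\mathrm{gr}^\cdot I$, i.e. $\varphi(F_i)\subset p^mF_i+F_{i+1}$ for $0\le i<L$. Then the projection $R\to W$ has a unique set-theoretic section $s:W\to R$ with $s\varphi_W=\varphi s$, and $s$ is a ring homomorphism. Let $\pi^*M=R\otimes_{s,W}M$ and $i^*N=W\otimes_RN=N/IN$ be the base change functors between $W_\varphi$-modules and $R_\varphi$-modules along $s$ and along $R\to W$. Their left derived functors $L\pi^*:D_\varphi^{\mathrm{perf}}(W)\to D_\varphi^{\mathrm{perf}}(R)$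 and $Li^*:D_\varphi^{\mathrm{perf}}(R)\to D_\varphi^{\mathrm{perf}}(W)$ exist, are additive, preserve nondegenerate objects, and induce mutually inverse equivalences of categories $$D_\varphi^{\mathrm{perf}}(W)^{\mathrm{nd}}\otimes\mathbb Q\;\simeq\;D_\varphi^{\mathrm{perf}}(R)^{\mathrm{nd}}\otimes\mathbb Q .$$ -/

import Mathlib

open CategoryTheory TensorProduct

universe u v v' w w'

noncomputable section

/-! ## The twisted polynomial ring `R_φ` -/

namespace Dwork

/-- The action of the free monoid on one generator on `R` through powers of `φ`. -/
abbrev powAction {R : Type u} [CommRing R] (φ : R →+* R) :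
    MulSemiringAction (Multiplicative ℕ) R :=
  MulSemiringAction.compHom R (powersHom (R →+* R) φ)

/-- `R_φ`: the associative ring generated by the subring `R` and an element `X`
with the relation `X r = φ(r) X`. Its elements are the finite sums `∑ rₙ Xⁿ`. -/
def SkewRing {R : Type u} [CommRing R] (_φ : R →+* R) : Type u :=
  SkewMonoidAlgebra R (Multiplicative ℕ)

namespace SkewRing

variable {R : Type u} [CommRing R] (φ : R →+* R)

instance : Ring (SkewRing φ) :=
  letI := powAction φ
  inferInstanceAs (Ring (SkewMonoidAlgebra R (Multiplicative ℕ)))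

/-- The inclusion `R → R_φ`. -/
def C : R →+* SkewRing φ where
  toFun r := SkewMonoidAlgebra.single 1 r
  map_one' := rfl
  map_zero' := SkewMonoidAlgebra.single_zero_right _
  map_add' := SkewMonoidAlgebra.single_add _
  map_mul' a b := by
    let := powAction φ
    have h := SkewMonoidAlgebra.single_mul_single (k := R) (G := Multiplicative ℕ)
      (a₁ := 1) (a₂ := 1) (b₁ := a) (b₂ := b)
    rw [one_smul, one_mul] at h
    exact h.symm

/-- The generator `X` of `R_φ`, which acts on a module as its `φ`-action. -/
def X : SkewRing φ := SkewMonoidAlgebra.single (Multiplicative.ofAdd 1) (1 : R)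

theorem X_mul_C (r : R) : X φ * C φ r = C φ (φ r) * X φ := by
  let := powAction φ
  have h1 := SkewMonoidAlgebra.single_mul_single (k := R) (G := Multiplicative ℕ)
    (a₁ := Multiplicative.ofAdd 1) (a₂ := 1) (b₁ := 1) (b₂ := r)
  have h2 := SkewMonoidAlgebra.single_mul_single (k := R) (G := Multiplicative ℕ)
    (a₁ := 1) (a₂ := Multiplicative.ofAdd 1) (b₁ := φ r) (b₂ := 1)
  have h3 : (Multiplicative.ofAdd 1 : Multiplicative ℕ) • r = φ r := by
    change (powersHom (R →+* R) φ (Multiplicative.ofAdd 1)) r = φ r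
    simp
  rw [one_mul, mul_one, h3] at h1
  rw [one_smul, mul_one, one_mul] at h2
  exact h1.trans h2.symm

variable {φ}

/-- Universal property: a ring homomorphism out of `R_φ` is given by its restriction to `R` and
the image `t` of `X`, subject to `t f(r) = f(φ(r)) t`. -/
def lift {A : Type v} [Ring A] (f : R →+* A) (t : A) (h : ∀ r, t * f r = f (φ r) * t) :
    SkewRing φ →+* A :=
  letI := powAction φ
  SkewMonoidAlgebra.liftNCRingHom (k := R) (G := Multiplicative ℕ) f (powersHom A t) (by
    intro x y
    have key : ∀ n : ℕ, f ((φ ^ n) x) * t ^ n = t ^ n * f x := by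
      intro n
      induction n with
      | zero => simp
      | succ n ih =>
        rw [pow_succ' t, mul_assoc t, ← ih, ← mul_assoc t, h, pow_succ' φ, mul_assoc]
        rfl
    change f ((powersHom (R →+* R) φ y) x) * _ = _
    simpa using key (Multiplicative.toAdd y))

theorem lift_C {A : Type v} [Ring A] (f : R →+* A) (t : A) (h : ∀ r, t * f r = f (φ r) * t)
    (r : R) : lift f t h (C φ r) = f r := by
  let := powAction φ
  refine (SkewMonoidAlgebra.liftNC_single (k := R) (G := Multiplicative ℕ) (f : R →+ A)
    (powersHom A t) 1 r).trans ?_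
  simp

theorem lift_X {A : Type v} [Ring A] (f : R →+* A) (t : A) (h : ∀ r, t * f r = f (φ r) * t) :
    lift f t h (X φ) = t := by
  let := powAction φ
  refine (SkewMonoidAlgebra.liftNC_single (k := R) (G := Multiplicative ℕ) (f : R →+ A)
    (powersHom A t) (Multiplicative.ofAdd 1) 1).trans ?_
  simp

theorem single_eq (n : Multiplicative ℕ) (r : R) :
    (SkewMonoidAlgebra.single n r : SkewRing φ) = C φ r * X φ ^ (Multiplicative.toAdd n) := by
  let := powAction φ
  have hpow : ∀ n : ℕ, (SkewMonoidAlgebra.single (Multiplicative.ofAdd n) (1 : R) : SkewRing φ)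
      = X φ ^ n := by
    intro n
    induction n with
    | zero => rfl
    | succ n ih =>
      rw [pow_succ, ← ih]
      have h := SkewMonoidAlgebra.single_mul_single (k := R) (G := Multiplicative ℕ)
        (a₁ := Multiplicative.ofAdd n) (a₂ := Multiplicative.ofAdd 1) (b₁ := 1) (b₂ := 1)
      rw [smul_one, mul_one] at h
      exact h.symm
  rw [← hpow]
  have h := SkewMonoidAlgebra.single_mul_single (k := R) (G := Multiplicative ℕ)
    (a₁ := 1) (a₂ := n) (b₁ := r) (b₂ := 1)
  rw [one_smul, mul_one, one_mul] at h
  exact h.symm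

theorem induction {P : SkewRing φ → Prop} (a : SkewRing φ)
    (add : ∀ a b, P a → P b → P (a + b)) (mul : ∀ a b, P a → P b → P (a * b))
    (hC : ∀ r, P (C φ r)) (hX : P (X φ)) : P a := by
  have hpow : ∀ n : ℕ, P (X φ ^ n) := by
    intro n
    induction n with
    | zero => simpa using hC 1
    | succ n ih => rw [pow_succ]; exact mul _ _ ih hX
  refine SkewMonoidAlgebra.induction_on' (k := R) (G := Multiplicative ℕ) (p := P) a ?_ ?_
  · intro n r
    have := mul _ _ (hC r) (hpow (Multiplicative.toAdd n))
    rwa [← single_eq] at this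
  · intro f g hf hg
    exact add _ _ hf hg

end SkewRing

/-! ## `R_φ`-modules -/

/-- The category `R_φ-mod` of left `R_φ`-modules. -/
abbrev FMod {R : Type u} [CommRing R] (φ : R →+* R) := ModuleCat.{u} (SkewRing φ)

section Modules

variable {R : Type u} [CommRing R] (φ : R →+* R)

/-- The underlying `R`-module of an `R_φ`-module. -/
abbrev forgetFrob : FMod φ ⥤ ModuleCat.{u} R := ModuleCat.restrictScalars (SkewRing.C φ)

/-- The `φ`-action `φ_M : M → φ_* M`, i.e. the `φ`-semilinear action of `X`. -/
def frob : forgetFrob φ ⟶ forgetFrob φ ⋙ ModuleCat.restrictScalars φ where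
  app M := ModuleCat.ofHom (X := (forgetFrob φ).obj M)
    (Y := (ModuleCat.restrictScalars φ).obj ((forgetFrob φ).obj M))
    { toFun := fun m => SkewRing.X φ • (show M from m)
      map_add' := fun x y => smul_add _ (show M from x) (show M from y)
      map_smul' := fun r m => by
        have h : SkewRing.X φ • SkewRing.C φ r • (show M from m) =
            SkewRing.C φ (φ r) • SkewRing.X φ • (show M from m) := by
          rw [← mul_smul, ← mul_smul, SkewRing.X_mul_C]
        exact h }
  naturality M N g := by
    ext m
    exact (g.hom.map_smul (SkewRing.X φ) (show M from m)).symm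

/-- The `R`-linear extension `φ^l_M : φ^* M → M`, `r ⊗ m ↦ r φ_M(m)`, of the `φ`-action. -/
def frobLin : forgetFrob φ ⋙ ModuleCat.extendScalars φ ⟶ forgetFrob φ where
  app M := ((ModuleCat.extendRestrictScalarsAdj φ).homEquiv _ _).symm ((frob φ).app M)
  naturality M N g := by
    have := (frob φ).naturality g
    dsimp only [Functor.comp_map]
    rw [← Adjunction.homEquiv_naturality_left_symm, ← Adjunction.homEquiv_naturality_right_symm]
    exact congrArg _ this

variable {φ}

/-- The action of `R_φ` defined by an `R`-module `N` and a `φ`-semilinear endomorphism of `N`. -/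
def ofFrobHom (N : ModuleCat.{u} R) (T : N ⟶ (ModuleCat.restrictScalars φ).obj N) :
    SkewRing φ →+* AddMonoid.End N :=
  SkewRing.lift (φ := φ) (Module.toAddMonoidEnd R N)
    (show AddMonoid.End N from T.hom.toAddMonoidHom) (fun r => by
      ext n
      exact T.hom.map_smul r n)

/-- The `R_φ`-module defined by an `R`-module `N` and a `φ`-semilinear endomorphism of `N`. -/
def ofFrob (N : ModuleCat.{u} R) (T : N ⟶ (ModuleCat.restrictScalars φ).obj N) : FMod φ :=
  letI : Module (SkewRing φ) N := Module.compHom N (ofFrobHom N T)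
  ModuleCat.of (SkewRing φ) N

theorem ofFrob_C_smul (N : ModuleCat.{u} R) (T : N ⟶ (ModuleCat.restrictScalars φ).obj N)
    (r : R) (n : N) : (SkewRing.C φ r • (show ofFrob N T from n)) = (r • n : N) := by
  have h : ofFrobHom N T (SkewRing.C φ r) = Module.toAddMonoidEnd R N r :=
    SkewRing.lift_C _ _ _ r
  exact DFunLike.congr_fun h n

theorem ofFrob_X_smul (N : ModuleCat.{u} R) (T : N ⟶ (ModuleCat.restrictScalars φ).obj N)
    (n : N) : (SkewRing.X φ • (show ofFrob N T from n)) = (T.hom n : N) := by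
  have h : ofFrobHom N T (SkewRing.X φ) = (show AddMonoid.End N from T.hom.toAddMonoidHom) :=
    SkewRing.lift_X _ _ _
  exact DFunLike.congr_fun h n

/-- An `R`-linear map that commutes with the given semilinear endomorphisms is `R_φ`-linear. -/
def ofFrobMap {N N' : ModuleCat.{u} R} {T : N ⟶ (ModuleCat.restrictScalars φ).obj N}
    {T' : N' ⟶ (ModuleCat.restrictScalars φ).obj N'} (g : N ⟶ N')
    (h : T ≫ (ModuleCat.restrictScalars φ).map g = g ≫ T') : ofFrob N T ⟶ ofFrob N' T' :=
  ModuleCat.ofHom (X := ofFrob N T) (Y := ofFrob N' T')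
    { toFun := fun n => g.hom n
      map_add' := fun x y => g.hom.map_add x y
      map_smul' := fun a => by
        refine SkewRing.induction (φ := φ) (P := fun a => ∀ n : ofFrob N T,
          (show ofFrob N' T' from g.hom (show N from (a • n))) =
            a • (show ofFrob N' T' from g.hom (show N from n))) a ?_ ?_ ?_ ?_
        · intro a b ha hb n
          rw [add_smul, add_smul, ← ha, ← hb]
          exact g.hom.map_add _ _
        · intro a b ha hb n
          rw [mul_smul, mul_smul, ha, hb]
        · intro r n
          refine (congrArg g.hom (ofFrob_C_smul N T r n)).trans ?_
          exact (g.hom.map_smul r _).trans (ofFrob_C_smul N' T' r _).symm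
        · intro n
          refine (congrArg g.hom (ofFrob_X_smul N T n)).trans ?_
          refine Eq.trans ?_ (ofFrob_X_smul N' T' _).symm
          exact congrArg (fun k => k.hom n) h }

variable {S : Type u} [CommRing S] {ψ : S →+* S}

/-- The `ψ`-action `s ⊗ m ↦ ψ(s) ⊗ φ_M(m)` on `S ⊗_R M`, where `f : R → S` satisfies
`f ∘ φ = ψ ∘ f`. -/
def baseChangeFrob (f : R →+* S) (hf : f.comp φ = ψ.comp f) (M : FMod φ) :
    (ModuleCat.extendScalars f).obj ((forgetFrob φ).obj M) ⟶
      (ModuleCat.restrictScalars ψ).obj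
        ((ModuleCat.extendScalars f).obj ((forgetFrob φ).obj M)) :=
  ((ModuleCat.extendRestrictScalarsAdj f).homEquiv _ _).symm
    ((frob φ).app M ≫
      (ModuleCat.restrictScalars φ).map
        ((ModuleCat.extendRestrictScalarsAdj f).unit.app ((forgetFrob φ).obj M)) ≫
      (ModuleCat.restrictScalarsComp'App φ f (f.comp φ) rfl _).inv ≫
      (ModuleCat.restrictScalarsComp'App f ψ (f.comp φ) hf _).hom)

theorem baseChangeFrob_naturality (f : R →+* S) (hf : f.comp φ = ψ.comp f) {M M' : FMod φ}
    (g : M ⟶ M') :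
    baseChangeFrob f hf M ≫ (ModuleCat.restrictScalars ψ).map
        ((ModuleCat.extendScalars f).map ((forgetFrob φ).map g)) =
      (ModuleCat.extendScalars f).map ((forgetFrob φ).map g) ≫ baseChangeFrob f hf M' := by
  dsimp only [baseChangeFrob]
  rw [← Adjunction.homEquiv_naturality_left_symm, ← Adjunction.homEquiv_naturality_right_symm]
  congr 1
  ext m
  change ((ModuleCat.extendScalars f).map ((forgetFrob φ).map g)).hom
      (((ModuleCat.extendRestrictScalarsAdj f).unit.app ((forgetFrob φ).obj M)).hom
        (((frob φ).app M).hom m)) =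
    ((ModuleCat.extendRestrictScalarsAdj f).unit.app ((forgetFrob φ).obj M')).hom
      (((frob φ).app M').hom (((forgetFrob φ).map g).hom m))
  have h1 := congrArg (fun k => k.hom m) ((frob φ).naturality g)
  have h2 := congrArg (fun k => k.hom (((frob φ).app M).hom m))
    ((ModuleCat.extendRestrictScalarsAdj f).unit.naturality ((forgetFrob φ).map g))
  exact h2.symm.trans
    (congrArg ((ModuleCat.extendRestrictScalarsAdj f).unit.app ((forgetFrob φ).obj M')).hom
      h1.symm)

/-- The base change functor `M ↦ S ⊗_R M`, `φ_{S ⊗ M} = ψ ⊗ φ_M`, from `R_φ`-modules to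
`S_ψ`-modules along a ring homomorphism `f : R → S` with `f ∘ φ = ψ ∘ f`. -/
def baseChange (f : R →+* S) (hf : f.comp φ = ψ.comp f) : FMod φ ⥤ FMod ψ where
  obj M := ofFrob _ (baseChangeFrob f hf M)
  map g := ofFrobMap ((ModuleCat.extendScalars f).map ((forgetFrob φ).map g))
    (baseChangeFrob_naturality f hf g)
  map_id M := by
    have h : (ModuleCat.extendScalars f).map ((forgetFrob φ).map (𝟙 M)) = 𝟙 _ := by simp
    ext m
    exact congrArg (fun k => k.hom m) h
  map_comp g g' := by
    have h := (forgetFrob φ ⋙ ModuleCat.extendScalars f).map_comp g g'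
    ext m
    exact congrArg (fun k => k.hom m) h

instance (f : R →+* S) : (ModuleCat.extendScalars.{u, u, u} f).Additive :=
  (ModuleCat.extendRestrictScalarsAdj.{u, u, u} f).left_adjoint_additive

instance (f : R →+* S) (hf : f.comp φ = ψ.comp f) : (baseChange f hf).Additive where
  map_add {M N g g'} := by
    have h := (forgetFrob φ ⋙ ModuleCat.extendScalars f).map_add (f := g) (g := g')
    ext m
    exact congrArg (fun k => k.hom m) h

end Modules

/-! ## Perfect and nondegenerate complexes -/

section Complexes

variable {R : Type u} [CommRing R]

/-- A bounded complex of finitely generated projective modules. -/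
def IsStrictlyPerfect (P : CochainComplex (ModuleCat.{u} R) ℤ) : Prop :=
  (∀ n, Module.Finite R (P.X n) ∧ Module.Projective R (P.X n)) ∧
    ∃ a b : ℤ, ∀ n, (n < a ∨ b < n) → Limits.IsZero (P.X n)

/-- A complex of `R`-modules is perfect if it is quasi-isomorphic to a strictly perfect one. (Since
a strictly perfect complex `P` is K-projective, isomorphisms from `P` to `K` in the derived
category are represented by quasi-isomorphisms of complexes `P → K`.) -/
def IsPerfect (K : CochainComplex (ModuleCat.{u} R) ℤ) : Prop :=
  ∃ (P : CochainComplex (ModuleCat.{u} R) ℤ) (f : P ⟶ K), IsStrictlyPerfect P ∧ QuasiIso f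

/-- The functor `M ↦ M ⊗ ℚ` from `R`-modules to `R ⊗ ℚ`-modules. -/
abbrev tensorRat (R : Type u) [CommRing R] : ModuleCat.{u} R ⥤ ModuleCat.{u} (R ⊗[ℤ] ℚ) :=
  ModuleCat.extendScalars (Algebra.TensorProduct.includeLeftRingHom : R →+* R ⊗[ℤ] ℚ)

variable (φ : R →+* R)

/-- Complexes of `R_φ`-modules. -/
abbrev FComplex := CochainComplex (FMod φ) ℤ

/-- The underlying complex of `R`-modules of a complex of `R_φ`-modules. -/
abbrev forgetComplex : FComplex φ ⥤ CochainComplex (ModuleCat.{u} R) ℤ :=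
  (forgetFrob φ).mapHomologicalComplex (ComplexShape.up ℤ)

/-- The `R`-linear extension `φ^* C → C` of the `φ`-action on a complex `C`. -/
def frobLinComplex (C : FComplex φ) :
    ((ModuleCat.extendScalars φ).mapHomologicalComplex (ComplexShape.up ℤ)).obj
      ((forgetComplex φ).obj C) ⟶ (forgetComplex φ).obj C :=
  (NatTrans.mapHomologicalComplex (frobLin φ) (ComplexShape.up ℤ)).app C

/-- A complex of `R_φ`-modules is `R`-perfect if it is perfect as a complex of `R`-modules. -/
def isRPerfect : ObjectProperty (FComplex φ) := fun C => IsPerfect ((forgetComplex φ).obj C)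

/-- A complex `C` of `R_φ`-modules is nondegenerate if the composition
`Lφ^* C ⊗ ℚ → φ^* C ⊗ ℚ → C ⊗ ℚ` is a quasi-isomorphism. Here `Lφ^* C → φ^* C` is computed as
`φ^* P → φ^* C`, where `P → C` is a K-projective resolution of the complex of `R`-modules `C`. -/
def isNondegenerate : ObjectProperty (FComplex φ) := fun C =>
  ∃ (P : CochainComplex (ModuleCat.{u} R) ℤ) (f : P ⟶ (forgetComplex φ).obj C),
    P.IsKProjective ∧ QuasiIso f ∧
    QuasiIso (((tensorRat R).mapHomologicalComplex (ComplexShape.up ℤ)).map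
      (((ModuleCat.extendScalars φ).mapHomologicalComplex (ComplexShape.up ℤ)).map f ≫
        frobLinComplex φ C))

variable [HasDerivedCategory.{w} (FMod φ)]

/-- The objects of `D(R_φ)` represented by `R`-perfect complexes. -/
def perfProp : ObjectProperty (DerivedCategory (FMod φ)) := fun X =>
  ∃ C : FComplex φ, isRPerfect φ C ∧ Nonempty (X ≅ DerivedCategory.Q.obj C)

/-- The category `D_φ^perf(R)`, a full subcategory of the derived category of `R_φ`-modules. -/
abbrev DPerf := (perfProp φ).FullSubcategory

/-- The objects of `D_φ^perf(R)` represented by nondegenerate complexes. -/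
def ndProp : ObjectProperty (DPerf φ) := fun X =>
  ∃ C : FComplex φ, isNondegenerate φ C ∧ Nonempty (X.obj ≅ DerivedCategory.Q.obj C)

/-- The category `D_φ^perf(R)^nd`. -/
abbrev DPerfNd := (ndProp φ).FullSubcategory

/-- The localization functor from `R`-perfect complexes of `R_φ`-modules to `D_φ^perf(R)`. -/
def perfQ : (isRPerfect φ).FullSubcategory ⥤ DPerf φ :=
  (perfProp φ).lift ((isRPerfect φ).ι ⋙ DerivedCategory.Q) fun C =>
    ⟨C.obj, C.property, ⟨Iso.refl _⟩⟩

variable {φ} {S : Type u} [CommRing S] {ψ : S →+* S} [HasDerivedCategory.{w'} (FMod ψ)]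

/-- The functor `C ↦ S ⊗_R C` from `R`-perfect complexes of `R_φ`-modules to `D(S_ψ)`. -/
def perfBaseChange (f : R →+* S) (hf : f.comp φ = ψ.comp f) :
    (isRPerfect φ).FullSubcategory ⥤ DerivedCategory (FMod ψ) :=
  (isRPerfect φ).ι ⋙ (baseChange f hf).mapHomologicalComplex (ComplexShape.up ℤ) ⋙
    DerivedCategory.Q

/-- `F : D_φ^perf(R) → D_ψ^perf(S)` is a left derived functor of the base change functor
`S ⊗_R -`: there is a natural transformation from `F` to base change on `R`-perfect complexes which
is universal among all natural transformations from functors on `D_φ^perf(R)` with values in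
`D(S_ψ)`, i.e. it is a right Kan extension along localization at quasi-isomorphisms. -/
def IsLeftDerivedBaseChange (f : R →+* S) (hf : f.comp φ = ψ.comp f) (F : DPerf φ ⥤ DPerf ψ) :
    Prop :=
  ∃ α : perfQ φ ⋙ F ⋙ (perfProp ψ).ι ⟶ perfBaseChange f hf,
    (F ⋙ (perfProp ψ).ι).IsRightKanExtension α

/-- The functor between the categories of nondegenerate objects induced by a functor
`D_φ^perf(R) → D_ψ^perf(S)` that preserves them. -/
def ndRestrict (F : DPerf φ ⥤ DPerf ψ) (hF : ∀ X, ndProp φ X → ndProp ψ (F.obj X)) :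
    DPerfNd φ ⥤ DPerfNd ψ :=
  (ndProp ψ).lift ((ndProp φ).ι ⋙ F) fun X => hF _ X.property

instance (F : DPerf φ ⥤ DPerf ψ) [F.Additive] (hF : ∀ X, ndProp φ X → ndProp ψ (F.obj X)) :
    (ndRestrict F hF).Additive where
  map_add {X Y f g} := by
    have h := ((ndProp φ).ι ⋙ F).map_add (f := f) (g := g)
    exact InducedCategory.hom_ext h

end Complexes

/-! ## Tensoring an additive category with `ℚ` -/

/-- The category `𝒜 ⊗ ℚ`: it has the same objects as `𝒜`, and
`Hom_{𝒜 ⊗ ℚ}(X, Y) = Hom_𝒜(X, Y) ⊗ ℚ`. -/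
structure RatCat (𝒜 : Type v) where
  /-- the underlying object of `𝒜` -/
  obj : 𝒜

namespace RatCat

variable {𝒜 : Type v} [Category.{w} 𝒜] [Preadditive 𝒜]

/-- Composition `(f ⊗ a, g ⊗ b) ↦ (f ≫ g) ⊗ ab`. -/
def comp (X Y Z : 𝒜) :
    ((X ⟶ Y) ⊗[ℤ] ℚ) →ₗ[ℤ] ((Y ⟶ Z) ⊗[ℤ] ℚ) →ₗ[ℤ] ((X ⟶ Z) ⊗[ℤ] ℚ) :=
  TensorProduct.map₂ (Linear.comp X Y Z) (LinearMap.mul ℤ ℚ)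

@[simp]
theorem comp_tmul {X Y Z : 𝒜} (f : X ⟶ Y) (a : ℚ) (g : Y ⟶ Z) (b : ℚ) :
    comp X Y Z (f ⊗ₜ a) (g ⊗ₜ b) = (f ≫ g) ⊗ₜ (a * b) := rfl

instance : Category.{w} (RatCat 𝒜) where
  Hom X Y := (X.obj ⟶ Y.obj) ⊗[ℤ] ℚ
  id X := 𝟙 X.obj ⊗ₜ 1
  comp {X Y Z} f g := comp X.obj Y.obj Z.obj f g
  id_comp f := by
    induction f using TensorProduct.induction_on with
    | zero => simp
    | tmul f a => simp
    | add f g hf hg => rw [map_add, hf, hg]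
  comp_id f := by
    induction f using TensorProduct.induction_on with
    | zero => simp
    | tmul f a => simp
    | add f g hf hg => rw [map_add, LinearMap.add_apply, hf, hg]
  assoc f g h := by
    induction f using TensorProduct.induction_on with
    | zero => simp
    | add f f' hf hf' => simp only [map_add, LinearMap.add_apply, hf, hf']
    | tmul f a =>
      induction g using TensorProduct.induction_on with
      | zero => simp
      | add g g' hg hg' => simp only [map_add, LinearMap.add_apply, hg, hg']
      | tmul g b =>
        induction h using TensorProduct.induction_on with
        | zero => simp
        | add h h' hh hh' => simp only [map_add, hh, hh']
        | tmul h c => simp [mul_assoc]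

variable {ℬ : Type v'} [Category.{w'} ℬ] [Preadditive ℬ]

/-- The functor `F ⊗ ℚ : 𝒜 ⊗ ℚ → ℬ ⊗ ℚ` induced by an additive functor `F`. -/
def map (F : 𝒜 ⥤ ℬ) [F.Additive] : RatCat 𝒜 ⥤ RatCat ℬ where
  obj X := ⟨F.obj X.obj⟩
  map {X Y} f := TensorProduct.map
    (F.mapAddHom (X := X.obj) (Y := Y.obj)).toIntLinearMap (LinearMap.id (R := ℤ) (M := ℚ)) f
  map_id X := by
    change TensorProduct.map _ _ (𝟙 X.obj ⊗ₜ[ℤ] (1 : ℚ)) = 𝟙 (F.obj X.obj) ⊗ₜ[ℤ] (1 : ℚ)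
    simp
  map_comp {X Y Z} f g := by
    change TensorProduct.map _ _ (comp _ _ _ f g) = comp _ _ _ _ _
    induction f using TensorProduct.induction_on with
    | zero => simp
    | add f f' hf hf' => simp only [map_add, LinearMap.add_apply, hf, hf']
    | tmul f a =>
      induction g using TensorProduct.induction_on with
      | zero => simp
      | add g g' hg hg' => simp only [map_add, hg, hg']
      | tmul g b => simp

end RatCat

/-! ## `p`-adic conditions -/

section Padic

variable {R : Type u} [CommRing R] (p : ℕ)

/-- The ideal `J` is closed in the `p`-adic topology of `R`. -/
def IsPadicClosed (J : Ideal R) : Prop :=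
  @IsClosed R (Ideal.span {(p : R)}).adicTopology (J : Set R)

/-- `φ` is strongly topologically nilpotent on `I`: for every `m > 0` there is a finite filtration
`I = F 0 ⊇ F 1 ⊇ ... ⊇ F L = 0` by closed `φ`-invariant ideals such that
`φ(gr F) ⊆ p^m gr F`. -/
def StronglyTopNilpotent (φ : R →+* R) (I : Ideal R) : Prop :=
  ∀ m : ℕ, 0 < m → ∃ (L : ℕ) (F : ℕ → Ideal R), Antitone F ∧ F 0 = I ∧ F L = ⊥ ∧
    (∀ i, IsPadicClosed p (F i) ∧ F i ≤ (F i).comap φ) ∧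
    ∀ i < L, ∀ x ∈ F i, ∃ y ∈ F i, φ x - (p : R) ^ m * y ∈ F (i + 1)

end Padic

end Dwork

end

/-! The canonical section. For every a some iterate φ^n carries I into p^(an+1) I, because each
application of φ either gains a large power of p or descends one step of a finite filtration. Hence
φ^n of a lift of φ_W^{-n}(x) is independent, modulo p^k, of the lift and of n once n is large; the
limit is s(x). The composite W → R → W is the identity, so Li ∘ Lπ is isomorphic to the identity. It
remains to prove that Li, on nondegenerate objects, is full and faithful up to powers of p: after
tensoring with ℚ it is then fully faithful and essentially surjective, and Lπ is its inverse
(`RatCat.exists_equivalence`).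

Reduction to a vanishing statement. Objects are represented by bounded above complexes P', P of
projective R_φ-modules, so that morphisms in the derived category are homotopy classes. Reduction
modulo I is surjective on Hom complexes, and its kernel consists of the R_φ-linear cochains with
values in I P. Fullness and faithfulness up to p-powers follow once every cocycle of this kernel
becomes a boundary in it after multiplication by a power of p (`exists_pow_smul_eq_diffHom`).

The vanishing. Let l', l be the linearized Frobenius maps of P', P. An R-linear cochain f is
R_φ-linear when its defect f ∘ l' - l ∘ φ^*f vanishes. Since P' is projective over R_φ, the defect
maps R-linear cochains with values in I P onto cochains on φ^*P' with values in I P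
(`exists_defect_eq_of_projective`). So the defect has to be bijective on cohomology up to p-powers.
Nondegeneracy and perfectness of P' give a map g that is inverse to l' up to homotopy and a factor
p^a (`isFrobIsogeny_of_isNondegenerate`). Precomposing with g turns the defect into p^a - T, where T
f = l ∘ φ^*f ∘ g. The iterate T^m has values in φ^m(I) P, inside p^(am+1) I P. Formally p^(am) - T^m
= p^(am)(1 - pD), which a geometric series inverts up to p^(am); the kernel is controlled by
separatedness and bounded torsion (`IsPAdicGroup.exists_sub_eq`, `IsPAdicGroup.pow_smul_eq_zero`).
Convergence requires finitely generated projective terms in the target, so P is exchanged for a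
strictly perfect complex of which it is a retract up to homotopy. Only the source has to be
nondegenerate.

Derived functors and nondegeneracy. Bounded above complexes of projective R_φ-modules stay
K-projective after forgetting to R and after base change, so base change of resolutions defines the
derived functors. Being an isogeny up to p^a is preserved by base change and is equivalent to
nondegeneracy on such perfect complexes. -/

noncomputable section

namespace Dwork

/-! ## Topologically nilpotent endomorphisms and the canonical section -/

section CanonicalSection

variable {R : Type u} [CommRing R] {p : ℕ} {φ : R →+* R} {I : Ideal R}

/-- Each application of φ either multiplies by p^(a+1) within one step of the filtration or descends
a step, and at most L descents are possible before reaching 0. So n iterations gain at least (a+1)(n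
- L) factors of p. -/
theorem StronglyTopNilpotent.exists_iterate_eq (hnil : StronglyTopNilpotent p φ I) (a : ℕ) :
    ∃ n : ℕ, ∀ x ∈ I, ∃ y ∈ I, (φ^[n]) x = (p : R) ^ (a * n + 1) * y := by
  obtain ⟨L, F, hanti, h0, hL, -, hF⟩ := hnil (a + 1) a.succ_pos
  have key : ∀ n i, i ≤ L → ∀ x ∈ F i,
      ∃ y ∈ I, (φ^[n]) x = (p : R) ^ ((a + 1) * (n - (L - i))) * y := by
    intro n
    induction n with
    | zero => exact fun i hi x hx => ⟨x, h0 ▸ hanti (Nat.zero_le i) hx, by simp⟩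
    | succ n ih =>
      intro i hi x hx
      rcases hi.eq_or_lt with rfl | hi'
      · rw [hL] at hx
        obtain rfl : x = 0 := hx
        exact ⟨0, I.zero_mem, by rw [iterate_map_zero, mul_zero]⟩
      · obtain ⟨y, hy, hz⟩ := hF i hi' x hx
        obtain ⟨y', hy', ey⟩ := ih i hi y hy
        obtain ⟨z', hz', ez⟩ := ih (i + 1) hi' _ hz
        -- Subtraction is truncated, so the term staying in `F i` may carry more factors of p than
        -- required; the surplus `p ^ k` goes into the witness.
        obtain ⟨k, hk⟩ : ∃ k, (a + 1) + (a + 1) * (n - (L - i)) =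
            (a + 1) * (n + 1 - (L - i)) + k := by
          refine Nat.exists_eq_add_of_le ?_
          rw [add_comm (a + 1), ← Nat.mul_succ]
          exact Nat.mul_le_mul_left _ (by omega)
        refine ⟨(p : R) ^ k * y' + z', I.add_mem (I.mul_mem_left _ hy') hz', ?_⟩
        have e1 : φ x = (p : R) ^ (a + 1) * y + (φ x - (p : R) ^ (a + 1) * y) := by ring
        have hnat : (φ^[n]) (p : R) = p := by rw [← RingHom.coe_pow, map_natCast]
        have e2 : n + 1 - (L - i) = n - (L - (i + 1)) := by omega
        rw [Function.iterate_succ_apply, e1, iterate_map_add, iterate_map_mul, iterate_map_pow,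
          hnat, ey, ez, ← mul_assoc, ← pow_add, hk, ← e2]
        ring
  -- For n = (a+1)L + 1 the gain (a+1)(n - L) equals an + 1 exactly.
  refine ⟨(a + 1) * L + 1, fun x hx => ?_⟩
  obtain ⟨y, hy, e⟩ := key ((a + 1) * L + 1) 0 L.zero_le x (h0 ▸ hx)
  refine ⟨y, hy, ?_⟩
  rw [e]
  congr 2
  rw [Nat.sub_zero, show (a + 1) * L + 1 - L = a * L + 1 by rw [add_mul, one_mul]; omega]
  ring

theorem StronglyTopNilpotent.exists_forall_iterate_mem (hnil : StronglyTopNilpotent p φ I)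
    (hI : I ≤ I.comap φ) (k : ℕ) :
    ∃ n₀ : ℕ, ∀ n, n₀ ≤ n → ∀ x ∈ I, (φ^[n]) x ∈ Ideal.span {(p : R)} ^ k := by
  obtain ⟨n, hn⟩ := hnil.exists_iterate_eq k
  have hiter : ∀ m, ∀ x ∈ I, (φ^[m]) x ∈ I := by
    intro m
    induction m with
    | zero => exact fun x hx => hx
    | succ m ih =>
      intro x hx
      rw [Function.iterate_succ_apply]
      exact ih _ (hI hx)
  rcases Nat.eq_zero_or_pos n with rfl | hpos
  -- For n = 0 the relation says I = pI, so elements of I are divisible by all powers of p.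
  · have hdiv : ∀ j, ∀ x ∈ I, ∃ y ∈ I, x = (p : R) ^ j * y := by
      intro j
      induction j with
      | zero => exact fun x hx => ⟨x, hx, by simp⟩
      | succ j ih =>
        intro x hx
        obtain ⟨y, hy, e⟩ := ih x hx
        obtain ⟨z, hz, e'⟩ := hn y hy
        refine ⟨z, hz, ?_⟩
        rw [e, show y = p ^ (k * 0 + 1) * z from e']
        ring
    refine ⟨0, fun m _ x hx => ?_⟩
    obtain ⟨y, -, e⟩ := hdiv k _ (hiter m x hx)
    rw [e, Ideal.span_singleton_pow]
    exact Ideal.mul_mem_right _ _ (Ideal.mem_span_singleton_self _)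
  · refine ⟨n, fun m hm x hx => ?_⟩
    obtain ⟨j, rfl⟩ := Nat.exists_eq_add_of_le hm
    rw [Function.iterate_add_apply]
    obtain ⟨y, -, e⟩ := hn _ (hiter j x hx)
    rw [e, Ideal.span_singleton_pow]
    refine Ideal.mul_mem_right _ _ (Ideal.mem_span_singleton.2 (pow_dvd_pow _ ?_))
    nlinarith

variable [IsAdicComplete (Ideal.span {(p : R)}) R]

variable (φ) in
-- Write x = φ_W^n(y). The two values at x are φ^n of elements congruent modulo I, so their
-- difference lies in p^k R for every k. Additivity of the sections plays no role.
theorem section_unique (hnil : StronglyTopNilpotent p φ I) (hI : I ≤ I.comap φ)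
    (hsurj : Function.Surjective (Ideal.quotientMap I φ hI)) {s t : R ⧸ I → R}
    (hs : ∀ x, Ideal.Quotient.mk I (s x) = x) (ht : ∀ x, Ideal.Quotient.mk I (t x) = x)
    (hs' : ∀ x, s (Ideal.quotientMap I φ hI x) = φ (s x))
    (ht' : ∀ x, t (Ideal.quotientMap I φ hI x) = φ (t x)) : t = s := by
  funext x
  rw [← sub_eq_zero]
  refine IsHausdorff.haus (I := Ideal.span {(p : R)}) inferInstance _ fun k => ?_
  rw [SModEq.zero, smul_eq_mul, Ideal.mul_top]
  obtain ⟨n, hn⟩ := hnil.exists_forall_iterate_mem hI k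
  obtain ⟨y, rfl⟩ := hsurj.iterate n x
  have e : ∀ r : R ⧸ I → R, (∀ x, r (Ideal.quotientMap I φ hI x) = φ (r x)) →
      r ((Ideal.quotientMap I φ hI)^[n] y) = (φ^[n]) (r y) :=
    fun r hr => (Function.Semiconj.iterate_right (f := r) (fun x => hr x) n) y
  rw [e t ht', e s hs', ← iterate_map_sub]
  refine hn n le_rfl _ (Ideal.Quotient.eq_zero_iff_mem.1 ?_)
  rw [map_sub, hs, ht, sub_self]

variable (φ) in
-- Modulo p^k, the value at x is φ^n(r) with r a lift of φ_W^{-n}(x) and n large. This defines ring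
-- homomorphisms to R/p^k, which glue by completeness. That the result is a section is checked
-- modulo all powers of p in R/I, whence the separatedness assumption `hW`.
theorem exists_section (hnil : StronglyTopNilpotent p φ I) (hI : I ≤ I.comap φ)
    (hbij : Function.Bijective (Ideal.quotientMap I φ hI))
    (hW : ∀ x : R ⧸ I, (∀ k, x ∈ Ideal.span {(p : R ⧸ I)} ^ k) → x = 0) :
    ∃ s : R ⧸ I →+* R, s.comp (Ideal.quotientMap I φ hI) = φ.comp s ∧
      (Ideal.Quotient.mk I).comp s = RingHom.id (R ⧸ I) := by
  let J := Ideal.span {(p : R)}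
  choose n hn using hnil.exists_forall_iterate_mem hI
  let e := RingEquiv.ofBijective _ hbij
  have he : ∀ x, e x = Ideal.quotientMap I φ hI x := fun _ => rfl
  have hsymm : ∀ m r, ((e.symm^[m]) (Ideal.Quotient.mk I ((φ^[m]) r))) = Ideal.Quotient.mk I r := by
    intro m
    induction m with
    | zero => exact fun r => rfl
    | succ m ih =>
      intro r
      have h : Ideal.Quotient.mk I ((φ^[m + 1]) r) = e (Ideal.Quotient.mk I ((φ^[m]) r)) := by
        rw [Function.iterate_succ_apply', he]
        exact (Ideal.quotientMap_mk (H := hI)).symm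
      rw [Function.iterate_succ_apply, h, e.symm_apply_apply, ih]
  have hφpow : ∀ m r, (φ ^ m) r = (φ^[m]) r := fun m r => by rw [RingHom.coe_pow]
  have hepow : ∀ (m : ℕ) (x : R ⧸ I), ((e.symm : R ⧸ I →+* R ⧸ I) ^ m) x = (e.symm^[m]) x :=
    fun m r => by rw [RingHom.coe_pow]; rfl
  let σ : ∀ k, R ⧸ I →+* R ⧸ J ^ k := fun k =>
    (Ideal.Quotient.lift I ((Ideal.Quotient.mk (J ^ k)).comp (φ ^ n k)) (fun x hx =>
      Ideal.Quotient.eq_zero_iff_mem.2 (by rw [hφpow]; exact hn k _ le_rfl x hx))).comp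
      ((e.symm : R ⧸ I →+* R ⧸ I) ^ n k)
  -- Any sufficiently large m and any lift r compute `σ k x`; the remaining verifications are
  -- suitable choices of m and r.
  have hσ : ∀ k m, n k ≤ m → ∀ x r, Ideal.Quotient.mk I r = (e.symm^[m]) x →
      σ k x = Ideal.Quotient.mk (J ^ k) ((φ^[m]) r) := by
    intro k m hm x r hr
    obtain ⟨j, rfl⟩ := Nat.exists_eq_add_of_le hm
    have h1 : ((e.symm : R ⧸ I →+* R ⧸ I) ^ n k) x = Ideal.Quotient.mk I ((φ^[j]) r) := by
      rw [hepow]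
      apply (e.symm.injective.iterate j)
      rw [← Function.iterate_add_apply, add_comm, ← hr, hsymm]
    simp only [σ, RingHom.comp_apply, h1, Ideal.Quotient.lift_mk, hφpow]
    rw [Function.iterate_add_apply]
  have hcompat : ∀ {k l : ℕ} (hle : k ≤ l),
      (Ideal.Quotient.factorPow J hle).comp (σ l) = σ k := by
    intro k l hle
    refine RingHom.ext fun x => ?_
    obtain ⟨r, hr⟩ := Ideal.Quotient.mk_surjective ((e.symm^[max (n k) (n l)]) x)
    rw [RingHom.comp_apply, hσ k _ (le_max_left _ _) x r hr, hσ l _ (le_max_right _ _) x r hr]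
    rfl
  let s := IsAdicComplete.liftRingHom J σ hcompat
  have hs : ∀ k x, Ideal.Quotient.mk (J ^ k) (s x) = σ k x :=
    fun k x => IsAdicComplete.mk_liftRingHom J σ hcompat k x
  refine ⟨s, ?_, ?_⟩
  · refine RingHom.ext fun x => ?_
    rw [← sub_eq_zero]
    refine IsHausdorff.haus (I := J) inferInstance _ fun k => ?_
    rw [SModEq.zero, smul_eq_mul, Ideal.mul_top, ← Ideal.Quotient.eq_zero_iff_mem, map_sub,
      RingHom.comp_apply, RingHom.comp_apply, hs, sub_eq_zero]
    obtain ⟨r, hr⟩ := Ideal.Quotient.mk_surjective ((e.symm^[n k]) x)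
    have h1 : σ k x = Ideal.Quotient.mk (J ^ k) ((φ^[n k]) r) := hσ k _ le_rfl x r hr
    -- One more iteration for φ_W(x) allows the same lift `r` on both sides.
    rw [hσ k (n k + 1) (Nat.le_succ _) (Ideal.quotientMap I φ hI x) r
      (by rw [Function.iterate_succ_apply, ← he, e.symm_apply_apply, hr]),
      Function.iterate_succ_apply', Ideal.Quotient.eq, ← map_sub]
    rw [← hs, Ideal.Quotient.eq] at h1
    have h2 := Ideal.mem_map_of_mem φ h1
    rw [Ideal.map_pow, Ideal.map_span, Set.image_singleton, map_natCast] at h2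
    have h3 := (J ^ k).neg_mem h2
    rwa [← map_neg, neg_sub] at h3
  · refine RingHom.ext fun x => ?_
    rw [RingHom.comp_apply, RingHom.id_apply, ← sub_eq_zero]
    refine hW _ fun k => ?_
    obtain ⟨r, hr⟩ := Ideal.Quotient.mk_surjective ((e.symm^[n k]) x)
    have h1 : σ k x = Ideal.Quotient.mk (J ^ k) ((φ^[n k]) r) := hσ k _ le_rfl x r hr
    rw [← hs, Ideal.Quotient.eq] at h1
    have h2 := Ideal.mem_map_of_mem (Ideal.Quotient.mk I) h1
    rw [Ideal.map_pow, Ideal.map_span, Set.image_singleton, map_natCast, map_sub] at h2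
    have h3 : Ideal.Quotient.mk I ((φ^[n k]) r) = x := by
      apply e.symm.injective.iterate (n k)
      rw [hsymm, hr]
    rwa [h3] at h2

end CanonicalSection

/-! ## Integers in `p`-adically complete rings -/

section Units

variable {R : Type u} [CommRing R] (p : ℕ)

/-- Every integer prime to `p` is invertible in `R`. -/
def PrimeToUnits (R : Type u) [CommRing R] (p : ℕ) : Prop :=
  ∀ n : ℕ, n.Coprime p → IsUnit (n : R)

/-- By completeness p lies in the Jacobson radical, and Bézout writes a multiple of n as 1 plus a
multiple of p. -/
theorem primeToUnits_of_isAdicComplete [IsAdicComplete (Ideal.span {(p : R)}) R] :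
    PrimeToUnits R p := by
  intro n hn
  have h1 := IsAdicComplete.le_jacobson_bot (Ideal.span {(p : R)})
  have h2 : (p : R) ∈ (⊥ : Ideal R).jacobson := h1 (Ideal.mem_span_singleton_self _)
  have h3 := Int.gcd_eq_gcd_ab n p
  rw [Int.gcd_natCast_natCast, hn, Nat.cast_one] at h3
  have h4 : IsUnit ((n : R) * (Int.gcdA n p : R)) := by
    have h5 : (n : R) * (Int.gcdA n p : R) = (p : R) * (- (Int.gcdB n p : R)) + 1 := by
      have := congrArg (Int.cast (R := R)) h3
      push_cast at this
      linear_combination -this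
    rw [h5]
    exact Ideal.mem_jacobson_bot.1 h2 _
  exact isUnit_of_mul_isUnit_left h4

theorem PrimeToUnits.map {S : Type u} [CommRing S] {p : ℕ} (h : PrimeToUnits R p) (f : R →+* S) :
    PrimeToUnits S p := fun n hn => by
  simpa using (h n hn).map f

/-- Because of this, denominators arising from tensoring with ℚ can always be taken to be powers of
p. -/
theorem PrimeToUnits.exists_eq {p : ℕ} [hp : Fact p.Prime] (h : PrimeToUnits R p) (n : ℤ) (hn : n ≠ 0) :
    ∃ (a : ℕ) (r s : R), r * s = 1 ∧ (n : R) = r * (p : R) ^ a := by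
  obtain ⟨a, m, hm, e⟩ := Nat.exists_eq_pow_mul_and_not_dvd (Int.natAbs_ne_zero.2 hn) p hp.1.ne_one
  obtain ⟨r, hr⟩ := h m ((Nat.Prime.coprime_iff_not_dvd hp.1).2 hm).symm
  rcases Int.natAbs_eq n with h' | h'
  · refine ⟨a, r, (r⁻¹ : Rˣ), by simp, ?_⟩
    rw [h', e]; push_cast; rw [hr]; ring
  · refine ⟨a, -r, -(r⁻¹ : Rˣ), by simp, ?_⟩
    rw [h', e]; push_cast; rw [hr]; ring

end Units

/-! ## Perturbations of powers of `p` on `p`-adically complete groups -/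

section Perturbation

/-- An abelian group is `p`-adically separated and complete with bounded `p`-power torsion. -/
structure IsPAdicGroup (p : ℕ) (A : Type v) [AddCommGroup A] : Prop where
  complete : ∀ b : ℕ → A, ∃ x, ∀ n, ∃ y, x - ∑ k ∈ Finset.range n, p ^ k • b k = p ^ n • y
  separated : ∀ x : A, (∀ n, ∃ y, x = p ^ n • y) → x = 0
  torsion : ∃ c : ℕ, ∀ (n : ℕ) (x : A), p ^ n • x = 0 → p ^ c • x = 0

variable {p : ℕ} {A : Type v} [AddCommGroup A] {T : AddMonoid.End A} {a n : ℕ}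

/-- Formally T^n = p^(an+1) D, so p^(an) - T^n = p^(an)(1 - pD) is inverted up to p^(an) by x = ∑
p^k D^k y; and p^a - T is a left factor of p^(an) - T^n. In the presence of torsion D is only a
choice function, so the series runs over the sequence `w k` of its iterates at y. -/
theorem IsPAdicGroup.exists_sub_eq (hA : IsPAdicGroup p A)
    (hT : ∀ x, ∃ y, (T ^ n) x = p ^ (a * n + 1) • y) (y : A) :
    ∃ x, p ^ a • x - T x = p ^ (a * n) • y := by
  choose D hD using hT
  let w : ℕ → A := fun k => Nat.rec y (fun _ x => D x) k
  have hw : ∀ k, (T ^ n) (w k) = p ^ (a * n + 1) • w (k + 1) := fun k => hD (w k)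
  obtain ⟨x, hx⟩ := hA.complete w
  have key : p ^ (a * n) • x - (T ^ n) x = p ^ (a * n) • y := by
    rw [← sub_eq_zero]
    refine hA.separated _ fun m => ?_
    obtain ⟨v, hv⟩ := hx m
    have hx' : x = ∑ k ∈ Finset.range m, p ^ k • w k + p ^ m • v := by rw [← hv]; abel
    refine ⟨p ^ (a * n) • v - (T ^ n) v - p ^ (a * n) • w m, ?_⟩
    have h1 : (T ^ n) (∑ k ∈ Finset.range m, p ^ k • w k) =
        ∑ k ∈ Finset.range m, p ^ (a * n) • (p ^ (k + 1) • w (k + 1)) := by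
      rw [map_sum]
      refine Finset.sum_congr rfl fun k _ => ?_
      rw [map_nsmul, hw, smul_smul, smul_smul]
      congr 1
      ring
    have h2 := Finset.sum_range_succ' (fun k => p ^ k • w k) m
    rw [Finset.sum_range_succ] at h2
    have h3 : w 0 = y := rfl
    rw [pow_zero, one_smul, h3] at h2
    have h4 : ∑ k ∈ Finset.range m, p ^ (k + 1) • w (k + 1) =
      ∑ k ∈ Finset.range m, p ^ k • w k + p ^ m • w m - y := by rw [h2]; abel
    rw [hx', map_add, h1, ← Finset.smul_sum, h4, map_nsmul]
    simp only [smul_add, smul_sub]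
    rw [smul_comm (p ^ m) (p ^ (a * n)) v, smul_comm (p ^ m) (p ^ (a * n)) (w m)]
    abel
  have hc : Commute (((p ^ a : ℕ) : AddMonoid.End A)) T := Nat.cast_commute _ _
  obtain ⟨Q, hQ⟩ := hc.sub_dvd_pow_sub_pow n
  refine ⟨Q x, ?_⟩
  have h5 := congrArg (fun f : AddMonoid.End A => f x) hQ
  have h6 : ((((p ^ a : ℕ) : AddMonoid.End A)) ^ n) x = p ^ (a * n) • x := by
    rw [← Nat.cast_pow, ← pow_mul]
    exact AddMonoid.End.natCast_apply _ _
  have h7 : (((p ^ a : ℕ) : AddMonoid.End A)) (Q x) = p ^ a • Q x :=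
    AddMonoid.End.natCast_apply _ _
  rw [← key, ← h6, ← h7]
  exact h5.symm

/-- Iterating p^a x = T x gives p^(ank) x = T^(nk) x = p^((an+1)k) y. Thus x - p^k y is p-power
torsion, hence killed by p^c, and p^c x is divisible by every p^k. -/
theorem IsPAdicGroup.pow_smul_eq_zero (hA : IsPAdicGroup p A)
    (hT : ∀ x, ∃ y, (T ^ n) x = p ^ (a * n + 1) • y) :
    ∃ c : ℕ, ∀ x, p ^ a • x = T x → p ^ c • x = 0 := by
  choose D hD using hT
  obtain ⟨c, hc⟩ := hA.torsion
  refine ⟨c, fun x hx => hA.separated _ fun k => ?_⟩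
  have hmul : ∀ (f g : AddMonoid.End A) (z : A), (f * g) z = f (g z) := fun _ _ _ => rfl
  have h0 : ∀ j, (T ^ j) x = p ^ (a * j) • x := by
    intro j
    induction j with
    | zero => simp
    | succ j ih =>
      rw [pow_succ', hmul, ih, map_nsmul, ← hx, smul_smul, ← pow_add]
      congr 2
  have h1 : ∀ j, ∃ y, (T ^ (n * j)) x = p ^ ((a * n + 1) * j) • y := by
    intro j
    induction j with
    | zero => exact ⟨x, by simp⟩
    | succ j ih =>
      obtain ⟨y, hy⟩ := ih
      refine ⟨D y, ?_⟩
      rw [mul_add, mul_one, add_comm, pow_add, hmul, hy, map_nsmul, hD, smul_smul]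
      congr 1
      ring
  obtain ⟨y, hy⟩ := h1 k
  rw [h0] at hy
  refine ⟨p ^ c • y, ?_⟩
  have h2 : p ^ (a * (n * k)) • (x - p ^ k • y) = 0 := by
    rw [smul_sub, hy, smul_smul, sub_eq_zero]
    congr 1
    ring
  have h3 := hc _ _ h2
  rw [smul_sub, sub_eq_zero] at h3
  rw [h3, smul_comm]

end Perturbation

end Dwork

namespace Dwork

/-! ## Projective resolutions of cohomologically bounded above complexes -/

section Resolutions

open CochainComplex HomologicalComplex Opposite

variable {𝒞 : Type u} [Category.{v} 𝒞] [Abelian 𝒞]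

theorem quasiIso_of_quasiIso_opEquivalence {K L : CochainComplex 𝒞 ℤ} (f : K ⟶ L)
    (hf : QuasiIso ((CochainComplex.opEquivalence 𝒞).functor.map f.op)) : QuasiIso f := by
  rw [← quasiIso_opFunctor_map_iff]
  refine ⟨fun n => ?_⟩
  obtain ⟨m, rfl⟩ : ∃ m, n = -m := ⟨-n, by simp⟩
  have h := hf.quasiIsoAt m
  rw [quasiIsoAt_iff' _ (m - 1) m (m + 1) (by simp) (by simp)] at h
  rw [quasiIsoAt_iff' _ (-(m - 1)) (-m) (-(m + 1))
    (ComplexShape.prev_eq' _ (show -m + 1 = -(m - 1) by ring))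
    (ComplexShape.next_eq' _ (show -(m + 1) + 1 = -m by ring))]
  exact h

/-- Dual to injective resolutions of bounded below complexes: truncate at n, pass to the opposite
category, where degrees change sign, and resolve there. -/
theorem exists_projective_quasiIso [EnoughProjectives 𝒞] (K : CochainComplex 𝒞 ℤ) (n : ℤ)
    [K.IsLE n] : ∃ (P : CochainComplex 𝒞 ℤ) (f : P ⟶ K), QuasiIso f ∧
      (∀ i, Projective (P.X i)) ∧ P.IsStrictlyLE n := by
  let K' := K.truncLE n
  let L := (CochainComplex.opEquivalence 𝒞).functor.obj (op K')
  have : L.IsStrictlyGE (-n) := by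
    rw [isStrictlyGE_iff]
    intro i hi
    exact (K'.isZero_of_isStrictlyLE n _ (show n < -i by lia)).op
  obtain ⟨L', i, _, _, _⟩ := CochainComplex.Plus.modelCategoryQuillen.exists_quasiIso_injective L (-n)
  let g := (CochainComplex.opEquivalence 𝒞).unitIso.hom.app (op K') ≫ (CochainComplex.opEquivalence 𝒞).inverse.map i
  let P := ((CochainComplex.opEquivalence 𝒞).inverse.obj L').unop
  have hg : QuasiIso g.unop := by
    apply quasiIso_of_quasiIso_opEquivalence
    rw [Quiver.Hom.op_unop]
    have h : (CochainComplex.opEquivalence 𝒞).functor.map g ≫ (CochainComplex.opEquivalence 𝒞).counitIso.hom.app L' = i := by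
      simp [g]
    exact (quasiIso_iff_comp_right _ ((CochainComplex.opEquivalence 𝒞).counitIso.hom.app L')).1 (h ▸ inferInstance)
  refine ⟨P, g.unop ≫ K.ιTruncLE n, inferInstance, fun j => ?_, ?_⟩
  · have : Injective (L'.X (-j)) := inferInstance
    change Projective (unop (L'.X (-j)))
    infer_instance
  · rw [isStrictlyLE_iff]
    intro j hj
    have := (L'.isZero_of_isStrictlyGE (-n) (-j) (by lia)).unop
    exact this

end Resolutions
end Dwork

namespace Dwork

/-! ## Base change of modules along ring homomorphisms -/

section ExtendScalars

variable {R S : Type u} [CommRing R] [CommRing S] (f : R →+* S)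

/-- The map `M → S ⊗_R M`, `m ↦ 1 ⊗ m`. -/
def oneTmul (M : ModuleCat.{u} R) (m : M) : (ModuleCat.extendScalars.{u, u, u} f).obj M :=
  ((ModuleCat.extendRestrictScalarsAdj f).unit.app M).hom m

theorem oneTmul_add (M : ModuleCat.{u} R) (x y : M) :
    oneTmul f M (x + y) = oneTmul f M x + oneTmul f M y :=
  ((ModuleCat.extendRestrictScalarsAdj f).unit.app M).hom.map_add x y

theorem oneTmul_smul (M : ModuleCat.{u} R) (r : R) (m : M) :
    oneTmul f M (r • m) = f r • oneTmul f M m :=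
  ((ModuleCat.extendRestrictScalarsAdj f).unit.app M).hom.map_smul r m

variable {f}

theorem extendScalars_induction {M : ModuleCat.{u} R}
    {P : (ModuleCat.extendScalars.{u, u, u} f).obj M → Prop}
    (x : (ModuleCat.extendScalars.{u, u, u} f).obj M)
    (add : ∀ x y, P x → P y → P (x + y))
    (smul_one : ∀ (s : S) (m : M), P (s • oneTmul f M m)) : P x := by
  let : Algebra R S := f.toAlgebra
  refine TensorProduct.induction_on (motive := P) x ?_ ?_ add
  · have := smul_one 0 0
    rwa [zero_smul] at this
  · intro (s : S) m
    have h := ModuleCat.ExtendScalars.smul_tmul f s 1 m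
    rw [mul_one] at h
    exact h ▸ smul_one s m

theorem extendScalars_hom_ext {M : ModuleCat.{u} R} {N : ModuleCat.{u} S}
    {α β : (ModuleCat.extendScalars f).obj M ⟶ N}
    (h : ∀ m : M, α.hom (oneTmul f M m) = β.hom (oneTmul f M m)) : α = β :=
  ModuleCat.ExtendScalars.hom_ext h

theorem extendScalars_map_oneTmul {M N : ModuleCat.{u} R} (g : M ⟶ N) (m : M) :
    ((ModuleCat.extendScalars f).map g).hom (oneTmul f M m) = oneTmul f N (g.hom m) := rfl

theorem homEquiv_symm_oneTmul {M : ModuleCat.{u} R} {N : ModuleCat.{u} S}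
    (g : M ⟶ (ModuleCat.restrictScalars f).obj N) (m : M) :
    (((ModuleCat.extendRestrictScalarsAdj f).homEquiv M N).symm g).hom (oneTmul f M m) =
      g.hom m := by
  have h := ((ModuleCat.extendRestrictScalarsAdj f).homEquiv M N).apply_symm_apply g
  exact congrArg (fun k => k.hom m) h

end ExtendScalars

/-! ## Morphisms of `R_φ`-modules -/

section Modules

variable {R : Type u} [CommRing R] {φ : R →+* R}

/-- The `φ`-action on the underlying `R`-module of an `R_φ`-module. -/
def act (M : FMod φ) (m : (forgetFrob φ).obj M) : (forgetFrob φ).obj M :=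
  ((frob φ).app M).hom m

theorem act_add (M : FMod φ) (x y : (forgetFrob φ).obj M) :
    act M (x + y) = act M x + act M y :=
  ((frob φ).app M).hom.map_add x y

theorem act_smul (M : FMod φ) (r : R) (x : (forgetFrob φ).obj M) :
    act M (r • x) = φ r • act M x :=
  ((frob φ).app M).hom.map_smul r x

theorem map_act {M N : FMod φ} (g : M ⟶ N) (m : (forgetFrob φ).obj M) :
    ((forgetFrob φ).map g).hom (act M m) = act N (((forgetFrob φ).map g).hom m) :=
  congrArg (fun k => k.hom m) ((frob φ).naturality g).symm

theorem frobLin_oneTmul (M : FMod φ) (m : (forgetFrob φ).obj M) :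
    ((frobLin φ).app M).hom (oneTmul φ ((forgetFrob φ).obj M) m) = act M m :=
  homEquiv_symm_oneTmul _ _

/-- An `R`-linear map that commutes with the Frobenius is `R_φ`-linear. -/
def homMk {M N : FMod φ} (g : (forgetFrob φ).obj M ⟶ (forgetFrob φ).obj N)
    (h : ∀ m, g.hom (act M m) = act N (g.hom m)) : M ⟶ N :=
  ModuleCat.ofHom
    { toFun := fun m => g.hom m
      map_add' := fun x y => g.hom.map_add x y
      map_smul' := fun a => by
        refine SkewRing.induction (φ := φ) (P := fun a => ∀ n : M,
          (show N from g.hom (a • n : M)) = a • (show N from g.hom n)) a ?_ ?_ ?_ ?_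
        · intro a b ha hb n
          rw [add_smul, add_smul, ← ha, ← hb]
          exact g.hom.map_add _ _
        · intro a b ha hb n
          rw [mul_smul, mul_smul, ha, hb]
        · exact fun r n => g.hom.map_smul r _
        · exact h }

/-- Turns linearity over R_φ into the vanishing of an expression that is additive in g and makes
sense for cochains. -/
theorem frobLin_comp_eq_iff {M N : FMod φ} (g : (forgetFrob φ).obj M ⟶ (forgetFrob φ).obj N) :
    (frobLin φ).app M ≫ g = (ModuleCat.extendScalars φ).map g ≫ (frobLin φ).app N ↔
      ∀ m, g.hom (act M m) = act N (g.hom m) := by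
  have h1 : ∀ m, ((frobLin φ).app M ≫ g).hom (oneTmul φ ((forgetFrob φ).obj M) m) =
      g.hom (act M m) := fun m => congrArg g.hom (frobLin_oneTmul M m)
  have h2 : ∀ m, ((ModuleCat.extendScalars φ).map g ≫ (frobLin φ).app N).hom
      (oneTmul φ ((forgetFrob φ).obj M) m) = act N (g.hom m) :=
    fun m => frobLin_oneTmul N _
  constructor
  · intro h m
    rw [← h1, h]
    exact h2 m
  · intro h
    refine extendScalars_hom_ext fun m => ?_
    exact (h1 m).trans ((h m).trans (h2 m).symm)

/-- The underlying `R`-module of the `R_φ`-module defined by a semilinear endomorphism. -/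
def forgetOfFrob (N : ModuleCat.{u} R) (T : N ⟶ (ModuleCat.restrictScalars φ).obj N) :
    (forgetFrob φ).obj (ofFrob N T) ≅ N :=
  LinearEquiv.toModuleIso (X₁ := (forgetFrob φ).obj (ofFrob N T)) (g₁ := inferInstance)
    (m₁ := ((forgetFrob φ).obj (ofFrob N T)).isModule)
    { toFun := fun n => n
      invFun := fun n => n
      map_add' := fun _ _ => rfl
      map_smul' := fun r n => ofFrob_C_smul N T r n
      left_inv := fun _ => rfl
      right_inv := fun _ => rfl }

theorem forgetOfFrob_act (N : ModuleCat.{u} R) (T : N ⟶ (ModuleCat.restrictScalars φ).obj N)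
    (x : (forgetFrob φ).obj (ofFrob N T)) :
    (forgetOfFrob N T).hom.hom (act _ x) = T.hom ((forgetOfFrob N T).hom.hom x) :=
  ofFrob_X_smul N T x

variable {S : Type u} [CommRing S] {ψ : S →+* S} (f : R →+* S) (hf : f.comp φ = ψ.comp f)

/-- Base change of `R_φ`-modules is base change of the underlying `R`-modules. -/
def baseChangeForget :
    baseChange f hf ⋙ forgetFrob ψ ≅ forgetFrob φ ⋙ ModuleCat.extendScalars f :=
  NatIso.ofComponents (fun M => forgetOfFrob _ (baseChangeFrob f hf M)) (fun g => by
    ext m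
    rfl)

theorem baseChangeForget_act (M : FMod φ) (s : S) (m : (forgetFrob φ).obj M)
    (x : (forgetFrob ψ).obj ((baseChange f hf).obj M))
    (hx : ((baseChangeForget f hf).hom.app M).hom x =
      s • oneTmul f ((forgetFrob φ).obj M) m) :
    ((baseChangeForget f hf).hom.app M).hom (act _ x) =
      ψ s • oneTmul f ((forgetFrob φ).obj M) (act M m) := by
  refine (forgetOfFrob_act _ (baseChangeFrob f hf M) x).trans ?_
  refine (congrArg (baseChangeFrob f hf M).hom hx).trans ?_
  refine ((baseChangeFrob f hf M).hom.map_smul s _).trans ?_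
  exact congrArg (fun z : (ModuleCat.extendScalars f).obj ((forgetFrob φ).obj M) => ψ s • z)
    (homEquiv_symm_oneTmul _ m)

/-- The ring homomorphism `R_φ → S_ψ` induced by `f`. -/
def SkewRing.map : SkewRing φ →+* SkewRing ψ :=
  SkewRing.lift ((SkewRing.C ψ).comp f) (SkewRing.X ψ) fun r => by
    rw [RingHom.comp_apply, RingHom.comp_apply, SkewRing.X_mul_C]
    congr 2
    exact (RingHom.congr_fun hf r).symm

theorem SkewRing.map_C (r : R) : SkewRing.map f hf (SkewRing.C φ r) = SkewRing.C ψ (f r) :=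
  SkewRing.lift_C _ _ _ r

theorem SkewRing.map_X : SkewRing.map f hf (SkewRing.X φ) = SkewRing.X ψ :=
  SkewRing.lift_X _ _ _

/-- Restriction of scalars from `S_ψ`-modules to `R_φ`-modules. -/
abbrev restrictFrob : FMod ψ ⥤ FMod φ := ModuleCat.restrictScalars (SkewRing.map f hf)

/-- Restriction of scalars is compatible with the underlying modules. -/
def restrictForget :
    restrictFrob f hf ⋙ forgetFrob φ ≅ forgetFrob ψ ⋙ ModuleCat.restrictScalars f :=
  NatIso.ofComponents (fun N => LinearEquiv.toModuleIso
    (X₁ := (forgetFrob φ).obj ((restrictFrob f hf).obj N))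
    (m₁ := ((forgetFrob φ).obj ((restrictFrob f hf).obj N)).isModule)
    (m₂ := ((ModuleCat.restrictScalars f).obj ((forgetFrob ψ).obj N)).isModule)
    { toFun := fun n => n
      invFun := fun n => n
      map_add' := fun _ _ => rfl
      map_smul' := fun r n => congrArg (fun a : SkewRing ψ => a • (show N from n))
        (SkewRing.map_C f hf r)
      left_inv := fun _ => rfl
      right_inv := fun _ => rfl }) (fun g => by ext m; rfl)

theorem restrictForget_act (N : FMod ψ) (n : (forgetFrob φ).obj ((restrictFrob f hf).obj N)) :
    @Eq ((forgetFrob ψ).obj N) (((restrictForget f hf).hom.app N).hom (act _ n))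
      (act N (((restrictForget f hf).hom.app N).hom n)) :=
  congrArg (fun a : SkewRing ψ => a • (show N from n))
    (SkewRing.map_X f hf)

/-- The `R_φ`-linear map `M → S ⊗_R M`. -/
def baseUnit (M : FMod φ) : M ⟶ (restrictFrob f hf).obj ((baseChange f hf).obj M) :=
  homMk ((ModuleCat.extendRestrictScalarsAdj f).unit.app _ ≫
    (ModuleCat.restrictScalars f).map ((baseChangeForget f hf).inv.app M) ≫
      (restrictForget f hf).inv.app _) fun m => by
    have h := baseChangeForget_act f hf M 1 m
      (((baseChangeForget f hf).inv.app M).hom (oneTmul f _ m)) (by rw [one_smul]; rfl)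
    rw [map_one, one_smul] at h
    exact h.symm.trans (restrictForget_act f hf ((baseChange f hf).obj M)
      (((baseChangeForget f hf).inv.app M).hom (oneTmul f _ m))).symm

variable {f hf} in
-- Semilinearity propagates compatibility from the generators 1 ⊗ m to the whole base change.
theorem hom_act_of_oneTmul {M : FMod φ} {N : FMod ψ}
    (E : (ModuleCat.extendScalars f).obj ((forgetFrob φ).obj M) ⟶ (forgetFrob ψ).obj N)
    (hE : ∀ m, E.hom (oneTmul f _ (act M m)) = act N (E.hom (oneTmul f _ m)))
    (x : (forgetFrob ψ).obj ((baseChange f hf).obj M)) :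
    E.hom (((baseChangeForget f hf).hom.app M).hom (act _ x)) =
      act N (E.hom (((baseChangeForget f hf).hom.app M).hom x)) := by
  obtain ⟨y, hy⟩ : ∃ y : (ModuleCat.extendScalars f).obj ((forgetFrob φ).obj M),
    ((baseChangeForget f hf).hom.app M).hom x = y := ⟨_, rfl⟩
  induction y using extendScalars_induction generalizing x with
  | add y z ihy ihz =>
    obtain ⟨x₁, h₁⟩ : ∃ x₁, ((baseChangeForget f hf).hom.app M).hom x₁ = y := ⟨y, rfl⟩
    obtain ⟨x₂, h₂⟩ : ∃ x₂, ((baseChangeForget f hf).hom.app M).hom x₂ = z := ⟨z, rfl⟩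
    obtain rfl : x = x₁ + x₂ := by
      rw [← h₁, ← h₂, ← map_add] at hy
      exact hy
    rw [act_add, map_add, map_add, map_add, map_add, act_add, ihy _ h₁, ihz _ h₂]
  | smul_one s m =>
    rw [baseChangeForget_act f hf M s m x hy, map_smul, hE, hy, map_smul, act_smul]

/-- The `S_ψ`-linear map `S ⊗_R M → N` defined by an `R_φ`-linear map `M → N`. -/
def baseDesc {M : FMod φ} {N : FMod ψ} (g : M ⟶ (restrictFrob f hf).obj N) :
    (baseChange f hf).obj M ⟶ N :=
  homMk ((baseChangeForget f hf).hom.app M ≫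
    ((ModuleCat.extendRestrictScalarsAdj f).homEquiv ((forgetFrob φ).obj M)
      ((forgetFrob ψ).obj N)).symm ((forgetFrob φ).map g ≫ (restrictForget f hf).hom.app N))
    (hom_act_of_oneTmul _ fun m => by
      have h1 := homEquiv_symm_oneTmul ((forgetFrob φ).map g ≫ (restrictForget f hf).hom.app N)
      refine (h1 _).trans (Eq.trans ?_ (congrArg (act N) (h1 m).symm))
      refine Eq.trans ?_ (restrictForget_act f hf N _)
      exact congrArg ((restrictForget f hf).hom.app N).hom (map_act g m))

theorem baseUnit_baseDesc {M : FMod φ} {N : FMod ψ} (g : M ⟶ (restrictFrob f hf).obj N) :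
    baseUnit f hf M ≫ (restrictFrob f hf).map (baseDesc f hf g) = g := by
  ext m
  exact homEquiv_symm_oneTmul ((forgetFrob φ).map g ≫ (restrictForget f hf).hom.app N) m

theorem baseChange_hom_ext {M : FMod φ} {N : FMod ψ} {g g' : (baseChange f hf).obj M ⟶ N}
    (h : baseUnit f hf M ≫ (restrictFrob f hf).map g =
      baseUnit f hf M ≫ (restrictFrob f hf).map g') : g = g' := by
  apply (forgetFrob ψ).map_injective
  rw [← cancel_epi ((baseChangeForget f hf).inv.app M)]
  exact extendScalars_hom_ext fun m => congrArg (fun k => k.hom m) h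

/-- Base change is left adjoint to restriction of scalars. -/
def baseChangeAdj : baseChange f hf ⊣ restrictFrob f hf :=
  Adjunction.mkOfHomEquiv
    { homEquiv := fun M N =>
        { toFun := fun g => baseUnit f hf M ≫ (restrictFrob f hf).map g
          invFun := baseDesc f hf
          left_inv := fun g => baseChange_hom_ext f hf (baseUnit_baseDesc f hf _)
          right_inv := baseUnit_baseDesc f hf }
      homEquiv_naturality_left_symm := fun g h => by
        apply baseChange_hom_ext
        rw [Functor.map_comp, ← Category.assoc]
        have h1 := baseUnit_baseDesc f hf h
        have h2 := baseUnit_baseDesc f hf (g ≫ h)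
        refine h2.trans ?_
        conv_lhs => rw [← h1]
        rfl
      homEquiv_naturality_right := fun {M _ _} g h => by
        change baseUnit f hf M ≫ (restrictFrob f hf).map (g ≫ h) =
          (baseUnit f hf M ≫ (restrictFrob f hf).map g) ≫ (restrictFrob f hf).map h
        rw [Category.assoc, ← Functor.map_comp] }

theorem baseUnit_naturality {M N : FMod φ} (g : M ⟶ N) :
    g ≫ baseUnit f hf N =
      baseUnit f hf M ≫ (restrictFrob f hf).map ((baseChange f hf).map g) := rfl

instance : (baseChange f hf).PreservesProjectiveObjects :=
  Functor.preservesProjectiveObjects_of_adjunction_of_preservesEpimorphisms (baseChangeAdj f hf)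

/-! ### Compositions of base changes -/

variable {φ : R →+* R} {ψ : S →+* S}

/-- Base change along a section followed by base change along the retraction is the identity. -/
def baseChangeSectionIso (f : R →+* S) (hf : f.comp φ = ψ.comp f) (g : S →+* R)
    (hg : g.comp ψ = φ.comp g) (hgf : g.comp f = RingHom.id R) :
    baseChange f hf ⋙ baseChange g hg ≅ 𝟭 (FMod φ) :=
  -- Left adjoints are determined by their right adjoints, and restriction along R_φ → S_ψ → R_φ is
  -- restriction along the identity.
  ((conjugateIsoEquiv ((baseChangeAdj f hf).comp (baseChangeAdj g hg)) Adjunction.id).symm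
    ((ModuleCat.restrictScalarsComp' (SkewRing.map f hf) (SkewRing.map g hg) _ rfl).symm ≪≫
      (ModuleCat.restrictScalarsId' ((SkewRing.map g hg).comp (SkewRing.map f hf)) (by
      refine RingHom.ext fun a => ?_
      refine SkewRing.induction (φ := φ) (P := fun a => ((SkewRing.map g hg).comp
        (SkewRing.map f hf)) a = RingHom.id _ a) a ?_ ?_ ?_ ?_
      · intro a b ha hb
        rw [map_add, map_add, ha, hb]
      · intro a b ha hb
        rw [map_mul, map_mul, ha, hb]
      · intro r
        rw [RingHom.comp_apply, SkewRing.map_C, SkewRing.map_C]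
        exact congrArg (SkewRing.C φ) (RingHom.congr_fun hgf r)
      · rw [RingHom.comp_apply, SkewRing.map_X, SkewRing.map_X]
        rfl)))).symm

/-- Extension of scalars along a composition. -/
def extendScalarsCompIso {R₁ R₂ R₃ : Type u} [CommRing R₁] [CommRing R₂] [CommRing R₃]
    (f : R₁ →+* R₂) (g : R₂ →+* R₃) (h : R₁ →+* R₃) (hh : g.comp f = h) :
    ModuleCat.extendScalars.{u, u, u} h ≅ ModuleCat.extendScalars f ⋙ ModuleCat.extendScalars g :=
  hh ▸ ModuleCat.extendScalarsComp f g

theorem extendScalarsCompIso_oneTmul {R₁ R₂ R₃ : Type u} [CommRing R₁] [CommRing R₂] [CommRing R₃]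
    (f : R₁ →+* R₂) (g : R₂ →+* R₃) (h : R₁ →+* R₃) (hh : g.comp f = h) (M : ModuleCat.{u} R₁)
    (m : M) : ((extendScalarsCompIso f g h hh).hom.app M).hom (oneTmul h M m) =
      oneTmul g _ (oneTmul f M m) := by
  subst hh
  exact ModuleCat.extendScalarsComp_hom_app_one_tmul f g M m

/-- Extensions of scalars along a commutative square. -/
def extendScalarsSquare (f : R →+* S) (hf : f.comp φ = ψ.comp f) :
    ModuleCat.extendScalars.{u, u, u} f ⋙ ModuleCat.extendScalars ψ ≅
      ModuleCat.extendScalars φ ⋙ ModuleCat.extendScalars f :=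
  (extendScalarsCompIso f ψ _ hf.symm).symm ≪≫ extendScalarsCompIso φ f _ rfl

theorem extendScalarsSquare_oneTmul (f : R →+* S) (hf : f.comp φ = ψ.comp f)
    (M : ModuleCat.{u} R) (m : M) :
    ((extendScalarsSquare f hf).hom.app M).hom (oneTmul ψ _ (oneTmul f M m)) =
      oneTmul f _ (oneTmul φ M m) := by
  rw [← extendScalarsCompIso_oneTmul f ψ _ hf.symm, ← extendScalarsCompIso_oneTmul φ f _ rfl]
  have h := (extendScalarsCompIso f ψ _ hf.symm).hom_inv_id_app M
  exact congrArg ((extendScalarsCompIso φ f _ rfl).hom.app M).hom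
    (congrArg (fun k => k.hom (oneTmul (f.comp φ) M m)) h)

/-- With this identification, statements about the linearized Frobenius pass to base changes by
functoriality alone. -/
theorem frobLin_baseChange (f : R →+* S) (hf : f.comp φ = ψ.comp f) (M : FMod φ) :
    (frobLin ψ).app ((baseChange f hf).obj M) ≫ (baseChangeForget f hf).hom.app M =
      (ModuleCat.extendScalars ψ).map ((baseChangeForget f hf).hom.app M) ≫
        (extendScalarsSquare f hf).hom.app ((forgetFrob φ).obj M) ≫
          (ModuleCat.extendScalars f).map ((frobLin φ).app M) := by
  refine extendScalars_hom_ext fun x => ?_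
  refine (congrArg ((baseChangeForget f hf).hom.app M).hom (frobLin_oneTmul _ x)).trans ?_
  have key : ∀ y : (ModuleCat.extendScalars f).obj ((forgetFrob φ).obj M),
      ∀ x : (forgetFrob ψ).obj ((baseChange f hf).obj M),
      ((baseChangeForget f hf).hom.app M).hom x = y →
      ((baseChangeForget f hf).hom.app M).hom (act _ x) =
      ((ModuleCat.extendScalars f).map ((frobLin φ).app M)).hom
        (((extendScalarsSquare f hf).hom.app ((forgetFrob φ).obj M)).hom (oneTmul ψ _ y)) := by
    intro y
    induction y using extendScalars_induction with
    | add y z ihy ihz =>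
      intro x hy
      obtain ⟨x₁, h₁⟩ : ∃ x₁, ((baseChangeForget f hf).hom.app M).hom x₁ = y := ⟨y, rfl⟩
      obtain ⟨x₂, h₂⟩ : ∃ x₂, ((baseChangeForget f hf).hom.app M).hom x₂ = z := ⟨z, rfl⟩
      obtain rfl : x = x₁ + x₂ := by
        rw [← h₁, ← h₂, ← map_add] at hy
        exact hy
      rw [act_add, map_add, ihy _ h₁, ihz _ h₂, oneTmul_add, map_add, map_add]
    | smul_one s m =>
      intro x hx
      rw [baseChangeForget_act f hf M s m x hx, oneTmul_smul, map_smul,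
        extendScalarsSquare_oneTmul, map_smul]
      exact congrArg (fun z : (ModuleCat.extendScalars f).obj ((forgetFrob φ).obj M) => ψ s • z)
        (congrArg (oneTmul f ((forgetFrob φ).obj M)) (frobLin_oneTmul M m).symm)
  exact key _ x rfl

/-! ### Reduction modulo an ideal -/

theorem oneTmul_quotient_eq_zero_iff (I : Ideal R) (M : ModuleCat.{u} R) (m : M) :
    oneTmul (Ideal.Quotient.mk I) M m = 0 ↔ m ∈ (I • ⊤ : Submodule R M) := by
  constructor
  · intro h
    let N : ModuleCat.{u} (R ⧸ I) := ModuleCat.of (R ⧸ I) (M ⧸ (I • ⊤ : Submodule R M))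
    let g : M ⟶ (ModuleCat.restrictScalars (Ideal.Quotient.mk I)).obj N :=
      ModuleCat.ofHom (Y := (ModuleCat.restrictScalars (Ideal.Quotient.mk I)).obj N)
        { toFun := fun m => Submodule.Quotient.mk m
          map_add' := fun _ _ => rfl
          map_smul' := fun _ _ => rfl }
    have h1 := homEquiv_symm_oneTmul g m
    rw [h, map_zero] at h1
    exact (Submodule.Quotient.mk_eq_zero _).1 h1.symm
  · intro h
    refine Submodule.smul_induction_on h (fun r hr m _ => ?_) (fun x y hx hy => ?_)
    · rw [oneTmul_smul, Ideal.Quotient.eq_zero_iff_mem.2 hr, zero_smul]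
    · rw [oneTmul_add, hx, hy, add_zero]

theorem oneTmul_surjective {f : R →+* S} (hf : Function.Surjective f) (M : ModuleCat.{u} R) :
    Function.Surjective (oneTmul f M) := by
  intro x
  induction x using extendScalars_induction with
  | add x y hx hy =>
    obtain ⟨a, rfl⟩ := hx
    obtain ⟨b, rfl⟩ := hy
    exact ⟨a + b, oneTmul_add f M a b⟩
  | smul_one s m =>
    obtain ⟨r, rfl⟩ := hf s
    exact ⟨r • m, oneTmul_smul f M r m⟩

/-! ### Projectivity over `R` -/

/-- As a left R-module, R_φ is free on the powers of X. -/
theorem SkewRing.projective (φ : R →+* R) :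
    Projective ((forgetFrob φ).obj (ModuleCat.of (SkewRing φ) (SkewRing φ))) := by
  let A := (forgetFrob φ).obj (ModuleCat.of (SkewRing φ) (SkewRing φ))
  let e : SkewMonoidAlgebra R (Multiplicative ℕ) ≃ₗ[R] A :=
    { toFun := fun a => a
      invFun := fun a => a
      map_add' := fun _ _ => rfl
      map_smul' := fun r a => by
        change (r • a : SkewMonoidAlgebra R (Multiplicative ℕ)) = SkewRing.C φ r * (show SkewRing φ from a)
        let := powAction φ
        induction a using SkewMonoidAlgebra.induction_on' with
        | single n x =>
          have h := SkewMonoidAlgebra.single_mul_single (k := R) (G := Multiplicative ℕ)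
            (a₁ := 1) (a₂ := n) (b₁ := r) (b₂ := x)
          rw [one_smul, one_mul] at h
          rw [SkewMonoidAlgebra.smul_single]
          exact h.symm
        | add a b ha hb =>
          rw [smul_add, ha, hb]
          exact (mul_add (SkewRing.C φ r) (show SkewRing φ from a) (show SkewRing φ from b)).symm
      left_inv := fun _ => rfl
      right_inv := fun _ => rfl }
  have : Module.Projective R A := Module.Projective.of_equiv e
  exact (IsProjective.iff_projective A).1 this

/-- The right adjoint, coextension of scalars, preserves epimorphisms because R_φ is projective over
R. -/
instance : (forgetFrob φ).PreservesProjectiveObjects := by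
  have : (ModuleCat.coextendScalars.{u, u, u} (SkewRing.C φ)).PreservesEpimorphisms := by
    refine ⟨fun {M N} g hg => ?_⟩
    rw [ModuleCat.epi_iff_surjective] at hg ⊢
    intro h
    let A := (forgetFrob φ).obj (ModuleCat.of (SkewRing φ) (SkewRing φ))
    let h' : A ⟶ N := @ModuleCat.ofHom R _ A N _ A.isModule _ _ h
    have : Epi g := (ModuleCat.epi_iff_surjective g).2 hg
    have : Projective A := SkewRing.projective φ
    have h1 := Projective.factorThru_comp h' g
    refine ⟨(Projective.factorThru h' g).hom, LinearMap.ext fun s => ?_⟩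
    exact congrArg (fun k => k.hom s) h1
  exact Functor.preservesProjectiveObjects_of_adjunction_of_preservesEpimorphisms
    (ModuleCat.restrictCoextendScalarsAdj (SkewRing.C φ))

end Modules

end Dwork

namespace Dwork

/-! ## Linear maps with values in `I N` -/

section IdealMaps

variable {R : Type u} [CommRing R] {p : ℕ} {I : Ideal R}

/-- The conditions on `(R, I, p)` under which modules of the form `I N` are `p`-adically
complete. -/
structure IsPAdicPair (p : ℕ) (I : Ideal R) : Prop where
  complete : IsAdicComplete (Ideal.span {(p : R)}) R
  torsion : ∃ c : ℕ, ∀ (n : ℕ) (x : R), (p : R) ^ n * x = 0 → (p : R) ^ c * x = 0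
  separated : ∀ x : R, (∀ k, ∃ y, x - (p : R) ^ k * y ∈ I) → x ∈ I
  saturated : ∀ (n : ℕ) (x : R), (p : R) ^ n * x ∈ I → x ∈ I

theorem eq_zero_of_forall_pow_mul [IsAdicComplete (Ideal.span {(p : R)}) R] (x : R)
    (hx : ∀ n, ∃ y, x = (p : R) ^ n * y) : x = 0 := by
  refine IsHausdorff.haus (I := Ideal.span {(p : R)}) inferInstance _ fun k => ?_
  obtain ⟨y, rfl⟩ := hx k
  rw [SModEq.zero, smul_eq_mul, Ideal.mul_top, Ideal.span_singleton_pow]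
  exact Ideal.mul_mem_right _ _ (Ideal.mem_span_singleton_self _)

/-- The partial sums converge in R. The limit lies in I because R/I is p-adically separated, and the
divided remainders lie in I because R/I has no p-torsion. -/
theorem IsPAdicPair.exists_sum (h : IsPAdicPair p I) (b : ℕ → R) (hb : ∀ k, b k ∈ I) :
    ∃ x ∈ I, ∀ n, ∃ y ∈ I, x - ∑ k ∈ Finset.range n, (p : R) ^ k * b k = (p : R) ^ n * y := by
  have := h.complete
  obtain ⟨x, hx⟩ := IsPrecomplete.prec (I := Ideal.span {(p : R)}) (M := R) inferInstance
    (f := fun n => ∑ k ∈ Finset.range n, (p : R) ^ k * b k) (by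
      intro m n hmn
      rw [SModEq.sub_mem, smul_eq_mul, Ideal.mul_top, Ideal.span_singleton_pow, ← neg_mem_iff,
        neg_sub, Finset.sum_range_sub_sum_range hmn]
      refine Ideal.sum_mem _ fun k hk => Ideal.mul_mem_right _ _
        (Ideal.mem_span_singleton.2 (pow_dvd_pow _ ?_))
      exact (Finset.mem_filter.1 hk).2)
  have hx' : ∀ n, ∃ y, x - ∑ k ∈ Finset.range n, (p : R) ^ k * b k = (p : R) ^ n * y := by
    intro n
    have := (hx n).symm
    rw [SModEq.sub_mem, smul_eq_mul, Ideal.mul_top, Ideal.span_singleton_pow,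
      Ideal.mem_span_singleton] at this
    exact this
  have hsum : ∀ n, ∑ k ∈ Finset.range n, (p : R) ^ k * b k ∈ I :=
    fun n => I.sum_mem fun k _ => I.mul_mem_left _ (hb k)
  have hxI : x ∈ I := by
    refine h.separated x fun n => ?_
    obtain ⟨y, hy⟩ := hx' n
    refine ⟨y, ?_⟩
    rw [← hy, sub_sub_cancel]
    exact hsum n
  refine ⟨x, hxI, fun n => ?_⟩
  obtain ⟨y, hy⟩ := hx' n
  refine ⟨y, h.saturated n y ?_, hy⟩
  rw [← hy]
  exact I.sub_mem hxI (hsum n)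

variable {M N : Type u} [AddCommGroup M] [Module R M] [AddCommGroup N] [Module R N]

theorem smul_top_map_mem {N' : Type u} [AddCommGroup N'] [Module R N'] (J : Ideal R)
    (f : N →ₗ[R] N') {x : N} (hx : x ∈ (J • ⊤ : Submodule R N)) :
    f x ∈ (J • ⊤ : Submodule R N') := by
  have := Submodule.mem_map_of_mem (f := f) hx
  rw [Submodule.map_smul''] at this
  exact Submodule.smul_mono le_rfl le_top this

theorem exists_retract [Module.Finite R N] [Module.Projective R N] :
    ∃ (k : ℕ) (i : N →ₗ[R] (Fin k → R)) (r : (Fin k → R) →ₗ[R] N), r ∘ₗ i = LinearMap.id := by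
  obtain ⟨k, r, hr⟩ := Module.Finite.exists_fin' R N
  obtain ⟨i, hi⟩ := Module.projective_lifting_property r LinearMap.id hr
  exact ⟨k, i, r, hi⟩

theorem pi_mem_smul_top (J : Ideal R) {k : ℕ} (x : Fin k → R) :
    x ∈ (J • ⊤ : Submodule R (Fin k → R)) ↔ ∀ j, x j ∈ J := by
  constructor
  · intro h j
    have := smul_top_map_mem J (LinearMap.proj (R := R) (φ := fun _ : Fin k => R) j) h
    rwa [smul_eq_mul, Ideal.mul_top] at this
  · intro h
    rw [show x = ∑ j, x j • (Pi.single j (1 : R) : Fin k → R) from pi_eq_sum_univ' x]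
    exact Submodule.sum_mem _ fun j _ => Submodule.smul_mem_smul (h j) trivial

theorem IsPAdicPair.module_separated [Module.Finite R N] [Module.Projective R N]
    (h : IsPAdicPair p I) (x : N) (hx : ∀ n, ∃ y : N, x = (p : R) ^ n • y) : x = 0 := by
  have := h.complete
  obtain ⟨k, i, r, hir⟩ := exists_retract (R := R) (N := N)
  have h0 : i x = 0 := by
    funext j
    refine eq_zero_of_forall_pow_mul (p := p) _ fun n => ?_
    obtain ⟨y, rfl⟩ := hx n
    exact ⟨i y j, by rw [map_smul]; rfl⟩
  have := LinearMap.congr_fun hir x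
  rw [LinearMap.comp_apply, h0, map_zero] at this
  exact this.symm

theorem IsPAdicPair.module_exists_sum [Module.Finite R N] [Module.Projective R N]
    (h : IsPAdicPair p I) (b : ℕ → N) (hb : ∀ k, b k ∈ (I • ⊤ : Submodule R N)) :
    ∃ x ∈ (I • ⊤ : Submodule R N), ∀ n, ∃ y ∈ (I • ⊤ : Submodule R N),
      x - ∑ k ∈ Finset.range n, (p : R) ^ k • b k = (p : R) ^ n • y := by
  obtain ⟨k, i, r, hir⟩ := exists_retract (R := R) (N := N)
  have hri : ∀ y, r (i y) = y := fun y => LinearMap.congr_fun hir y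
  have hib : ∀ j m, i (b m) j ∈ I := fun j m => (pi_mem_smul_top I _).1 (smul_top_map_mem I i (hb m)) j
  choose x hxI y hyI hy using fun j => h.exists_sum (fun m => i (b m) j) (hib j)
  refine ⟨r x, smul_top_map_mem I r ((pi_mem_smul_top I _).2 hxI), fun n =>
    ⟨r (fun j => y j n), smul_top_map_mem I r ((pi_mem_smul_top I _).2 fun j => hyI j n), ?_⟩⟩
  have e : x - ∑ m ∈ Finset.range n, (p : R) ^ m • i (b m) = (p : R) ^ n • (fun j => y j n) := by
    funext j
    rw [Pi.sub_apply, Finset.sum_apply]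
    exact hy j n
  rw [← map_smul, ← e, map_sub, map_sum]
  simp only [map_smul, hri]

/-- The exponent comes from R and serves all these modules at once; this uniformity is needed for
cochains, which may have infinitely many components. -/
theorem IsPAdicPair.module_torsion (h : IsPAdicPair p I) :
    ∃ c : ℕ, ∀ (N : Type u) [AddCommGroup N] [Module R N] [Module.Finite R N]
      [Module.Projective R N] (n : ℕ) (x : N), (p : R) ^ n • x = 0 → (p : R) ^ c • x = 0 := by
  obtain ⟨c, hc⟩ := h.torsion
  refine ⟨c, fun N _ _ _ _ n x hx => ?_⟩
  obtain ⟨k, i, r, hir⟩ := exists_retract (R := R) (N := N)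
  have h0 : i ((p : R) ^ c • x) = 0 := by
    funext j
    rw [map_smul]
    refine hc n (i x j) ?_
    have := congrFun (congrArg i hx) j
    rwa [map_smul, map_zero] at this
  have := LinearMap.congr_fun hir ((p : R) ^ c • x)
  rw [LinearMap.comp_apply, h0, map_zero] at this
  exact this.symm

/-- Pointwise quotients need not be linear, but projectivity lifts f along the surjection from Y to
rY. -/
theorem exists_eq_smul_of_projective [Module.Projective R M] (Y : Submodule R N) (r : R)
    (f : M →ₗ[R] N) (hf : ∀ m, ∃ y ∈ Y, f m = r • y) :
    ∃ g : M →ₗ[R] N, (∀ m, g m ∈ Y) ∧ f = r • g := by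
  let q : Y →ₗ[R] N := r • Y.subtype
  obtain ⟨g, hg⟩ := Module.projective_lifting_property q.rangeRestrict
    (f.codRestrict (LinearMap.range q) fun m => by
      obtain ⟨y, hy, e⟩ := hf m
      exact ⟨⟨y, hy⟩, e.symm⟩) q.surjective_rangeRestrict
  refine ⟨Y.subtype ∘ₗ g, fun m => (g m).2, LinearMap.ext fun m => ?_⟩
  exact (congrArg Subtype.val (LinearMap.congr_fun hg m)).symm

/-- The sum is formed pointwise. Separatedness of N makes it linear, and projectivity of M makes the
pointwise quotients of the remainders linear. -/
theorem IsPAdicPair.linearMap_exists_sum [Module.Finite R N] [Module.Projective R N]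
    [Module.Projective R M] (h : IsPAdicPair p I) (b : ℕ → M →ₗ[R] N)
    (hb : ∀ k m, b k m ∈ (I • ⊤ : Submodule R N)) :
    ∃ x : M →ₗ[R] N, (∀ m, x m ∈ (I • ⊤ : Submodule R N)) ∧
      ∀ n, ∃ y : M →ₗ[R] N, (∀ m, y m ∈ (I • ⊤ : Submodule R N)) ∧
        x - ∑ k ∈ Finset.range n, (p : R) ^ k • b k = (p : R) ^ n • y := by
  choose x hxI y hyI hy using fun m => h.module_exists_sum (fun k => b k m) (fun k => hb k m)
  have hx : ∀ m n, x m = ∑ k ∈ Finset.range n, (p : R) ^ k • b k m + (p : R) ^ n • y m n :=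
    fun m n => by rw [← hy m n]; abel
  let X : M →ₗ[R] N :=
    { toFun := x
      map_add' := fun m m' => by
        rw [← sub_eq_zero]
        refine h.module_separated _ fun n => ⟨y (m + m') n - (y m n + y m' n), ?_⟩
        rw [hx _ n, hx m n, hx m' n]
        simp only [map_add, smul_add, Finset.sum_add_distrib, smul_sub]
        abel
      map_smul' := fun r m => by
        rw [← sub_eq_zero]
        refine h.module_separated _ fun n => ⟨y (r • m) n - r • y m n, ?_⟩
        rw [hx _ n, hx m n]
        simp only [map_smul, smul_add, Finset.smul_sum, smul_sub, smul_comm r, RingHom.id_apply]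
        abel }
  refine ⟨X, hxI, fun n => ?_⟩
  obtain ⟨g, hg, e⟩ := exists_eq_smul_of_projective (I • ⊤ : Submodule R N) ((p : R) ^ n)
    (X - ∑ k ∈ Finset.range n, (p : R) ^ k • b k) (fun m => ⟨y m n, hyI m n, by
      rw [← hy m n, LinearMap.sub_apply, LinearMap.sum_apply]; rfl⟩)
  exact ⟨g, hg, e⟩

end IdealMaps

end Dwork

namespace Dwork

open CochainComplex.HomComplex

/-! ## Cochains between complexes -/

section Cochains

variable {𝒞 : Type v} [Category.{w} 𝒞] [Preadditive 𝒞] {F F' G K L L' : CochainComplex 𝒞 ℤ} {n : ℤ}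

/-- The differential on cochains as an additive map. -/
def diffHom (K L : CochainComplex 𝒞 ℤ) (n m : ℤ) : Cochain K L n →+ Cochain K L m :=
  (δ_hom ℤ K L n m).toAddMonoidHom

theorem diffHom_apply (n m : ℤ) (z : Cochain K L n) : diffHom K L n m z = δ n m z := rfl

/-- Precomposition of cochains with a morphism of complexes. -/
def preComp (f : F ⟶ K) (L : CochainComplex 𝒞 ℤ) (n : ℤ) : Cochain K L n →+ Cochain F L n where
  toFun z := (Cochain.ofHom f).comp z (zero_add n)
  map_zero' := Cochain.comp_zero _ _
  map_add' _ _ := Cochain.comp_add _ _ _ _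

/-- Postcomposition of cochains with a morphism of complexes. -/
def postComp (K : CochainComplex 𝒞 ℤ) (f : L ⟶ L') (n : ℤ) : Cochain K L n →+ Cochain K L' n where
  toFun z := z.comp (Cochain.ofHom f) (add_zero n)
  map_zero' := Cochain.zero_comp _ _
  map_add' _ _ := Cochain.add_comp _ _ _ _

theorem preComp_v (f : F ⟶ K) (z : Cochain K L n) (p q : ℤ) (h : p + n = q) :
    (preComp f L n z).v p q h = f.f p ≫ z.v p q h := by
  simp [preComp]

theorem postComp_v (f : L ⟶ L') (z : Cochain K L n) (p q : ℤ) (h : p + n = q) :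
    (postComp K f n z).v p q h = z.v p q h ≫ f.f q := by
  simp [postComp]

theorem diffHom_preComp (f : F ⟶ K) (z : Cochain K L n) (m : ℤ) :
    diffHom F L n m (preComp f L n z) = preComp f L m (diffHom K L n m z) :=
  δ_ofHom_comp f z m

theorem diffHom_postComp (f : L ⟶ L') (z : Cochain K L n) (m : ℤ) :
    diffHom K L' n m (postComp K f n z) = postComp K f m (diffHom K L n m z) :=
  δ_comp_ofHom z f m

theorem preComp_comp (f : F ⟶ F') (g : F' ⟶ K) (z : Cochain K L n) :
    preComp (f ≫ g) L n z = preComp f L n (preComp g L n z) := by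
  ext p q h
  simp only [preComp_v, HomologicalComplex.comp_f, Category.assoc]

theorem postComp_comp (f : L ⟶ L') (g : L' ⟶ G) (z : Cochain K L n) :
    postComp K (f ≫ g) n z = postComp K g n (postComp K f n z) := by
  ext p q h
  simp only [postComp_v, HomologicalComplex.comp_f, Category.assoc]

theorem preComp_postComp (f : F ⟶ K) (g : L ⟶ L') (z : Cochain K L n) :
    preComp f L' n (postComp K g n z) = postComp F g n (preComp f L n z) := by
  ext p q h
  simp only [preComp_v, postComp_v, Category.assoc]

theorem preComp_nsmul_id (k : ℕ) (z : Cochain K L n) :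
    preComp (k • 𝟙 K) L n z = k • z := by
  ext p q h
  have h1 : (k • 𝟙 K : K ⟶ K).f p = k • 𝟙 _ := by simp
  have h2 : (k • z).v p q h = k • z.v p q h := by
    simpa using Cochain.smul_v (k : ℤ) z p q h
  rw [preComp_v, h1, h2, Preadditive.nsmul_comp, Category.id_comp]

theorem postComp_id (z : Cochain K L n) : postComp K (𝟙 L) n z = z := by
  ext p q h
  simp only [postComp_v, HomologicalComplex.id_f, Category.comp_id]

/-- The primitive is kept explicit, as a composition of a fixed cochain with z, so that it has
values in an ideal whenever z does. -/
theorem exists_preComp_sub {f g : F ⟶ K} (H : Homotopy f g) :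
    ∃ s : Cochain F K (-1), ∀ (n m : ℤ) (_ : m + 1 = n) (L : CochainComplex 𝒞 ℤ)
      (z : Cochain K L n), diffHom K L n (n + 1) z = 0 →
      preComp f L n z - preComp g L n z =
        diffHom F L m n (n.negOnePow • s.comp z (show -1 + n = m by omega)) := by
  refine ⟨Cochain.ofHomotopy H, fun n m hm L z hz => ?_⟩
  have h1 := δ_comp (Cochain.ofHomotopy H) z (show -1 + n = m by omega) 0 (n + 1) n hm
    (neg_add_cancel 1) rfl
  change δ n (n + 1) z = 0 at hz
  rw [hz, Cochain.comp_zero, zero_add, δ_ofHomotopy, Cochain.sub_comp] at h1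
  change _ = δ m n _
  rw [δ_units_smul, h1, smul_smul, Int.units_mul_self, one_smul]
  rfl

theorem exists_postComp_sub {f g : L ⟶ L'} (H : Homotopy f g) :
    ∃ s : Cochain L L' (-1), ∀ (n m : ℤ) (_ : m + 1 = n) (K : CochainComplex 𝒞 ℤ)
      (z : Cochain K L n), diffHom K L n (n + 1) z = 0 →
      postComp K f n z - postComp K g n z =
        diffHom K L' m n (z.comp s (show n + -1 = m by omega)) := by
  refine ⟨Cochain.ofHomotopy H, fun n m hm K z hz => ?_⟩
  have h1 := δ_comp z (Cochain.ofHomotopy H) (show n + -1 = m by omega) (n + 1) 0 n hm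
    rfl (neg_add_cancel 1)
  change δ n (n + 1) z = 0 at hz
  rw [hz, Cochain.zero_comp, smul_zero, add_zero, δ_ofHomotopy, Cochain.comp_sub] at h1
  exact h1.symm

variable {𝒟 : Type v'} [Category.{w'} 𝒟] [Preadditive 𝒟] (Φ : 𝒞 ⥤ 𝒟) [Φ.Additive]

/-- The map on cochains induced by an additive functor. -/
def mapCochain (K L : CochainComplex 𝒞 ℤ) (n : ℤ) :
    Cochain K L n →+ Cochain ((Φ.mapHomologicalComplex _).obj K)
      ((Φ.mapHomologicalComplex _).obj L) n where
  toFun z := z.map Φ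
  map_zero' := Cochain.map_zero _ _ _ _
  map_add' _ _ := Cochain.map_add _ _ _

theorem mapCochain_v (z : Cochain K L n) (p q : ℤ) (h : p + n = q) :
    (mapCochain Φ K L n z).v p q h = Φ.map (z.v p q h) := rfl

theorem diffHom_mapCochain (z : Cochain K L n) (m : ℤ) :
    diffHom _ _ n m (mapCochain Φ K L n z) = mapCochain Φ K L m (diffHom K L n m z) :=
  δ_map n m z Φ

theorem mapCochain_postComp (f : L ⟶ L') (z : Cochain K L n) :
    mapCochain Φ K L' n (postComp K f n z) =
      postComp _ ((Φ.mapHomologicalComplex _).map f) n (mapCochain Φ K L n z) := by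
  ext p q h
  rw [mapCochain_v, postComp_v, postComp_v, Φ.map_comp]
  rfl

end Cochains

/-! ## Cochains with values in `J L` -/

section IdealCochains

variable {R : Type u} [CommRing R] {F K L L' : CochainComplex (ModuleCat.{u} R) ℤ} {n : ℤ}

/-- The cochains from `K` to `L` with values in `J L`. -/
def idealCochains (J : Ideal R) (K L : CochainComplex (ModuleCat.{u} R) ℤ) (n : ℤ) :
    AddSubgroup (Cochain K L n) where
  carrier := {z | ∀ (p q : ℤ) (h : p + n = q) (x : K.X p),
    (z.v p q h).hom x ∈ (J • ⊤ : Submodule R (L.X q))}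
  zero_mem' := fun _ _ _ _ => Submodule.zero_mem _
  add_mem' := fun ha hb p q h x => Submodule.add_mem _ (ha p q h x) (hb p q h x)
  neg_mem' := fun ha p q h x => Submodule.neg_mem _ (ha p q h x)

variable {J J' : Ideal R}

theorem idealCochains_mono (h : J ≤ J') : idealCochains J K L n ≤ idealCochains J' K L n :=
  fun _ hz p q hpq x => Submodule.smul_mono_left h (hz p q hpq x)

theorem comp_mem_idealCochains_left {n₁ n₂ : ℤ} {z₁ : Cochain F K n₁}
    (hz : z₁ ∈ idealCochains J F K n₁) (z₂ : Cochain K L n₂) (h : n₁ + n₂ = n) :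
    z₁.comp z₂ h ∈ idealCochains J F L n := by
  intro p q hpq x
  rw [Cochain.comp_v z₁ z₂ h p (p + n₁) q rfl (by omega)]
  exact smul_top_map_mem J (z₂.v _ _ _).hom (hz p (p + n₁) rfl x)

theorem comp_mem_idealCochains_right {n₁ n₂ : ℤ} (z₁ : Cochain F K n₁) {z₂ : Cochain K L n₂}
    (hz : z₂ ∈ idealCochains J K L n₂) (h : n₁ + n₂ = n) :
    z₁.comp z₂ h ∈ idealCochains J F L n := by
  intro p q hpq x
  rw [Cochain.comp_v z₁ z₂ h p (p + n₁) q rfl (by omega)]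
  exact hz _ _ _ _

theorem preComp_mem_idealCochains (f : F ⟶ K) {z : Cochain K L n}
    (hz : z ∈ idealCochains J K L n) : preComp f L n z ∈ idealCochains J F L n :=
  comp_mem_idealCochains_right _ hz (zero_add n)

theorem postComp_mem_idealCochains (f : L ⟶ L') {z : Cochain K L n}
    (hz : z ∈ idealCochains J K L n) : postComp K f n z ∈ idealCochains J K L' n :=
  comp_mem_idealCochains_left hz _ (add_zero n)

theorem units_smul_mem_idealCochains (e : ℤˣ) {z : Cochain K L n}
    (hz : z ∈ idealCochains J K L n) : e • z ∈ idealCochains J K L n := by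
  rcases Int.units_eq_one_or e with rfl | rfl
  · rwa [one_smul]
  · rw [Units.neg_smul, one_smul]
    exact neg_mem hz

theorem diffHom_mem_idealCochains {z : Cochain K L n} (m : ℤ)
    (hz : z ∈ idealCochains J K L n) : diffHom K L n m z ∈ idealCochains J K L m := by
  by_cases h : n + 1 = m
  · intro p q hpq x
    change ((δ n m z).v p q hpq).hom x ∈ _
    rw [δ_v n m h z p q hpq (q - 1) (p + 1) rfl rfl]
    have h1 := units_smul_mem_idealCochains m.negOnePow hz
    refine Submodule.add_mem _ (smul_top_map_mem J (L.d (q - 1) q).hom (hz p (q - 1) (by omega) x)) ?_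
    exact h1 (p + 1) q (by omega) _
  · rw [diffHom_apply, δ_shape n m h]
    exact zero_mem _

/-- For f = φ this is how φ acts on the ideal of values: applying φ^* to a cochain replaces J by the
ideal generated by φ(J). -/
theorem extendScalars_map_mem {S : Type u} [CommRing S] (f : R →+* S) {M N : ModuleCat.{u} R}
    (g : M ⟶ N) (hg : ∀ x, g.hom x ∈ (J • ⊤ : Submodule R N))
    (x : (ModuleCat.extendScalars.{u, u, u} f).obj M) :
    ((ModuleCat.extendScalars f).map g).hom x ∈
      (J.map f • ⊤ : Submodule S ((ModuleCat.extendScalars.{u, u, u} f).obj N)) := by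
  induction x using extendScalars_induction with
  | add x y hx hy =>
    rw [map_add]
    exact Submodule.add_mem _ hx hy
  | smul_one s m =>
    rw [map_smul, extendScalars_map_oneTmul]
    refine Submodule.smul_mem _ _ ?_
    refine Submodule.smul_induction_on (p := fun y => oneTmul f N y ∈ _) (hg m)
      (fun r hr y _ => ?_) (fun x y hx hy => ?_)
    · rw [oneTmul_smul]
      exact Submodule.smul_mem_smul (Ideal.mem_map_of_mem f hr) trivial
    · rw [oneTmul_add]
      exact Submodule.add_mem _ hx hy

theorem mapCochain_mem_idealCochains (φ : R →+* R) {z : Cochain K L n}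
    (hz : z ∈ idealCochains J K L n) :
    mapCochain (ModuleCat.extendScalars φ) K L n z ∈ idealCochains (J.map φ) _ _ n :=
  fun p q h x => extendScalars_map_mem φ _ (hz p q h) x

theorem exists_eq_nsmul_idealCochains (hK : ∀ i, Projective (K.X i)) (k : ℕ) {z : Cochain K L n}
    (hz : ∀ (p q : ℤ) (h : p + n = q) (x : K.X p),
      ∃ y ∈ (J • ⊤ : Submodule R (L.X q)), (z.v p q h).hom x = (k : R) • y) :
    ∃ y ∈ idealCochains J K L n, z = k • y := by
  have hK' : ∀ i, Module.Projective R (K.X i) := fun i => (IsProjective.iff_projective _).2 (hK i)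
  choose g hg hg' using fun (p q : ℤ) (h : p + n = q) =>
    exists_eq_smul_of_projective (J • ⊤ : Submodule R (L.X q)) (k : R) (z.v p q h).hom (hz p q h)
  refine ⟨Cochain.mk fun p q h => ModuleCat.ofHom (g p q h), fun p q h x => hg p q h x, ?_⟩
  refine Cochain.ext _ _ fun p q h => ModuleCat.hom_ext ?_
  rw [hg' p q h, Nat.cast_smul_eq_nsmul]
  rfl

variable {p : ℕ} {I : Ideal R}

/-- Everything is checked componentwise. Finite generation is needed only of the target; the source
has to be projective so that cochains can be divided by p^n. -/
theorem IsPAdicPair.isPAdicGroup_idealCochains (h : IsPAdicPair p I)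
    (hK : ∀ i, Projective (K.X i))
    (hL : ∀ i, Module.Finite R (L.X i) ∧ Module.Projective R (L.X i)) (n : ℤ) :
    IsPAdicGroup p (idealCochains I K L n) := by
  have hK' : ∀ i, Module.Projective R (K.X i) := fun i => (IsProjective.iff_projective _).2 (hK i)
  have hL1 : ∀ i, Module.Finite R (L.X i) := fun i => (hL i).1
  have hL2 : ∀ i, Module.Projective R (L.X i) := fun i => (hL i).2
  have hc : ∀ (k : ℕ) (M : Type u) [AddCommGroup M] [Module R M] (m : M),
      p ^ k • m = (p : R) ^ k • m := fun k M _ _ m => by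
    rw [← Nat.cast_pow, Nat.cast_smul_eq_nsmul]
  refine ⟨fun b => ?_, fun x hx => ?_, ?_⟩
  · choose x hx y hy e using fun (i j : ℤ) (hij : i + n = j) =>
      h.linearMap_exists_sum (fun k => ((b k).1.v i j hij).hom) (fun k => (b k).2 i j hij)
    refine ⟨⟨Cochain.mk fun i j hij => ModuleCat.ofHom (x i j hij), hx⟩, fun k =>
      ⟨⟨Cochain.mk fun i j hij => ModuleCat.ofHom (y i j hij k), fun i j hij => hy i j hij k⟩, ?_⟩⟩
    refine Subtype.ext ?_
    have h1 : ∀ s : Finset ℕ, ∀ (i j : ℤ) (hij : i + n = j),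
        ((((∑ m ∈ s, p ^ m • b m : idealCochains I K L n) : Cochain K L n)).v i j hij).hom =
          ∑ m ∈ s, (p : R) ^ m • ((b m).1.v i j hij).hom := by
      intro s i j hij
      induction s using Finset.induction_on with
      | empty => rfl
      | insert a s ha ih =>
        rw [Finset.sum_insert ha, Finset.sum_insert ha, ← ih, ← hc]
        rfl
    refine Cochain.ext _ _ fun i j hij => ModuleCat.hom_ext ?_
    have := e i j hij k
    rw [← h1, ← hc] at this
    exact this
  · refine Subtype.ext ?_
    refine Cochain.ext _ _ fun i j hij => ModuleCat.hom_ext (LinearMap.ext fun m => ?_)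
    refine h.module_separated _ fun k => ?_
    obtain ⟨y, rfl⟩ := hx k
    refine ⟨(y.1.v i j hij).hom m, ?_⟩
    rw [← hc]
    rfl
  · obtain ⟨c, hc'⟩ := h.module_torsion
    refine ⟨c, fun k x hx => Subtype.ext ?_⟩
    refine Cochain.ext _ _ fun i j hij => ModuleCat.hom_ext (LinearMap.ext fun m => ?_)
    have h1 : (p : R) ^ k • ((x.1.v i j hij).hom m) = 0 := by
      rw [← hc]
      exact congrArg (fun z : idealCochains I K L n => (z.1.v i j hij).hom m) hx
    have h2 := hc' _ k _ h1
    rw [← hc] at h2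
    exact h2

end IdealCochains

end Dwork

namespace Dwork

open CochainComplex.HomComplex

/-! ## Cochains modulo boundaries with values in `J L` -/

section Boundaries

variable {R : Type u} [CommRing R] {F K L L' : CochainComplex (ModuleCat.{u} R) ℤ} {n : ℤ}
  {J : Ideal R}

/-- The boundaries of cochains with values in `J L`. -/
def idealBoundaries (J : Ideal R) (K L : CochainComplex (ModuleCat.{u} R) ℤ) (n : ℤ) :
    AddSubgroup (Cochain K L n) :=
  (idealCochains J K L (n - 1)).map (diffHom K L (n - 1) n)

theorem diffHom_mem_idealBoundaries {m : ℤ} (hm : m + 1 = n) {z : Cochain K L m}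
    (hz : z ∈ idealCochains J K L m) : diffHom K L m n z ∈ idealBoundaries J K L n := by
  obtain rfl : m = n - 1 := by omega
  exact ⟨z, hz, rfl⟩

theorem preComp_mem_idealBoundaries (f : F ⟶ K) {z : Cochain K L n}
    (hz : z ∈ idealBoundaries J K L n) : preComp f L n z ∈ idealBoundaries J F L n := by
  obtain ⟨y, hy, rfl⟩ := hz
  rw [← diffHom_preComp]
  exact ⟨_, preComp_mem_idealCochains f hy, rfl⟩

theorem postComp_mem_idealBoundaries (f : L ⟶ L') {z : Cochain K L n}
    (hz : z ∈ idealBoundaries J K L n) : postComp K f n z ∈ idealBoundaries J K L' n := by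
  obtain ⟨y, hy, rfl⟩ := hz
  rw [← diffHom_postComp]
  exact ⟨_, postComp_mem_idealCochains f hy, rfl⟩

/-- Homotopy invariance persists for the subcomplex of cochains with values in J L, since the
primitive is a composition with z itself. -/
theorem preComp_sub_mem_idealBoundaries {f g : F ⟶ K} (H : Homotopy f g) {z : Cochain K L n}
    (hz : z ∈ idealCochains J K L n) (hz' : diffHom K L n (n + 1) z = 0) :
    preComp f L n z - preComp g L n z ∈ idealBoundaries J F L n := by
  obtain ⟨s, hs⟩ := exists_preComp_sub H
  rw [hs n (n - 1) (sub_add_cancel n 1) L z hz']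
  exact diffHom_mem_idealBoundaries (sub_add_cancel n 1)
    (units_smul_mem_idealCochains _ (comp_mem_idealCochains_right s hz _))

theorem postComp_sub_mem_idealBoundaries {f g : L ⟶ L'} (H : Homotopy f g) {z : Cochain K L n}
    (hz : z ∈ idealCochains J K L n) (hz' : diffHom K L n (n + 1) z = 0) :
    postComp K f n z - postComp K g n z ∈ idealBoundaries J K L' n := by
  obtain ⟨s, hs⟩ := exists_postComp_sub H
  rw [hs n (n - 1) (sub_add_cancel n 1) K z hz']
  exact diffHom_mem_idealBoundaries (sub_add_cancel n 1)
    (comp_mem_idealCochains_left hz s _)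

theorem sub_mem_idealBoundaries_trans {x y z : Cochain K L n}
    (h₁ : x - y ∈ idealBoundaries J K L n) (h₂ : y - z ∈ idealBoundaries J K L n) :
    x - z ∈ idealBoundaries J K L n := by
  rw [← sub_add_sub_cancel x y z]
  exact add_mem h₁ h₂

end Boundaries

/-! ## The twist `f ↦ l ∘ φ^* f ∘ g` -/

section Twist

variable {R : Type u} [CommRing R] (φ : R →+* R)

/-- The base change along `φ` of a complex of `R`-modules. -/
abbrev pull : CochainComplex (ModuleCat.{u} R) ℤ ⥤ CochainComplex (ModuleCat.{u} R) ℤ :=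
  (ModuleCat.extendScalars φ).mapHomologicalComplex (ComplexShape.up ℤ)

variable {φ} {K L E : CochainComplex (ModuleCat.{u} R) ℤ} {n : ℤ} {I J : Ideal R} {p a : ℕ}

/-- The endomorphism `f ↦ l ∘ φ^* f ∘ g` of the cochains from `K` to `E`. -/
def twist (g : K ⟶ (pull φ).obj K) (l : (pull φ).obj E ⟶ E) (n : ℤ) :
    AddMonoid.End (Cochain K E n) :=
  ((preComp g E n).comp (postComp ((pull φ).obj K) l n)).comp
    (mapCochain (ModuleCat.extendScalars φ) K E n)

theorem twist_apply (g : K ⟶ (pull φ).obj K) (l : (pull φ).obj E ⟶ E) (z : Cochain K E n) :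
    twist g l n z = preComp g E n (postComp _ l n (mapCochain (ModuleCat.extendScalars φ) K E n z)) :=
  rfl

theorem diffHom_twist (g : K ⟶ (pull φ).obj K) (l : (pull φ).obj E ⟶ E) (z : Cochain K E n)
    (m : ℤ) : diffHom K E n m (twist g l n z) = twist g l m (diffHom K E n m z) := by
  rw [twist_apply, twist_apply, diffHom_preComp, diffHom_postComp, diffHom_mapCochain]

theorem twist_mem_map (g : K ⟶ (pull φ).obj K) (l : (pull φ).obj E ⟶ E) {z : Cochain K E n}
    (hz : z ∈ idealCochains J K E n) : twist g l n z ∈ idealCochains (J.map φ) K E n :=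
  preComp_mem_idealCochains _ (postComp_mem_idealCochains _ (mapCochain_mem_idealCochains φ hz))

theorem twist_mem (hI : I ≤ I.comap φ) (g : K ⟶ (pull φ).obj K) (l : (pull φ).obj E ⟶ E)
    {z : Cochain K E n} (hz : z ∈ idealCochains I K E n) : twist g l n z ∈ idealCochains I K E n :=
  idealCochains_mono (Ideal.map_le_iff_le_comap.2 hI) (twist_mem_map g l hz)

/-- The restriction of `twist` to the cochains with values in `I E`. -/
def idealTwist (hI : I ≤ I.comap φ) (g : K ⟶ (pull φ).obj K) (l : (pull φ).obj E ⟶ E) (n : ℤ) :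
    AddMonoid.End (idealCochains I K E n) :=
  AddMonoidHom.codRestrict ((twist g l n : Cochain K E n →+ Cochain K E n).comp
    (idealCochains I K E n).subtype) _ fun z => twist_mem hI g l z.2

/-- The m-th iterate has values in φ^m(I) E, which lies in p^(am+1) I E, and projectivity of the
terms of K divides the cochain itself. The exponent m does not depend on the degree n. -/
theorem exists_idealTwist_pow_eq (hnil : StronglyTopNilpotent p φ I) (hI : I ≤ I.comap φ)
    (hK : ∀ i, Projective (K.X i)) (g : K ⟶ (pull φ).obj K) (l : (pull φ).obj E ⟶ E) (a : ℕ) :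
    ∃ m : ℕ, ∀ (n : ℤ) (x : idealCochains I K E n), ∃ y, (idealTwist hI g l n ^ m) x =
      p ^ (a * m + 1) • y := by
  obtain ⟨m, hm⟩ := hnil.exists_iterate_eq a
  refine ⟨m, fun n x => ?_⟩
  have h1 : ∀ k : ℕ, ((idealTwist hI g l n ^ k) x : Cochain K E n) ∈
      idealCochains (I.map (φ ^ k)) K E n := by
    intro k
    induction k with
    | zero =>
      have : I.map (φ ^ 0) = I := Ideal.map_id I
      rw [this]
      exact x.2
    | succ k ih =>
      have h2 := twist_mem_map g l ih
      rw [Ideal.map_map] at h2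
      rw [pow_succ', pow_succ']
      exact h2
  have h2 : ∀ N : Type u, ∀ [AddCommGroup N] [Module R N] (z : N),
      z ∈ (I.map (φ ^ m) • ⊤ : Submodule R N) →
      ∃ y ∈ (I • ⊤ : Submodule R N), z = ((p ^ (a * m + 1) : ℕ) : R) • y := by
    intro N _ _ z hz
    let q : N →ₗ[R] N := LinearMap.lsmul R N ((p ^ (a * m + 1) : ℕ) : R)
    have h3 : (I.map (φ ^ m) • ⊤ : Submodule R N) ≤ (I • ⊤ : Submodule R N).map q := by
      rw [Submodule.smul_le]
      intro r hr y _
      have h4 : r ∈ I * Ideal.span {((p ^ (a * m + 1) : ℕ) : R)} := by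
        refine (Ideal.map_le_iff_le_comap.2 (fun x hx => ?_) : I.map (φ ^ m) ≤ _) hr
        obtain ⟨y, hy, e⟩ := hm x hx
        have h5 : (φ ^ m) x = y * ((p ^ (a * m + 1) : ℕ) : R) := by
          rw [mul_comm, Nat.cast_pow, ← e, RingHom.coe_pow]
        rw [Ideal.mem_comap, h5]
        exact Ideal.mul_mem_mul hy (Ideal.mem_span_singleton_self _)
      obtain ⟨s, hs, rfl⟩ := Ideal.mem_mul_span_singleton.1 h4
      refine ⟨s • y, Submodule.smul_mem_smul hs trivial, ?_⟩
      change ((p ^ (a * m + 1) : ℕ) : R) • s • y = _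
      rw [smul_smul, mul_comm]
    obtain ⟨y, hy, e⟩ := h3 hz
    exact ⟨y, hy, e.symm⟩
  obtain ⟨y, hy, e⟩ := exists_eq_nsmul_idealCochains hK (p ^ (a * m + 1))
    fun i j hij b => h2 _ _ (h1 m i j hij b)
  exact ⟨⟨y, hy⟩, Subtype.ext e⟩

theorem exists_sub_twist_eq (h : IsPAdicPair p I) (hnil : StronglyTopNilpotent p φ I)
    (hI : I ≤ I.comap φ) (hK : ∀ i, Projective (K.X i))
    (hE : ∀ i, Module.Finite R (E.X i) ∧ Module.Projective R (E.X i))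
    (g : K ⟶ (pull φ).obj K) (l : (pull φ).obj E ⟶ E)
    (a : ℕ) (n : ℤ) : ∃ M : ℕ, ∀ y ∈ idealCochains I K E n,
    ∃ x ∈ idealCochains I K E n, p ^ a • x - twist g l n x = p ^ M • y := by
  obtain ⟨m, hm⟩ := exists_idealTwist_pow_eq hnil hI hK g l a
  refine ⟨a * m, fun y hy => ?_⟩
  obtain ⟨x, hx⟩ := (h.isPAdicGroup_idealCochains hK hE n).exists_sub_eq (hm n) ⟨y, hy⟩
  exact ⟨x.1, x.2, congrArg Subtype.val hx⟩

theorem exists_pow_smul_eq_zero_of_twist (h : IsPAdicPair p I) (hnil : StronglyTopNilpotent p φ I)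
    (hI : I ≤ I.comap φ) (hK : ∀ i, Projective (K.X i))
    (hE : ∀ i, Module.Finite R (E.X i) ∧ Module.Projective R (E.X i))
    (g : K ⟶ (pull φ).obj K) (l : (pull φ).obj E ⟶ E)
    (a : ℕ) (n : ℤ) : ∃ c : ℕ, ∀ x ∈ idealCochains I K E n,
    p ^ a • x = twist g l n x → p ^ c • x = 0 := by
  obtain ⟨m, hm⟩ := exists_idealTwist_pow_eq hnil hI hK g l a
  obtain ⟨c, hc⟩ := (h.isPAdicGroup_idealCochains hK hE n).pow_smul_eq_zero (hm n)
  refine ⟨c, fun x hx e => ?_⟩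
  exact congrArg Subtype.val (hc ⟨x, hx⟩ (Subtype.ext e))

/-- Injectivity on cohomology of p^a - T, with T the twist. If it sends f to dm, solve p^a x - T x =
p^M m; then p^M f - dx lies in the kernel of p^a - T, hence is killed by p^c. -/
theorem exists_pow_smul_mem_idealBoundaries (h : IsPAdicPair p I) (hnil : StronglyTopNilpotent p φ I)
    (hI : I ≤ I.comap φ) (hK : ∀ i, Projective (K.X i))
    (hE : ∀ i, Module.Finite R (E.X i) ∧ Module.Projective R (E.X i))
    (g : K ⟶ (pull φ).obj K) (l : (pull φ).obj E ⟶ E)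
    (f : Cochain K E n) (hf : f ∈ idealCochains I K E n)
    (hb : p ^ a • f - twist g l n f ∈ idealBoundaries I K E n) :
    ∃ N : ℕ, p ^ N • f ∈ idealBoundaries I K E n := by
  obtain ⟨m, hm, e⟩ := hb
  obtain ⟨M, hM⟩ := exists_sub_twist_eq h hnil hI hK hE g l a (n - 1)
  obtain ⟨c, hc⟩ := exists_pow_smul_eq_zero_of_twist h hnil hI hK hE g l a n
  obtain ⟨x, hx, e'⟩ := hM m hm
  refine ⟨c + M, p ^ c • x, nsmul_mem hx _, ?_⟩
  have h1 := hc (p ^ M • f - diffHom K E (n - 1) n x)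
    (sub_mem (nsmul_mem hf _) (diffHom_mem_idealCochains n hx)) (by
      rw [← sub_eq_zero, map_sub, ← diffHom_twist, map_nsmul, smul_sub, ← map_nsmul, smul_comm,
        sub_sub_sub_comm, ← smul_sub, ← map_sub, e', map_nsmul, e, sub_self])
  rw [smul_sub, smul_smul, ← pow_add, sub_eq_zero] at h1
  rw [map_nsmul, ← h1]

/-- Surjectivity on cohomology. After solving the equation on cochains, the boundary of the solution
lies in the kernel of p^a minus the twist one degree higher; a factor p^c makes the solution a
cocycle. -/
theorem exists_cocycle_sub_twist_eq (h : IsPAdicPair p I) (hnil : StronglyTopNilpotent p φ I)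
    (hI : I ≤ I.comap φ) (hK : ∀ i, Projective (K.X i))
    (hE : ∀ i, Module.Finite R (E.X i) ∧ Module.Projective R (E.X i))
    (g : K ⟶ (pull φ).obj K) (l : (pull φ).obj E ⟶ E)
    (k : Cochain K E n) (hk : k ∈ idealCochains I K E n)
    (hk' : diffHom K E n (n + 1) k = 0) (a : ℕ) :
    ∃ (N : ℕ) (x : Cochain K E n), x ∈ idealCochains I K E n ∧ diffHom K E n (n + 1) x = 0 ∧
      p ^ a • x - twist g l n x = p ^ N • k := by
  obtain ⟨M, hM⟩ := exists_sub_twist_eq h hnil hI hK hE g l a n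
  obtain ⟨c, hc⟩ := exists_pow_smul_eq_zero_of_twist h hnil hI hK hE g l a (n + 1)
  obtain ⟨x, hx, e⟩ := hM k hk
  refine ⟨c + M, p ^ c • x, nsmul_mem hx _, ?_, ?_⟩
  · rw [map_nsmul]
    refine hc _ (diffHom_mem_idealCochains _ hx) ?_
    rw [← sub_eq_zero, ← diffHom_twist, ← map_nsmul, ← map_sub, e, map_nsmul, hk', smul_zero]
  · rw [map_nsmul, smul_comm, ← smul_sub, e, smul_smul, ← pow_add]

end Twist

end Dwork

namespace Dwork

open CochainComplex.HomComplex

/-! ## The defect of linearity over `R_φ` -/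

section Defect

variable {R : Type u} [CommRing R] {φ : R →+* R} {K L E : CochainComplex (ModuleCat.{u} R) ℤ}
  {n : ℤ} {I : Ideal R} {p a : ℕ}

/-- The map `f ↦ f ∘ l_K - l_L ∘ φ^* f` on cochains. -/
def defect (lK : (pull φ).obj K ⟶ K) (lL : (pull φ).obj L ⟶ L) (n : ℤ) :
    Cochain K L n →+ Cochain ((pull φ).obj K) L n :=
  preComp lK L n - (postComp ((pull φ).obj K) lL n).comp
    (mapCochain (ModuleCat.extendScalars φ) K L n)

variable (lK : (pull φ).obj K ⟶ K) (lL : (pull φ).obj L ⟶ L)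

theorem defect_apply (z : Cochain K L n) : defect lK lL n z = preComp lK L n z -
    postComp _ lL n (mapCochain (ModuleCat.extendScalars φ) K L n z) := rfl

theorem diffHom_defect (z : Cochain K L n) (m : ℤ) :
    diffHom _ _ n m (defect lK lL n z) = defect lK lL m (diffHom K L n m z) := by
  rw [defect_apply, defect_apply, map_sub, diffHom_preComp, diffHom_postComp, diffHom_mapCochain]

theorem mapCochain_mem (hI : I ≤ I.comap φ) {z : Cochain K L n}
    (hz : z ∈ idealCochains I K L n) :
    mapCochain (ModuleCat.extendScalars φ) K L n z ∈ idealCochains I _ _ n :=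
  idealCochains_mono (Ideal.map_le_iff_le_comap.2 hI) (mapCochain_mem_idealCochains φ hz)

theorem defect_mem (hI : I ≤ I.comap φ) {z : Cochain K L n}
    (hz : z ∈ idealCochains I K L n) : defect lK lL n z ∈ idealCochains I _ _ n :=
  sub_mem (preComp_mem_idealCochains _ hz) (postComp_mem_idealCochains _ (mapCochain_mem hI hz))

/-- If the defect vanishes, precomposition with g shows that p^a f is cohomologous to l_L ∘ φ^*f ∘
g. The retraction u, v moves this relation to E, where p-adic convergence is available. -/
theorem exists_pow_smul_mem_idealBoundaries_of_defect_eq_zero (h : IsPAdicPair p I)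
    (hnil : StronglyTopNilpotent p φ I) (hI : I ≤ I.comap φ) (hK : ∀ i, Projective (K.X i))
    (hE : ∀ i, Module.Finite R (E.X i) ∧ Module.Projective R (E.X i))
    (u : E ⟶ L) (v : L ⟶ E) (H : Homotopy (v ≫ u) (𝟙 L))
    (g : K ⟶ (pull φ).obj K) (Hg : Homotopy (g ≫ lK) (p ^ a • 𝟙 K)) (f : Cochain K L n)
    (hf : f ∈ idealCochains I K L n) (hd : diffHom K L n (n + 1) f = 0)
    (hdef : defect lK lL n f = 0) : ∃ N : ℕ, p ^ N • f ∈ idealBoundaries I K L n := by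
  let mf := mapCochain (ModuleCat.extendScalars φ) K L n f
  have hmf : mf ∈ idealCochains I _ _ n := mapCochain_mem hI hf
  have hmd : diffHom _ _ n (n + 1) mf = 0 := by rw [diffHom_mapCochain, hd, map_zero]
  obtain ⟨N, hN⟩ := exists_pow_smul_mem_idealBoundaries h hnil hI hK hE g
    ((pull φ).map u ≫ lL ≫ v) (a := a) (postComp K v n f) (postComp_mem_idealCochains v hf) (by
    have h1 := preComp_sub_mem_idealBoundaries Hg hf hd
    rw [preComp_nsmul_id, preComp_comp, sub_eq_zero.1 hdef, ← neg_mem_iff, neg_sub] at h1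
    have h2 := postComp_mem_idealBoundaries v h1
    rw [map_sub, map_nsmul] at h2
    -- Inserting v ≫ u, homotopic to the identity, under φ^* produces the twist on E.
    refine sub_mem_idealBoundaries_trans h2 ?_
    have h3 := postComp_sub_mem_idealBoundaries ((ModuleCat.extendScalars φ).mapHomotopy H) hmf hmd
    have h4 := preComp_mem_idealBoundaries g (postComp_mem_idealBoundaries (lL ≫ v) h3)
    rw [← neg_mem_iff, neg_sub] 
    convert h4 using 1
    rw [map_sub, map_sub, twist_apply, mapCochain_postComp, CategoryTheory.Functor.map_id, postComp_id,
      Functor.map_comp]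
    simp only [postComp_comp, preComp_postComp, AddMonoidHom.comp_apply, mf])
  refine ⟨N, ?_⟩
  have h5 := postComp_mem_idealBoundaries u hN
  have h6 := postComp_sub_mem_idealBoundaries H (nsmul_mem hf (p ^ N)) (by rw [map_nsmul, hd, smul_zero])
  rw [postComp_id, postComp_comp] at h6
  rw [map_nsmul] at h5 h6
  rw [map_nsmul] at h6
  simpa using sub_mem h5 h6

/-- Solve for p^a minus the twist on E with right-hand side v ∘ k ∘ g, and push the solution forward
by u. Its defect then agrees with p^N k after precomposition with g. Precomposing further with l_K
removes g at the cost of another factor p^a. -/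
theorem exists_defect_sub_mem_idealBoundaries (h : IsPAdicPair p I)
    (hnil : StronglyTopNilpotent p φ I) (hI : I ≤ I.comap φ) (hK : ∀ i, Projective (K.X i))
    (hE : ∀ i, Module.Finite R (E.X i) ∧ Module.Projective R (E.X i))
    (u : E ⟶ L) (v : L ⟶ E) (H : Homotopy (v ≫ u) (𝟙 L))
    (g : K ⟶ (pull φ).obj K) (Hg : Homotopy (g ≫ lK) (p ^ a • 𝟙 K))
    (Hg' : Homotopy (lK ≫ g) (p ^ a • 𝟙 _)) (k : Cochain ((pull φ).obj K) L n)
    (hk : k ∈ idealCochains I _ L n) (hd : diffHom _ L n (n + 1) k = 0) :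
    ∃ (N : ℕ) (x : Cochain K L n), x ∈ idealCochains I K L n ∧ diffHom K L n (n + 1) x = 0 ∧
      defect lK lL n x - p ^ N • k ∈ idealBoundaries I _ L n := by
  obtain ⟨N, x, hx, hxd, e⟩ := exists_cocycle_sub_twist_eq h hnil hI hK hE g
    ((pull φ).map u ≫ lL ≫ v) (preComp g E n (postComp _ v n k))
    (preComp_mem_idealCochains _ (postComp_mem_idealCochains _ hk))
    (by rw [diffHom_preComp, diffHom_postComp, hd, map_zero, map_zero]) a
  let y := postComp K u n x
  have hy : y ∈ idealCochains I K L n := postComp_mem_idealCochains _ hx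
  have hyd : diffHom K L n (n + 1) y = 0 := by rw [diffHom_postComp, hxd, map_zero]
  let my := mapCochain (ModuleCat.extendScalars φ) K L n y
  have hmy : my ∈ idealCochains I _ _ n := mapCochain_mem hI hy
  have hmd : diffHom _ _ n (n + 1) my = 0 := by rw [diffHom_mapCochain, hyd, map_zero]
  have hdy := defect_mem lK lL hI hy
  have hddy : diffHom _ _ n (n + 1) (defect lK lL n y) = 0 := by
    rw [diffHom_defect, hyd, map_zero]
  have h1 : preComp g L n (defect lK lL n y) - p ^ N • preComp g L n k ∈
      idealBoundaries I K L n := by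
    have h2 := preComp_sub_mem_idealBoundaries Hg hy hyd
    rw [preComp_nsmul_id, preComp_comp] at h2
    have h3 := preComp_mem_idealBoundaries g (postComp_sub_mem_idealBoundaries H
      (postComp_mem_idealCochains lL hmy) (by rw [diffHom_postComp, hmd, map_zero]))
    have h4 := preComp_mem_idealBoundaries g (postComp_sub_mem_idealBoundaries H hk hd)
    rw [map_sub, postComp_id, postComp_comp] at h3 h4
    have e' := congrArg (postComp K u n) e
    rw [map_sub, map_nsmul, map_nsmul, twist_apply, ← preComp_postComp, ← preComp_postComp] at e'
    rw [defect_apply, map_sub]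
    have h5 : postComp _ u n (postComp _ ((pull φ).map u ≫ lL ≫ v) n
        (mapCochain (ModuleCat.extendScalars φ) K E n x)) =
        postComp _ u n (postComp _ v n (postComp _ lL n my)) := by
      rw [postComp_comp, postComp_comp]
      change _ = postComp _ u n (postComp _ v n (postComp _ lL n
        (mapCochain (ModuleCat.extendScalars φ) K L n (postComp K u n x))))
      rw [mapCochain_postComp]
    rw [h5] at e'
    have h6 := add_mem (add_mem h2 h3) (nsmul_mem h4 (p ^ N))
    convert h6 using 1
    rw [smul_sub, ← e']
    abel
  have h7 := preComp_mem_idealBoundaries lK h1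
  rw [map_sub, map_nsmul, ← preComp_comp, ← preComp_comp] at h7
  have h8 := preComp_sub_mem_idealBoundaries Hg' hdy hddy
  have h9 := preComp_sub_mem_idealBoundaries Hg' hk hd
  rw [preComp_nsmul_id] at h8 h9
  refine ⟨N + a, p ^ a • y, nsmul_mem hy _, by rw [map_nsmul, hyd, smul_zero], ?_⟩
  have h10 := add_mem (sub_mem h7 h8) (nsmul_mem h9 (p ^ N))
  convert h10 using 1
  rw [map_nsmul, pow_add, mul_smul, smul_sub]
  abel

end Defect

/-! ## Linear maps over `R_φ` -/

section Linear

variable {R : Type u} [CommRing R] {φ : R →+* R} {I : Ideal R}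

theorem act_mem_smul_top (hI : I ≤ I.comap φ) (N : FMod φ) {y : (forgetFrob φ).obj N}
    (hy : y ∈ (I • ⊤ : Submodule R ((forgetFrob φ).obj N))) :
    act N y ∈ (I • ⊤ : Submodule R ((forgetFrob φ).obj N)) := by
  refine Submodule.smul_induction_on (p := fun y => act N y ∈ _) hy (fun r hr y _ => ?_)
    (fun x y hx hy => ?_)
  · rw [act_smul]
    exact Submodule.smul_mem_smul (hI hr) trivial
  · rw [act_add]
    exact Submodule.add_mem _ hx hy

/-- The component of `frobLin` at `M`. -/
abbrev frobLinObj (M : FMod φ) :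
    (ModuleCat.extendScalars φ).obj ((forgetFrob φ).obj M) ⟶ (forgetFrob φ).obj M :=
  (frobLin φ).app M

/-- The defect of linearity over `R_φ` of an `R`-linear map. -/
abbrev moduleDefect (M N : FMod φ) (l : (forgetFrob φ).obj M ⟶ (forgetFrob φ).obj N) :
    (ModuleCat.extendScalars φ).obj ((forgetFrob φ).obj M) ⟶ (forgetFrob φ).obj N :=
  frobLinObj M ≫ l - (ModuleCat.extendScalars φ).map l ≫ frobLinObj N

/-- For a projective `R_φ`-module `M`, every semilinear map from `M` to `I N` is the defect of
linearity over `R_φ` of an `R`-linear map with values in `I N`. -/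
theorem exists_defect_eq_of_projective (hI : I ≤ I.comap φ) (M N : FMod φ) [Projective M]
    (k : (ModuleCat.extendScalars φ).obj ((forgetFrob φ).obj M) ⟶ (forgetFrob φ).obj N)
    (hk : ∀ x, k.hom x ∈ (I • ⊤ : Submodule R ((forgetFrob φ).obj N))) :
    ∃ l : (forgetFrob φ).obj M ⟶ (forgetFrob φ).obj N,
      (∀ x, l.hom x ∈ (I • ⊤ : Submodule R ((forgetFrob φ).obj N))) ∧
      moduleDefect M N l = k := by
  let M' := (forgetFrob φ).obj M
  let N' := (forgetFrob φ).obj N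
  let Y : Submodule R N' := I • ⊤
  let κ : M' → N' := fun m => k.hom (oneTmul φ M' m)
  have κ_add : ∀ x y, κ (x + y) = κ x + κ y := fun x y => by
    simp only [κ, oneTmul_add, map_add]
  have κ_smul : ∀ (r : R) x, κ (r • x) = φ r • κ x := fun r x => by
    simp only [κ, oneTmul_smul, map_smul]
  -- The extension of M by I N whose Frobenius is (y, m) ↦ (F y + κ m, F m). It splits over R_φ
  -- because M is projective, and the first component of a splitting has defect κ.
  let E : ModuleCat.{u} R := ModuleCat.of R (Y × M')
  let T : E ⟶ (ModuleCat.restrictScalars φ).obj E :=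
    ModuleCat.ofHom (Y := (ModuleCat.restrictScalars φ).obj E)
      { toFun := fun z => ((⟨act N z.1.1 + κ z.2,
          Y.add_mem (act_mem_smul_top hI N z.1.2) (hk _)⟩, act M z.2) : Y × M')
        map_add' := fun x y => by
          refine Prod.ext (Subtype.ext ?_) (act_add M _ _)
          change act N (x.1.1 + y.1.1) + κ (x.2 + y.2) = _ + _ + (_ + _)
          rw [act_add, κ_add]
          abel
        map_smul' := fun r x => by
          refine Prod.ext (Subtype.ext ?_) (act_smul M _ _)
          change act N (r • x.1.1) + κ (r • x.2) = φ r • (act N x.1.1 + κ x.2)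
          rw [act_smul, κ_smul, smul_add] }
  let e := forgetOfFrob E T
  let pr : E ⟶ M' := ModuleCat.ofHom (X := E) (Y := M') (LinearMap.snd R Y M')
  let π : ofFrob E T ⟶ M := homMk (e.hom ≫ pr) fun x =>
    congrArg pr.hom (forgetOfFrob_act E T x)
  have hπ : Epi π := by
    refine (ModuleCat.epi_iff_surjective π).2 fun m => ⟨((0 : Y), (m : M')), rfl⟩
  let σ := Projective.factorThru (𝟙 M) π
  have hσ : σ ≫ π = 𝟙 M := Projective.factorThru_comp _ _
  let σ' : M' ⟶ E := (forgetFrob φ).map σ ≫ e.hom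
  have hσ' : ∀ m : M', (σ'.hom m).2 = m := fun m => congrArg (fun k => k.hom m) hσ
  have hσT : ∀ m : M', σ'.hom (act M m) = T.hom (σ'.hom m) := fun m =>
    (congrArg e.hom.hom (map_act σ m)).trans (forgetOfFrob_act E T _)
  let fst : E ⟶ N' := ModuleCat.ofHom (X := E) (Y := N')
    { toFun := fun z => z.1.1
      map_add' := fun _ _ => rfl
      map_smul' := fun _ _ => rfl }
  let l : M' ⟶ N' := σ' ≫ fst
  refine ⟨l, fun x => (σ'.hom x).1.2, ?_⟩
  refine extendScalars_hom_ext fun m => ?_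
  have h1 : l.hom (act M m) = act N (l.hom m) + κ m := by
    have h2 := congrArg (fun z : E => (z.1.1 : N')) (hσT m)
    refine h2.trans ?_
    change act N (l.hom m) + κ (σ'.hom m).2 = _
    rw [hσ']
  have h3 : ((frobLin φ).app M ≫ l).hom (oneTmul φ M' m) = l.hom (act M m) :=
    congrArg l.hom (frobLin_oneTmul M m)
  have h4 : ((ModuleCat.extendScalars φ).map l ≫ (frobLin φ).app N).hom (oneTmul φ M' m) =
      act N (l.hom m) := frobLin_oneTmul N _
  refine (congrArg₂ (fun x y : N' => x - y) h3 h4).trans ?_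
  rw [h1, add_sub_cancel_left]

variable {P' P : FComplex φ} {n : ℤ}

/-- The underlying `R`-linear cochain of an `R_φ`-linear cochain. -/
abbrev forgetCochain (P' P : FComplex φ) (n : ℤ) :
    Cochain P' P n →+ Cochain ((forgetComplex φ).obj P') ((forgetComplex φ).obj P) n :=
  mapCochain (forgetFrob φ) P' P n

/-- The defect of linearity over `R_φ` of an `R`-linear cochain. -/
abbrev frobDefect (P' P : FComplex φ) (n : ℤ) :
    Cochain ((forgetComplex φ).obj P') ((forgetComplex φ).obj P) n →+
      Cochain ((pull φ).obj ((forgetComplex φ).obj P')) ((forgetComplex φ).obj P) n :=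
  defect (frobLinComplex φ P') (frobLinComplex φ P) n

theorem frobDefect_v (z : Cochain ((forgetComplex φ).obj P') ((forgetComplex φ).obj P) n)
    (i j : ℤ) (h : i + n = j) : (frobDefect P' P n z).v i j h =
      moduleDefect (P'.X i) (P.X j) (z.v i j h) := by
  rw [defect_apply, Cochain.sub_v, preComp_v, postComp_v]
  rfl

theorem frobDefect_forgetCochain (z : Cochain P' P n) :
    frobDefect P' P n (forgetCochain P' P n z) = 0 := by
  refine Cochain.ext _ _ fun i j h => ?_
  rw [frobDefect_v]
  exact sub_eq_zero.2 ((frobLin φ).naturality (z.v i j h)).symm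

theorem exists_forgetCochain_eq
    (z : Cochain ((forgetComplex φ).obj P') ((forgetComplex φ).obj P) n)
    (hz : frobDefect P' P n z = 0) : ∃ y, forgetCochain P' P n y = z := by
  refine ⟨Cochain.mk fun i j h => homMk (z.v i j h) ((frobLin_comp_eq_iff _).1 ?_), ?_⟩
  · rw [← sub_eq_zero]
    exact (frobDefect_v z i j h).symm.trans (congrArg (fun y => y.v i j h) hz)
  · refine Cochain.ext _ _ fun i j h => ?_
    rfl

theorem forgetCochain_injective : Function.Injective (forgetCochain P' P n) := by
  intro x y h
  refine Cochain.ext _ _ fun i j hij => ?_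
  apply (forgetFrob φ).map_injective
  exact congrArg (fun z => z.v i j hij) h

theorem exists_frobDefect_eq (hI : I ≤ I.comap φ) (hP' : ∀ i, Projective (P'.X i))
    (k : Cochain ((pull φ).obj ((forgetComplex φ).obj P')) ((forgetComplex φ).obj P) n)
    (hk : k ∈ idealCochains I _ _ n) :
    ∃ l ∈ idealCochains I _ _ n, frobDefect P' P n l = k := by
  choose l hl hl' using fun (i j : ℤ) (h : i + n = j) =>
    have := hP' i
    exists_defect_eq_of_projective hI (P'.X i) (P.X j) (k.v i j h) (hk i j h)
  refine ⟨Cochain.mk l, hl, ?_⟩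
  refine Cochain.ext _ _ fun i j h => ?_
  rw [frobDefect_v]
  exact hl' i j h

end Linear

/-! ## Vanishing of cohomology with values in `I P` up to isogeny -/

section Isogeny

variable {R : Type u} [CommRing R] {φ : R →+* R} {I : Ideal R} {n : ℤ}

/-- The linear extension `φ^* C → C` of the `φ`-action is a homotopy equivalence up to a power
of `p`. -/
def IsFrobIsogeny (p : ℕ) (C : FComplex φ) : Prop :=
  ∃ (a : ℕ) (g : (forgetComplex φ).obj C ⟶ (pull φ).obj ((forgetComplex φ).obj C)),
    Nonempty (Homotopy (g ≫ frobLinComplex φ C) (p ^ a • 𝟙 _)) ∧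
    Nonempty (Homotopy (frobLinComplex φ C ≫ g) (p ^ a • 𝟙 _))

/-- A retract up to homotopy of a strictly perfect complex. -/
def IsHomotopyFinite (L : CochainComplex (ModuleCat.{u} R) ℤ) : Prop :=
  ∃ (E : CochainComplex (ModuleCat.{u} R) ℤ) (u : E ⟶ L) (v : L ⟶ E),
    IsStrictlyPerfect E ∧ Nonempty (Homotopy (v ≫ u) (𝟙 L))

/-- An argument as in the long exact sequence of the defect. Injectivity on cohomology gives an
R-linear primitive x of p^N f, whose defect is a cocycle because f has none. Surjectivity on
cohomology makes p^M times this defect the defect of a cocycle y, up to a boundary dz, and z is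
itself a defect because P' is projective over R_φ. -/
theorem exists_pow_smul_eq_diffHom {p : ℕ} (h : IsPAdicPair p I)
    (hnil : StronglyTopNilpotent p φ I) (hI : I ≤ I.comap φ) {P' P : FComplex φ}
    (hP' : ∀ i, Projective (P'.X i)) (hP'' : IsFrobIsogeny p P')
    (hP : IsHomotopyFinite ((forgetComplex φ).obj P)) (f : Cochain P' P n)
    (hf : forgetCochain P' P n f ∈ idealCochains I _ _ n) (hd : diffHom P' P n (n + 1) f = 0) :
    ∃ (N : ℕ) (y : Cochain P' P (n - 1)), forgetCochain P' P (n - 1) y ∈ idealCochains I _ _ _ ∧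
      diffHom P' P (n - 1) n y = p ^ N • f := by
  obtain ⟨a, g, ⟨Hg⟩, ⟨Hg'⟩⟩ := hP''
  obtain ⟨E, u, v, ⟨hE, -⟩, ⟨H⟩⟩ := hP
  have hK : ∀ i, Projective (((forgetComplex φ).obj P').X i) := fun i => by
    have := hP' i
    exact (forgetFrob φ).projective_obj (P'.X i)
  have hd' : diffHom _ _ n (n + 1) (forgetCochain P' P n f) = 0 := by
    rw [diffHom_mapCochain, hd, map_zero]
  obtain ⟨N, x, hx, ex⟩ := exists_pow_smul_mem_idealBoundaries_of_defect_eq_zero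
    (frobLinComplex φ P') (frobLinComplex φ P) h hnil hI hK hE u v H g Hg _ hf hd'
    (frobDefect_forgetCochain f)
  obtain ⟨M, y, hy, hyd, z, hz, e⟩ := exists_defect_sub_mem_idealBoundaries
    (frobLinComplex φ P') (frobLinComplex φ P) h hnil hI hK hE u v H g Hg Hg'
    (frobDefect P' P (n - 1) x) (defect_mem _ _ hI hx) (by
      rw [sub_add_cancel, diffHom_defect, ex, map_nsmul, frobDefect_forgetCochain, smul_zero])
  obtain ⟨l, hl, rfl⟩ := exists_frobDefect_eq hI hP' z hz
  rw [diffHom_defect] at e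
  -- This combination has zero defect, so it comes from an R_φ-linear cochain; its boundary is still
  -- p^M dx.
  have hx' : p ^ M • x - y + diffHom _ _ (n - 1 - 1) (n - 1) l ∈ idealCochains I _ _ (n - 1) :=
    add_mem (sub_mem (nsmul_mem hx _) hy) (diffHom_mem_idealCochains _ hl)
  obtain ⟨q, hq⟩ := exists_forgetCochain_eq
    (p ^ M • x - y + diffHom _ _ (n - 1 - 1) (n - 1) l) (by
      rw [map_add, map_sub, map_nsmul, e]
      abel)
  refine ⟨M + N, q, hq ▸ hx', forgetCochain_injective ?_⟩
  have h1 : diffHom _ _ (n - 1) n (diffHom ((forgetComplex φ).obj P') ((forgetComplex φ).obj P)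
      (n - 1 - 1) (n - 1) l) = 0 := δ_δ _ _ _ l
  rw [sub_add_cancel] at hyd
  rw [← diffHom_mapCochain, hq, map_add, map_sub, map_nsmul, ex, h1, hyd, map_nsmul, smul_smul,
    ← pow_add, sub_zero, add_zero]

end Isogeny

end Dwork

namespace Dwork

open CochainComplex.HomComplex

/-! ## K-projective complexes -/

section KProjective

variable {𝒞 : Type v} [Category.{w} 𝒞] [Abelian 𝒞]

theorem acyclic_mappingCone_iff {K L : CochainComplex 𝒞 ℤ} (f : K ⟶ L) :
    QuasiIso f ↔ (CochainComplex.mappingCone f).Acyclic := by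
  rw [← HomotopyCategory.quotient_obj_mem_subcategoryAcyclic_iff_acyclic]
  refine Iff.trans ?_ ((HomotopyCategory.subcategoryAcyclic 𝒞).trW_iff_of_distinguished _
    (HomotopyCategory.mappingCone_triangleh_distinguished f))
  rw [← HomotopyCategory.quasiIso_eq_trW_subcategoryAcyclic]
  exact (HomotopyCategory.quotient_map_mem_quasiIso_iff f).symm

attribute [local instance] HasDerivedCategory.standard in
theorem exists_lift_of_quasiIso {P K L : CochainComplex 𝒞 ℤ} [P.IsKProjective] (s : K ⟶ L)
    [QuasiIso s] (f : P ⟶ L) : ∃ g : P ⟶ K, Nonempty (Homotopy (g ≫ s) f) := by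
  have hs : IsIso (DerivedCategory.Qh.map ((HomotopyCategory.quotient _ _).map s)) :=
    inferInstanceAs (IsIso (DerivedCategory.Q.map s))
  obtain ⟨g, hg⟩ := (CochainComplex.IsKProjective.Qh_map_bijective P _).surjective
    (DerivedCategory.Qh.map ((HomotopyCategory.quotient _ _).map f) ≫
      inv (DerivedCategory.Qh.map ((HomotopyCategory.quotient _ _).map s)))
  obtain ⟨g, rfl⟩ := (HomotopyCategory.quotient _ _).map_surjective g
  refine ⟨g, ⟨HomotopyCategory.homotopyOfEq _ _ ?_⟩⟩
  apply (CochainComplex.IsKProjective.Qh_map_bijective P _).injective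
  rw [Functor.map_comp, Functor.map_comp, hg, Category.assoc, IsIso.inv_hom_id, Category.comp_id]

attribute [local instance] HasDerivedCategory.standard in
/-- A quasi-isomorphism between K-projective complexes is a homotopy equivalence. -/
theorem exists_homotopyEquiv {K L : CochainComplex 𝒞 ℤ} [K.IsKProjective] [L.IsKProjective]
    (f : K ⟶ L) [QuasiIso f] : ∃ e : HomotopyEquiv K L, e.hom = f := by
  obtain ⟨e, he⟩ := (CochainComplex.IsKProjective.quasiIso_iff f).1 inferInstance
  exact ⟨e, he⟩

theorem quasiIso_of_homotopyEquiv {K L : CochainComplex 𝒞 ℤ} (e : HomotopyEquiv K L) :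
    QuasiIso e.hom := inferInstance

theorem quasiIso_of_homotopy {K L : CochainComplex 𝒞 ℤ} {f g : K ⟶ L} (H : Homotopy f g)
    (hf : QuasiIso f) : QuasiIso g := by
  have hf' : HomologicalComplex.quasiIso 𝒞 (ComplexShape.up ℤ) f := hf
  rw [← HomotopyCategory.quotient_map_mem_quasiIso_iff, HomotopyCategory.eq_of_homotopy _ _ H] at hf'
  exact (HomotopyCategory.quotient_map_mem_quasiIso_iff g).1 hf'

variable {𝒟 : Type v'} [Category.{w'} 𝒟] [Abelian 𝒟] (Φ : 𝒞 ⥤ 𝒟) [Φ.Additive]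

theorem quasiIso_map_of_homotopyEquiv {K L : CochainComplex 𝒞 ℤ} (e : HomotopyEquiv K L) :
    QuasiIso ((Φ.mapHomologicalComplex (ComplexShape.up ℤ)).map e.hom) :=
  quasiIso_of_homotopyEquiv (Φ.mapHomotopyEquiv e)

theorem quasiIso_map_of_isKProjective {K L : CochainComplex 𝒞 ℤ} [K.IsKProjective]
    [L.IsKProjective] (f : K ⟶ L) [QuasiIso f] :
    QuasiIso ((Φ.mapHomologicalComplex (ComplexShape.up ℤ)).map f) := by
  obtain ⟨e, rfl⟩ := exists_homotopyEquiv f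
  exact quasiIso_map_of_homotopyEquiv Φ e

end KProjective

/-! ## Perfect complexes -/

section Perfect

variable {R : Type u} [CommRing R] {K L : CochainComplex (ModuleCat.{u} R) ℤ}

theorem IsStrictlyPerfect.isKProjective (h : IsStrictlyPerfect K) : K.IsKProjective := by
  obtain ⟨h1, a, b, h2⟩ := h
  have : ∀ i, Projective (K.X i) := fun i => (IsProjective.iff_projective _).1 (h1 i).2
  have : K.IsStrictlyLE b := (CochainComplex.isStrictlyLE_iff _ _).2 fun i hi => h2 i (Or.inr hi)
  exact CochainComplex.isKProjective_of_projective K b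

theorem IsPerfect.isHomotopyFinite (h : IsPerfect K) [K.IsKProjective] : IsHomotopyFinite K := by
  obtain ⟨P, f, hP, hf⟩ := h
  have := hP.isKProjective
  obtain ⟨e, rfl⟩ := exists_homotopyEquiv f
  exact ⟨P, e.hom, e.inv, hP, ⟨e.homotopyInvHomId⟩⟩

theorem IsPerfect.of_quasiIso (h : IsPerfect K) (f : K ⟶ L) [QuasiIso f] : IsPerfect L := by
  obtain ⟨P, g, hP, hg⟩ := h
  exact ⟨P, g ≫ f, hP, inferInstance⟩

theorem IsPerfect.of_quasiIso' (h : IsPerfect L) (f : K ⟶ L) [QuasiIso f] : IsPerfect K := by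
  obtain ⟨P, g, hP, hg⟩ := h
  have := hP.isKProjective
  obtain ⟨g', ⟨H⟩⟩ := exists_lift_of_quasiIso f g
  refine ⟨P, g', hP, ?_⟩
  have : QuasiIso (g' ≫ f) := quasiIso_of_homotopy H.symm hg
  exact quasiIso_of_comp_right g' f

variable {S : Type u} [CommRing S] (f : R →+* S)

theorem IsStrictlyPerfect.extendScalars (h : IsStrictlyPerfect K) : IsStrictlyPerfect
    (((ModuleCat.extendScalars.{u, u, u} f).mapHomologicalComplex (ComplexShape.up ℤ)).obj K) := by
  obtain ⟨h1, a, b, h2⟩ := h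
  refine ⟨fun n => ⟨?_, ?_⟩, a, b, fun n hn => (ModuleCat.extendScalars f).map_isZero (h2 n hn)⟩
  · let : Algebra R S := f.toAlgebra
    have := (h1 n).1
    exact Module.Finite.base_change R S (K.X n)
  · let : Algebra R S := f.toAlgebra
    have := (h1 n).2
    exact inferInstanceAs (Module.Projective S (S ⊗[R] K.X n))

theorem IsHomotopyFinite.extendScalars (h : IsHomotopyFinite K) : IsHomotopyFinite
    (((ModuleCat.extendScalars.{u, u, u} f).mapHomologicalComplex (ComplexShape.up ℤ)).obj K) := by
  obtain ⟨E, u, v, hE, ⟨H⟩⟩ := h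
  let Φ := (ModuleCat.extendScalars.{u, u, u} f).mapHomologicalComplex (ComplexShape.up ℤ)
  refine ⟨Φ.obj E, Φ.map u, Φ.map v, hE.extendScalars f, ⟨?_⟩⟩
  rw [← Φ.map_comp, ← Φ.map_id]
  exact (ModuleCat.extendScalars f).mapHomotopy H

theorem IsPerfect.extendScalars (h : IsPerfect K) [K.IsKProjective] : IsPerfect
    (((ModuleCat.extendScalars.{u, u, u} f).mapHomologicalComplex (ComplexShape.up ℤ)).obj K) := by
  obtain ⟨P, g, hP, hg⟩ := h
  have := hP.isKProjective
  exact ⟨_, _, hP.extendScalars f, quasiIso_map_of_isKProjective _ g⟩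

end Perfect

/-! ## The functor `M ↦ M ⊗ ℚ` -/

section TensorRat

variable {R : Type u} [CommRing R]

/-- R ⊗ ℚ is the localization of R at the nonzero integers. -/
theorem oneTmul_tensorRat_eq_zero (M : ModuleCat.{u} R) (m : M)
    (h : oneTmul (Algebra.TensorProduct.includeLeftRingHom : R →+* R ⊗[ℤ] ℚ) M m = 0) :
    ∃ n : ℤ, n ≠ 0 ∧ (n : R) • m = 0 := by
  have h1 := (isLocalizedModule_iff_isBaseChange
    (Algebra.algebraMapSubmonoid R (nonZeroDivisors ℤ)) (R ⊗[ℤ] ℚ)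
    (TensorProduct.mk R (R ⊗[ℤ] ℚ) M 1)).2 (TensorProduct.isBaseChange R M (R ⊗[ℤ] ℚ))
  let ι : R →+* R ⊗[ℤ] ℚ := Algebra.TensorProduct.includeLeftRingHom
  let N : ModuleCat.{u} (R ⊗[ℤ] ℚ) := ModuleCat.of (R ⊗[ℤ] ℚ) ((R ⊗[ℤ] ℚ) ⊗[R] M)
  let g : M ⟶ (ModuleCat.restrictScalars ι).obj N :=
    ModuleCat.ofHom (Y := (ModuleCat.restrictScalars ι).obj N)
      { toFun := fun m => (1 : R ⊗[ℤ] ℚ) ⊗ₜ m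
        map_add' := fun _ _ => TensorProduct.tmul_add _ _ _
        map_smul' := fun r m => by
          refine (TensorProduct.tmul_smul r _ _).trans ?_
          exact (algebraMap_smul (R ⊗[ℤ] ℚ) r ((1 : R ⊗[ℤ] ℚ) ⊗ₜ[R] m)).symm }
  have h2 := homEquiv_symm_oneTmul g m
  rw [h, map_zero] at h2
  obtain ⟨⟨s, hs⟩, e⟩ := (IsLocalizedModule.eq_zero_iff (m := m)
    (Algebra.algebraMapSubmonoid R (nonZeroDivisors ℤ)) (TensorProduct.mk R (R ⊗[ℤ] ℚ) M 1)).1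
    h2.symm
  obtain ⟨n, hn, rfl⟩ := hs
  exact ⟨n, nonZeroDivisors.ne_zero hn, e⟩

theorem exists_smul_eq_oneTmul_tensorRat (M : ModuleCat.{u} R) (x : (tensorRat R).obj M) :
    ∃ (n : ℤ) (m : M), n ≠ 0 ∧ (n : R ⊗[ℤ] ℚ) • x =
      oneTmul (Algebra.TensorProduct.includeLeftRingHom : R →+* R ⊗[ℤ] ℚ) M m := by
  induction x using extendScalars_induction with
  | add x y hx hy =>
    obtain ⟨a, m, ha, hm⟩ := hx
    obtain ⟨b, m', hb, hm'⟩ := hy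
    refine ⟨a * b, (b : R) • m + (a : R) • m', mul_ne_zero ha hb, ?_⟩
    rw [oneTmul_add, oneTmul_smul, oneTmul_smul, ← hm, ← hm', smul_smul, smul_smul, map_intCast,
      map_intCast, Int.cast_mul, smul_add, mul_comm (b : R ⊗[ℤ] ℚ)]
  | smul_one s m =>
    obtain ⟨n, r, hn, e⟩ : ∃ (n : ℤ) (r : R), n ≠ 0 ∧ (n : R ⊗[ℤ] ℚ) * s = r ⊗ₜ 1 := by
      induction s using TensorProduct.induction_on with
      | zero => exact ⟨1, 0, one_ne_zero, by rw [mul_zero, zero_tmul]⟩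
      | tmul r q =>
        refine ⟨q.den, (q.num : R) * r, by exact_mod_cast q.den_ne_zero, ?_⟩
        rw [← zsmul_eq_mul, ← TensorProduct.tmul_smul, zsmul_eq_mul, Int.cast_natCast,
          Rat.den_mul_eq_num, ← zsmul_eq_mul, TensorProduct.smul_tmul, zsmul_eq_mul, mul_one]
      | add s t hs ht =>
        obtain ⟨a, r, ha, hr⟩ := hs
        obtain ⟨b, r', hb, hr'⟩ := ht
        refine ⟨a * b, (b : R) * r + (a : R) * r', mul_ne_zero ha hb, ?_⟩
        have h1 : ∀ (k : ℤ) (x : R), ((k : R) * x) ⊗ₜ[ℤ] (1 : ℚ) = (k : R ⊗[ℤ] ℚ) * (x ⊗ₜ 1) := by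
          intro k x
          rw [← zsmul_eq_mul, ← zsmul_eq_mul, TensorProduct.smul_tmul']
        rw [TensorProduct.add_tmul, h1, h1, ← hr, ← hr', Int.cast_mul]
        ring
    refine ⟨n, r • m, hn, ?_⟩
    rw [smul_smul, e, oneTmul_smul]
    rfl

variable {p : ℕ}

/-- Every cocycle is a boundary up to a power of `p`. -/
def IsTorsionAcyclic (p : ℕ) (Y : CochainComplex (ModuleCat.{u} R) ℤ) : Prop :=
  ∀ (i j k : ℤ) (_ : i + 1 = j) (_ : j + 1 = k) (y : Y.X j), (Y.d j k).hom y = 0 →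
    ∃ (a : ℕ) (z : Y.X i), (Y.d i j).hom z = p ^ a • y

/-- Clear denominators in a primitive over R ⊗ ℚ; up to a unit the resulting integer is a power of
p. The exponent depends on the cocycle. -/
theorem isTorsionAcyclic_of_acyclic_tensorRat [Fact p.Prime] (hp : PrimeToUnits R p)
    (Y : CochainComplex (ModuleCat.{u} R) ℤ)
    (hY : (((tensorRat R).mapHomologicalComplex (ComplexShape.up ℤ)).obj Y).Acyclic) :
    IsTorsionAcyclic p Y := by
  intro i j k hij hjk y hy
  have h1 := hY j
  rw [HomologicalComplex.exactAt_iff' _ i j k (by simp [← hij]) (by simp [← hjk]),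
    ShortComplex.moduleCat_exact_iff] at h1
  let ι : R →+* R ⊗[ℤ] ℚ := Algebra.TensorProduct.includeLeftRingHom
  obtain ⟨x, hx⟩ := h1 (oneTmul ι (Y.X j) y) (by
    change oneTmul ι (Y.X k) ((Y.d j k).hom y) = 0
    rw [hy]
    exact (((ModuleCat.extendRestrictScalarsAdj ι).unit.app (Y.X k)).hom.map_zero))
  obtain ⟨n, z, hn, hz⟩ := exists_smul_eq_oneTmul_tensorRat (Y.X i) x
  have h2 : oneTmul ι (Y.X j) ((n : R) • y) = oneTmul ι (Y.X j) ((Y.d i j).hom z) := by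
    rw [oneTmul_smul, ← hx, map_intCast]
    refine (((tensorRat R).map (Y.d i j)).hom.map_smul (n : R ⊗[ℤ] ℚ) x).symm.trans ?_
    rw [hz]
    rfl
  have h3 : oneTmul ι (Y.X j) ((n : R) • y - (Y.d i j).hom z) = 0 := by
    refine (((ModuleCat.extendRestrictScalarsAdj ι).unit.app (Y.X j)).hom.map_sub _ _).trans ?_
    exact sub_eq_zero.2 h2
  obtain ⟨m, hm, e⟩ := oneTmul_tensorRat_eq_zero (Y.X j) _ h3
  obtain ⟨a, r, s, hrs, hmn⟩ := hp.exists_eq (m * n) (mul_ne_zero hm hn)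
  refine ⟨a, s • (m : R) • z, ?_⟩
  rw [smul_sub, sub_eq_zero, smul_smul, ← Int.cast_mul, hmn, mul_smul] at e
  rw [map_smul, map_smul, ← e, smul_smul, mul_comm s, hrs, one_smul, ← Nat.cast_pow,
    Nat.cast_smul_eq_nsmul]

end TensorRat

end Dwork

namespace Dwork

open CochainComplex.HomComplex

/-! ## Morphisms to torsion complexes -/

section Torsion

variable {R : Type u} [CommRing R] {p : ℕ} {E K X Y : CochainComplex (ModuleCat.{u} R) ℤ}

/-- A single exponent works on a finite generating set, hence on M; projectivity then lifts the
multiple through the differential. -/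
theorem IsTorsionAcyclic.exists_lift (hY : IsTorsionAcyclic p Y) {M : ModuleCat.{u} R}
    [Module.Finite R M] [Module.Projective R M] {i j k : ℤ} (hij : i + 1 = j) (hjk : j + 1 = k)
    (f : M ⟶ Y.X j) (hf : f ≫ Y.d j k = 0) : ∃ (a : ℕ) (t : M ⟶ Y.X i), t ≫ Y.d i j = p ^ a • f := by
  have h1 : ∀ m : M, ∃ (a : ℕ), p ^ a • f.hom m ∈ LinearMap.range (Y.d i j).hom := fun m => by
    obtain ⟨a, z, hz⟩ := hY i j k hij hjk (f.hom m) (congrArg (fun g => g.hom m) hf)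
    exact ⟨a, z, hz⟩
  obtain ⟨s, hs⟩ := (Module.Finite.fg_top : (⊤ : Submodule R M).FG)
  choose a ha using h1
  let N := ∑ m ∈ s, a m
  have h2 : ∀ m : M, p ^ N • f.hom m ∈ LinearMap.range (Y.d i j).hom := by
    intro m
    have hm : m ∈ Submodule.span R (s : Set M) := hs ▸ trivial
    induction hm using Submodule.span_induction with
    | mem x hx =>
      obtain ⟨c, hc⟩ := Nat.exists_eq_add_of_le (Finset.single_le_sum (f := a)
        (fun _ _ => Nat.zero_le _) hx)
      have : N = a x + c := hc
      rw [this, add_comm, pow_add, mul_smul]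
      exact nsmul_mem (ha x) _
    | zero => rw [map_zero, smul_zero]; exact zero_mem _
    | add x y _ _ hx hy => rw [map_add, smul_add]; exact add_mem hx hy
    | smul r x _ hx => rw [map_smul, smul_comm]; exact Submodule.smul_mem _ r hx
  obtain ⟨t, ht⟩ := Module.projective_lifting_property (Y.d i j).hom.rangeRestrict
    ((p ^ N • f.hom).codRestrict _ h2) (Y.d i j).hom.surjective_rangeRestrict
  refine ⟨N, ModuleCat.ofHom t, ModuleCat.hom_ext (LinearMap.ext fun m => ?_)⟩
  exact congrArg Subtype.val (LinearMap.congr_fun ht m)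

theorem nsmul_v {n : ℤ} (k : ℕ) (z : Cochain E Y n) (i j : ℤ) (h : i + n = j) :
    (k • z).v i j h = k • z.v i j h := by
  simpa using Cochain.smul_v (k : ℤ) z i j h

/-- Descend through the finitely many nonzero degrees of E. In the top degree where z is nonzero its
component is a cocycle of Y, so a p-power multiple can be removed by a cochain concentrated in that
degree. -/
theorem IsTorsionAcyclic.exists_diffHom_eq (hY : IsTorsionAcyclic p Y) (hE : IsStrictlyPerfect E)
    (z : Cochain E Y 0) (hz : diffHom E Y 0 1 z = 0) :
    ∃ (N : ℕ) (y : Cochain E Y (-1)), diffHom E Y (-1) 0 y = p ^ N • z := by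
  obtain ⟨h1, a, b, h2⟩ := hE
  have key : ∀ m : ℤ, a ≤ m → ∀ z : Cochain E Y 0, diffHom E Y 0 1 z = 0 →
      (∀ i, m ≤ i → z.v i i (add_zero i) = 0) →
      ∃ (N : ℕ) (y : Cochain E Y (-1)), diffHom E Y (-1) 0 y = p ^ N • z := by
    intro m hm
    induction m, hm using Int.leInduction with
    | base =>
      intro z _ hz
      refine ⟨0, 0, ?_⟩
      rw [map_zero, pow_zero, one_smul]
      refine Cochain.ext₀ _ _ fun i => ?_
      by_cases hi : a ≤ i
      · rw [hz i hi, Cochain.zero_v]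
      · exact (h2 i (Or.inl (not_le.1 hi))).eq_of_src _ _
    | succ m hm ih =>
      intro z hz hz'
      have := (h1 m).1
      have := (h1 m).2
      obtain ⟨c, t, ht⟩ := hY.exists_lift (sub_add_cancel m 1) (rfl : m + 1 = m + 1)
        (z.v m m (add_zero m)) (by
          have h3 := congrArg (fun y => y.v m (m + 1) rfl) hz
          change (δ 0 1 z).v m (m + 1) rfl = 0 at h3
          rw [δ_zero_cochain_v, hz' (m + 1) le_rfl, Limits.comp_zero, sub_zero] at h3
          exact h3)
      let s : Cochain E Y (-1) := Cochain.single t (-1)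
      have hs : ∀ i, m ≤ i → (diffHom E Y (-1) 0 s).v i i (add_zero i) =
          p ^ c • z.v i i (add_zero i) := by
        intro i hi
        rw [diffHom_apply, δ_v (-1) 0 rfl s i i (add_zero i) (i - 1) (i + 1) rfl rfl,
          Cochain.single_v_eq_zero t (-1) (i + 1) i (by omega) (by omega), Limits.comp_zero,
          smul_zero, add_zero]
        rcases hi.eq_or_lt with rfl | hi
        · rw [Cochain.single_v, ht]
        · rw [Cochain.single_v_eq_zero t (-1) i (i - 1) (by omega) (by omega), Limits.zero_comp,
            hz' i hi, smul_zero]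
      obtain ⟨N, y, hy⟩ := ih (p ^ c • z - diffHom E Y (-1) 0 s) (by
        have h4 : diffHom E Y 0 1 (diffHom E Y (-1) 0 s) = 0 := δ_δ _ _ _ s
        rw [map_sub, map_nsmul, hz, smul_zero, h4, sub_zero]) (fun i hi => by
          rw [Cochain.sub_v, hs i hi, nsmul_v, sub_self])
      refine ⟨N + c, y + p ^ N • s, ?_⟩
      rw [map_add, hy, map_nsmul, smul_sub, sub_add_cancel, smul_smul, pow_add]
  -- For b + 1 < a the complex E is zero and the induction starts at its base a.
  rcases le_total a (b + 1) with hab | hab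
  · exact key (b + 1) hab z hz fun i hi => (h2 i (Or.inr (by omega))).eq_of_src _ _
  · exact key a le_rfl z hz fun i hi => (h2 i (Or.inr (by omega))).eq_of_src _ _

theorem map_nsmul_quotient (k : ℕ) (f : X ⟶ Y) :
    (HomotopyCategory.quotient (ModuleCat.{u} R) (ComplexShape.up ℤ)).map (k • f) =
      k • (HomotopyCategory.quotient _ _).map f :=
  Functor.map_nsmul _

theorem IsTorsionAcyclic.exists_pow_smul_eq_zero (hY : IsTorsionAcyclic p Y)
    (hX : IsHomotopyFinite X)
    (f : (HomotopyCategory.quotient _ (ComplexShape.up ℤ)).obj X ⟶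
      (HomotopyCategory.quotient _ _).obj Y) : ∃ N : ℕ, p ^ N • f = 0 := by
  obtain ⟨f, rfl⟩ := (HomotopyCategory.quotient _ _).map_surjective f
  obtain ⟨E, u, v, hE, ⟨H⟩⟩ := hX
  obtain ⟨N, y, hy⟩ := hY.exists_diffHom_eq hE (Cochain.ofHom (u ≫ f)) (δ_ofHom (p := 1) (u ≫ f))
  refine ⟨N, ?_⟩
  have h1 : Homotopy (p ^ N • (u ≫ f)) 0 := (Cochain.equivHomotopy _ _).symm ⟨y, by
    rw [Cochain.ofHom_zero, add_zero]
    change _ = diffHom E Y (-1) 0 y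
    rw [hy]
    refine Cochain.ext₀ _ _ fun i => ?_
    rw [nsmul_v, Cochain.ofHom_v, Cochain.ofHom_v]
    simp⟩
  have h2 := HomotopyCategory.eq_of_homotopy _ _ h1
  have h3 := HomotopyCategory.eq_of_homotopy _ _ H
  rw [map_nsmul_quotient, Functor.map_comp, Functor.map_zero] at h2
  rw [Functor.map_comp, CategoryTheory.Functor.map_id] at h3
  rw [← Category.id_comp ((HomotopyCategory.quotient _ _).map f), ← h3, Category.assoc,
    ← Preadditive.comp_nsmul, h2, Limits.comp_zero]

theorem IsTorsionAcyclic.shift (hY : IsTorsionAcyclic p Y) (n : ℤ) : IsTorsionAcyclic p (Y⟦n⟧) := by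
  intro i j k hij hjk y hy
  have hy' : (Y.d (j + n) (k + n)).hom y = 0 := by
    rw [CochainComplex.shiftFunctor_obj_d'] at hy
    rcases Int.units_eq_one_or n.negOnePow with h | h
    · rw [h, one_smul] at hy
      exact hy
    · rw [h, Units.neg_smul, one_smul] at hy
      exact neg_eq_zero.1 hy
  obtain ⟨a, z, hz⟩ := hY (i + n) (j + n) (k + n) (by omega) (by omega) y hy'
  refine ⟨a, ((n.negOnePow : ℤˣ) : ℤ) • z, ?_⟩
  rw [CochainComplex.shiftFunctor_obj_d']
  rcases Int.units_eq_one_or n.negOnePow with h | h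
  · rw [h, one_smul, Units.val_one, one_smul]
    exact hz
  · rw [h, Units.neg_smul, one_smul, Units.val_neg, Units.val_one, neg_smul, one_smul]
    exact (((Y.d (i + n) (j + n)).hom.map_neg z).symm ▸ neg_neg _).trans hz

end Torsion

/-! ## Nondegeneracy and isogenies -/

section Nondegenerate

variable {R : Type u} [CommRing R] {φ : R →+* R} {p : ℕ}

theorem quasiIso_tensorRat_frobLin {P : FComplex φ}
    [((forgetComplex φ).obj P).IsKProjective] (h : isNondegenerate φ P) :
    QuasiIso (((tensorRat R).mapHomologicalComplex (ComplexShape.up ℤ)).map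
      (frobLinComplex φ P)) := by
  obtain ⟨K, f, hK, hf, h⟩ := h
  obtain ⟨e, rfl⟩ := exists_homotopyEquiv f
  have h1 : QuasiIso (((tensorRat R).mapHomologicalComplex (ComplexShape.up ℤ)).map
      (((ModuleCat.extendScalars φ).mapHomologicalComplex (ComplexShape.up ℤ)).map e.hom)) :=
    quasiIso_map_of_homotopyEquiv (tensorRat R) ((ModuleCat.extendScalars φ).mapHomotopyEquiv e)
  rw [Functor.map_comp] at h
  exact (quasiIso_iff_comp_left _ _).1 h

/-- If multiplication by powers of `p` kills the morphisms to the third object of a distinguished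
triangle, then its first morphism is an isomorphism up to a power of `p`. -/
theorem exists_isogeny_of_distTriang {𝒞 : Type v} [Category.{w} 𝒞] [Preadditive 𝒞]
    [Limits.HasZeroObject 𝒞] [HasShift 𝒞 ℤ] [∀ n : ℤ, (shiftFunctor 𝒞 n).Additive]
    [Pretriangulated 𝒞] {T : Pretriangulated.Triangle 𝒞}
    (hT : T ∈ Pretriangulated.distinguishedTriangles) {p a : ℕ} (ha : p ^ a • T.mor₂ = 0)
    (h : ∀ t : T.obj₁ ⟶ T.obj₃⟦(-1 : ℤ)⟧, ∃ b : ℕ, p ^ b • t = 0) :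
    ∃ (b : ℕ) (g : T.obj₂ ⟶ T.obj₁), g ≫ T.mor₁ = p ^ b • 𝟙 _ ∧ T.mor₁ ≫ g = p ^ b • 𝟙 _ := by
  obtain ⟨g, hg⟩ := Pretriangulated.Triangle.coyoneda_exact₂ _ hT (p ^ a • 𝟙 T.obj₂) (by
    rw [Preadditive.nsmul_comp, Category.id_comp, ha])
  -- The composite in the other order differs from p^a by a morphism that factors through
  -- T.obj₃⟦-1⟧, so a further power of p equates them.
  obtain ⟨t, ht⟩ := Pretriangulated.Triangle.coyoneda_exact₂ _
    (Pretriangulated.inv_rot_of_distTriang _ hT) (T.mor₁ ≫ g - p ^ a • 𝟙 T.obj₁) (by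
      change (T.mor₁ ≫ g - p ^ a • 𝟙 T.obj₁) ≫ T.mor₁ = 0
      rw [Preadditive.sub_comp, Category.assoc, ← hg, Preadditive.comp_nsmul,
        Preadditive.nsmul_comp, Category.comp_id, Category.id_comp, sub_self])
  obtain ⟨b, hb⟩ := h t
  refine ⟨b + a, p ^ b • g, ?_, ?_⟩
  · rw [Preadditive.nsmul_comp, ← hg, smul_smul, ← pow_add]
  · have h1 : p ^ b • (T.mor₁ ≫ g - p ^ a • 𝟙 T.obj₁) = 0 :=
      (congrArg (fun y => p ^ b • y) ht).trans ((Preadditive.nsmul_comp _ _ _).symm.trans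
        ((congrArg (fun y => y ≫ T.invRotate.mor₁) hb).trans Limits.zero_comp))
    rw [smul_sub, sub_eq_zero, smul_smul, ← pow_add] at h1
    rw [Preadditive.comp_nsmul, h1]

/-- The cone of the linearized Frobenius is acyclic after tensoring with ℚ, hence torsion acyclic.
Perfectness of P bounds the denominators: each morphism to the cone or its shifts from P or φ^*P is
killed by a power of p, and the triangle yields the inverse up to p-powers. -/
theorem isFrobIsogeny_of_isNondegenerate [Fact p.Prime] (hp : PrimeToUnits R p) {P : FComplex φ}
    [((forgetComplex φ).obj P).IsKProjective] (hP : isRPerfect φ P) (h : isNondegenerate φ P) :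
    IsFrobIsogeny p P := by
  let K := (forgetComplex φ).obj P
  let l : (pull φ).obj K ⟶ K := frobLinComplex φ P
  let Q := HomotopyCategory.quotient (ModuleCat.{u} R) (ComplexShape.up ℤ)
  have hK : IsHomotopyFinite K := hP.isHomotopyFinite
  have hpK : IsHomotopyFinite ((pull φ).obj K) := hK.extendScalars φ
  have hY : IsTorsionAcyclic p (CochainComplex.mappingCone l) := by
    refine isTorsionAcyclic_of_acyclic_tensorRat hp _ ?_
    have h1 := (acyclic_mappingCone_iff _).1 (quasiIso_tensorRat_frobLin h)
    exact fun i => (h1 i).of_iso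
      (CochainComplex.mappingCone.mapHomologicalComplexIso l (tensorRat R)).symm
  obtain ⟨a, ha⟩ := hY.exists_pow_smul_eq_zero hK (Q.map (CochainComplex.mappingCone.inr l))
  have key : ∃ (b : ℕ) (g : Q.obj K ⟶ Q.obj ((pull φ).obj K)),
      g ≫ Q.map l = p ^ b • 𝟙 _ ∧ Q.map l ≫ g = p ^ b • 𝟙 _ := by
    refine exists_isogeny_of_distTriang
      (HomotopyCategory.mappingCone_triangleh_distinguished l) ha fun t => ?_
    let e := ((HomotopyCategory.quotient (ModuleCat.{u} R) (ComplexShape.up ℤ)).commShiftIso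
      (-1 : ℤ)).app (CochainComplex.mappingCone l)
    obtain ⟨b, hb⟩ := (hY.shift (-1)).exists_pow_smul_eq_zero hpK (t ≫ e.inv)
    refine ⟨b, ?_⟩
    refine (cancel_mono e.inv).1 ?_
    exact (Preadditive.nsmul_comp _ _ _).trans (hb.trans Limits.zero_comp.symm)
  obtain ⟨b, g, h1, h2⟩ := key
  obtain ⟨g, rfl⟩ := Q.map_surjective g
  refine ⟨b, g, ⟨HomotopyCategory.homotopyOfEq _ _ ?_⟩, ⟨HomotopyCategory.homotopyOfEq _ _ ?_⟩⟩
  · rw [Functor.map_comp, map_nsmul_quotient, CategoryTheory.Functor.map_id]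
    exact h1
  · rw [Functor.map_comp, map_nsmul_quotient, CategoryTheory.Functor.map_id]
    exact h2

theorem hom_nsmul_id_inv {𝒞 : Type v} [Category.{w} 𝒞] [Preadditive 𝒞] {X Y : 𝒞} (e : X ≅ Y)
    (n : ℕ) : (e.hom ≫ (n • 𝟙 Y)) ≫ e.inv = n • 𝟙 X := by
  simp

theorem isIso_nsmul_id {A : Type v} [CommRing A] (n : ℕ) {c : A} (hc : c * (n : A) = 1)
    (Z : ModuleCat.{w} A) : IsIso (n • 𝟙 Z) := by
  let e : Z ⟶ Z := ModuleCat.ofHom (LinearMap.lsmul A Z c)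
  have h1 : ∀ z : Z, n • z = (n : A) • z := fun z => (Nat.cast_smul_eq_nsmul A n z).symm
  refine ⟨e, ModuleCat.hom_ext (LinearMap.ext fun z => ?_),
    ModuleCat.hom_ext (LinearMap.ext fun z => ?_)⟩
  · change c • n • z = z
    rw [h1, smul_smul, hc, one_smul]
  · change n • c • z = z
    rw [h1, smul_smul, mul_comm, hc, one_smul]

/-- After tensoring with ℚ the power p^a acts invertibly on cohomology. This converse makes
nondegeneracy stable under base change, since being an isogeny visibly is. -/
theorem IsFrobIsogeny.isNondegenerate [hp : Fact p.Prime] {P : FComplex φ}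
    [hP : ((forgetComplex φ).obj P).IsKProjective] (h : IsFrobIsogeny p P) :
    isNondegenerate φ P := by
  obtain ⟨a, g, ⟨H₁⟩, ⟨H₂⟩⟩ := h
  refine ⟨_, 𝟙 _, hP, inferInstance, ?_⟩
  rw [CategoryTheory.Functor.map_id, Category.id_comp]
  let Φ := (tensorRat R).mapHomologicalComplex (ComplexShape.up ℤ)
  have H₁' := (tensorRat R).mapHomotopy H₁
  have H₂' := (tensorRat R).mapHomotopy H₂
  obtain ⟨c, hc⟩ : ∃ c : R ⊗[ℤ] ℚ, c * ((p ^ a : ℕ) : R ⊗[ℤ] ℚ) = 1 := by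
    have h0 : ((p ^ a : ℕ) : ℚ) ≠ 0 := Nat.cast_ne_zero.2 (pow_ne_zero _ hp.1.ne_zero)
    refine ⟨1 ⊗ₜ (((p ^ a : ℕ) : ℚ)⁻¹), ?_⟩
    have h1 : ((p ^ a : ℕ) : R ⊗[ℤ] ℚ) = (1 : R) ⊗ₜ[ℤ] ((p ^ a : ℕ) : ℚ) :=
      (map_natCast (Algebra.TensorProduct.includeRight : ℚ →ₐ[ℤ] R ⊗[ℤ] ℚ) (p ^ a)).symm
    rw [h1, Algebra.TensorProduct.tmul_mul_tmul, inv_mul_cancel₀ h0, one_mul]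
    rfl
  rw [quasiIso_iff]
  intro i
  rw [quasiIsoAt_iff_isIso_homologyMap]
  have h1 := H₁'.homologyMap_eq i
  have h2 := H₂'.homologyMap_eq i
  have hs : ∀ (Z : CochainComplex (ModuleCat.{u} (R ⊗[ℤ] ℚ)) ℤ),
      IsIso (HomologicalComplex.homologyMap (p ^ a • 𝟙 Z) i) := by
    intro Z
    have h3 : HomologicalComplex.homologyMap (p ^ a • 𝟙 Z) i = p ^ a • 𝟙 (Z.homology i) := by
      rw [← HomologicalComplex.homologyMap_id]
      exact Functor.map_nsmul (HomologicalComplex.homologyFunctor _ _ i)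
    rw [h3]
    exact isIso_nsmul_id _ hc _
  have h4 : ∀ Z : CochainComplex (ModuleCat.{u} R) ℤ,
      ((tensorRat R).mapHomologicalComplex (ComplexShape.up ℤ)).map (p ^ a • 𝟙 Z) =
        p ^ a • 𝟙 _ := fun Z => by
    rw [Functor.map_nsmul, CategoryTheory.Functor.map_id]
  rw [h4, Functor.map_comp, HomologicalComplex.homologyMap_comp] at h1 h2
  have := hs (Φ.obj ((forgetComplex φ).obj P))
  have := hs (Φ.obj ((pull φ).obj ((forgetComplex φ).obj P)))
  have := mono_of_mono_fac h2
  have := epi_of_epi_fac h1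
  exact isIso_of_mono_of_epi _

variable {S : Type u} [CommRing S] {ψ : S →+* S} (f : R →+* S) (hf : f.comp φ = ψ.comp f)

/-- Base change of complexes of `R_φ`-modules. -/
abbrev baseChangeComplex : FComplex φ ⥤ FComplex ψ :=
  (baseChange f hf).mapHomologicalComplex (ComplexShape.up ℤ)

/-- Base change of complexes of `R_φ`-modules is base change of the underlying complexes. -/
def baseChangeComplexForget (P : FComplex φ) :
    (forgetComplex ψ).obj ((baseChangeComplex f hf).obj P) ≅
      ((ModuleCat.extendScalars f).mapHomologicalComplex (ComplexShape.up ℤ)).obj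
        ((forgetComplex φ).obj P) :=
  HomologicalComplex.Hom.isoOfComponents (fun i => (baseChangeForget f hf).app (P.X i))
    fun i j _ => ((baseChangeForget f hf).hom.naturality (P.d i j)).symm

/-- Extensions of scalars of complexes along a commutative square. -/
def extendScalarsSquareComplex (f : R →+* S) (hf : f.comp φ = ψ.comp f)
    (K : CochainComplex (ModuleCat.{u} R) ℤ) :
    (pull ψ).obj (((ModuleCat.extendScalars f).mapHomologicalComplex (ComplexShape.up ℤ)).obj K) ≅
      ((ModuleCat.extendScalars f).mapHomologicalComplex (ComplexShape.up ℤ)).obj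
        ((pull φ).obj K) :=
  HomologicalComplex.Hom.isoOfComponents (fun i => (extendScalarsSquare f hf).app (K.X i))
    fun i j _ => ((extendScalarsSquare f hf).hom.naturality (K.d i j)).symm

theorem frobLinComplex_baseChange (P : FComplex φ) :
    frobLinComplex ψ ((baseChangeComplex f hf).obj P) ≫ (baseChangeComplexForget f hf P).hom =
      (pull ψ).map (baseChangeComplexForget f hf P).hom ≫
        (extendScalarsSquareComplex f hf ((forgetComplex φ).obj P)).hom ≫
          ((ModuleCat.extendScalars f).mapHomologicalComplex (ComplexShape.up ℤ)).map
            (frobLinComplex φ P) := by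
  refine HomologicalComplex.hom_ext _ _ fun i => ?_
  exact frobLin_baseChange f hf (P.X i)

theorem IsFrobIsogeny.baseChange {P : FComplex φ} (h : IsFrobIsogeny p P) :
    IsFrobIsogeny p ((baseChangeComplex f hf).obj P) := by
  obtain ⟨a, g, ⟨H₁⟩, ⟨H₂⟩⟩ := h
  let Φ := (ModuleCat.extendScalars.{u, u, u} f).mapHomologicalComplex (ComplexShape.up ℤ)
  let B := baseChangeComplexForget f hf P
  let A := (pull ψ).mapIso B ≪≫ extendScalarsSquareComplex f hf ((forgetComplex φ).obj P)
  have hl : frobLinComplex ψ ((baseChangeComplex f hf).obj P) =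
      A.hom ≫ Φ.map (frobLinComplex φ P) ≫ B.inv := by
    have := frobLinComplex_baseChange f hf P
    rw [← Category.assoc, Iso.eq_comp_inv]
    exact this.trans (Category.assoc _ _ _).symm
  have hΦ : ∀ Z, Φ.map (p ^ a • 𝟙 Z) = p ^ a • 𝟙 _ := fun Z => by
    rw [Functor.map_nsmul, CategoryTheory.Functor.map_id]
  refine ⟨a, B.hom ≫ Φ.map g ≫ A.inv, ⟨?_⟩, ⟨?_⟩⟩
  · have H := (((ModuleCat.extendScalars f).mapHomotopy H₁).compLeft B.hom).compRight B.inv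
    refine ((Homotopy.ofEq ?_).trans H).trans (Homotopy.ofEq ?_)
    · rw [hl]
      simp only [Category.assoc, Iso.inv_hom_id_assoc, Φ, Functor.map_comp]
    · exact (congrArg (fun k => (B.hom ≫ k) ≫ B.inv) (hΦ _)).trans (hom_nsmul_id_inv B _)
  · have H := (((ModuleCat.extendScalars f).mapHomotopy H₂).compLeft A.hom).compRight A.inv
    refine ((Homotopy.ofEq ?_).trans H).trans (Homotopy.ofEq ?_)
    · rw [hl]
      simp only [Category.assoc, Iso.inv_hom_id_assoc, Φ, Functor.map_comp]
    · exact (congrArg (fun k => (A.hom ≫ k) ≫ A.inv) (hΦ _)).trans (hom_nsmul_id_inv A _)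

end Nondegenerate

end Dwork

namespace Dwork

/-! ## A criterion for right Kan extensions -/

section Kan

universe v₁ v₂ v₃ u₁ u₂ u₃

variable {𝒜 : Type u₁} {ℬ : Type u₂} {𝒟 : Type u₃} [Category.{v₁} 𝒜] [Category.{v₂} ℬ]
  [Category.{v₃} 𝒟] {L : 𝒜 ⥤ ℬ} {G : 𝒜 ⥤ 𝒟} {F : ℬ ⥤ 𝒟}

/-- The factorization through `α` of a transformation `β`. -/
def kanLift (α : L ⋙ F ⟶ G) {A : ℬ → 𝒜} (e : ∀ X, L.obj (A X) ≅ X) [∀ X, IsIso (α.app (A X))]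
    (hL : ∀ X C, Function.Surjective (L.map : (A X ⟶ C) → (L.obj (A X) ⟶ L.obj C)))
    (F' : ℬ ⥤ 𝒟) (β : L ⋙ F' ⟶ G) : F' ⟶ F where
  app X := F'.map (e X).inv ≫ β.app (A X) ≫ inv (α.app (A X)) ≫ F.map (e X).hom
  naturality X Y m := by
    obtain ⟨c, hc⟩ := hL X (A Y) ((e X).hom ≫ m ≫ (e Y).inv)
    have h1 : m ≫ (e Y).inv = (e X).inv ≫ L.map c := by rw [hc, Iso.inv_hom_id_assoc]
    have h2 : (e X).hom ≫ m = L.map c ≫ (e Y).hom := by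
      rw [hc, Category.assoc, Category.assoc, Iso.inv_hom_id, Category.comp_id]
    have h3 : F'.map (L.map c) ≫ β.app (A Y) = β.app (A X) ≫ G.map c := β.naturality c
    have h4 : inv (α.app (A X)) ≫ F.map (L.map c) = G.map c ≫ inv (α.app (A Y)) := by
      rw [IsIso.inv_comp_eq, ← Category.assoc, IsIso.eq_comp_inv]
      exact α.naturality c
    rw [← F'.map_comp_assoc, h1, F'.map_comp_assoc, reassoc_of% h3, Category.assoc,
      Category.assoc, Category.assoc, ← F.map_comp, h2, F.map_comp, reassoc_of% h4]

theorem kanLift_fac (α : L ⋙ F ⟶ G) {A : ℬ → 𝒜} (e : ∀ X, L.obj (A X) ≅ X)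
    [∀ X, IsIso (α.app (A X))]
    (hL : ∀ X C, Function.Surjective (L.map : (A X ⟶ C) → (L.obj (A X) ⟶ L.obj C)))
    (F' : ℬ ⥤ 𝒟) (β : L ⋙ F' ⟶ G) (C : 𝒜) :
    (kanLift α e hL F' β).app (L.obj C) ≫ α.app C = β.app C := by
  obtain ⟨c, hc⟩ := hL (L.obj C) C (e (L.obj C)).hom
  have h3 : F'.map (L.map c) ≫ β.app C = β.app (A (L.obj C)) ≫ G.map c := β.naturality c
  have h4 : F.map (L.map c) ≫ α.app C = α.app (A (L.obj C)) ≫ G.map c := α.naturality c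
  dsimp only [kanLift]
  rw [← hc, Category.assoc, Category.assoc, Category.assoc, h4, IsIso.inv_hom_id_assoc, ← h3,
    hc, ← F'.map_comp_assoc, Iso.inv_hom_id, CategoryTheory.Functor.map_id, Category.id_comp]

theorem eq_kanLift (α : L ⋙ F ⟶ G) {A : ℬ → 𝒜} (e : ∀ X, L.obj (A X) ≅ X)
    [∀ X, IsIso (α.app (A X))]
    (hL : ∀ X C, Function.Surjective (L.map : (A X ⟶ C) → (L.obj (A X) ⟶ L.obj C)))
    (F' : ℬ ⥤ 𝒟) (β : L ⋙ F' ⟶ G) (γ : F' ⟶ F)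
    (hγ : ∀ C, γ.app (L.obj C) ≫ α.app C = β.app C) : γ = kanLift α e hL F' β := by
  ext X
  have h1 := hγ (A X)
  have h2 := γ.naturality (e X).inv
  dsimp only [kanLift]
  rw [← h1, Category.assoc, IsIso.hom_inv_id_assoc, reassoc_of% h2, ← F.map_comp,
    Iso.inv_hom_id, CategoryTheory.Functor.map_id, Category.comp_id]

/-- `F` is a right Kan extension if every object of `ℬ` comes from an object of `𝒜` at which `α`
is an isomorphism and whose morphisms in `ℬ` come from `𝒜`. -/
theorem isRightKanExtension_of_exists (α : L ⋙ F ⟶ G)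
    (h : ∀ X : ℬ, ∃ A : 𝒜, Nonempty (L.obj A ≅ X) ∧ IsIso (α.app A) ∧
      ∀ C : 𝒜, Function.Surjective (L.map : (A ⟶ C) → (L.obj A ⟶ L.obj C))) :
    F.IsRightKanExtension α := by
  choose A e hα hL using h
  replace e := fun X => (e X).some
  refine ⟨⟨Limits.IsTerminal.ofUniqueHom (fun E => CostructuredArrow.homMk
    (kanLift α e hL E.left E.hom) ?_) fun E γ => ?_⟩⟩
  · ext C
    exact kanLift_fac α e hL E.left E.hom C
  · refine CostructuredArrow.hom_ext _ _ ?_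
    exact eq_kanLift α e hL E.left E.hom γ.left
      fun C => congrArg (fun t => t.app C) (CostructuredArrow.w γ)

end Kan

open CochainComplex.HomComplex

/-! ## Resolutions by projective `R_φ`-modules -/

section Resolutions

variable {R : Type u} [CommRing R] {φ : R →+* R}

theorem exactAt_forgetComplex_iff (C : FComplex φ) (i : ℤ) :
    ((forgetComplex φ).obj C).ExactAt i ↔ C.ExactAt i := by
  rw [HomologicalComplex.exactAt_iff' _ (i - 1) i (i + 1) (by simp) (by simp),
    HomologicalComplex.exactAt_iff' _ (i - 1) i (i + 1) (by simp) (by simp),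
    ShortComplex.moduleCat_exact_iff, ShortComplex.moduleCat_exact_iff]
  rfl

theorem quasiIso_forgetComplex_iff {C D : FComplex φ} (f : C ⟶ D) :
    QuasiIso ((forgetComplex φ).map f) ↔ QuasiIso f := by
  rw [acyclic_mappingCone_iff, acyclic_mappingCone_iff]
  refine forall_congr' fun i => ?_
  rw [← exactAt_forgetComplex_iff]
  let e := CochainComplex.mappingCone.mapHomologicalComplexIso f (forgetFrob φ)
  exact ⟨fun h => h.of_iso e.symm, fun h => h.of_iso e⟩

theorem IsPerfect.exists_isLE {K : CochainComplex (ModuleCat.{u} R) ℤ} (h : IsPerfect K) :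
    ∃ n : ℤ, ∀ i, n < i → K.ExactAt i := by
  obtain ⟨P, f, ⟨-, a, b, hP⟩, hf⟩ := h
  refine ⟨b, fun i hi => (exactAt_iff_of_quasiIsoAt f i).1 ?_⟩
  rw [HomologicalComplex.exactAt_iff]
  exact ShortComplex.exact_of_isZero_X₂ _ (hP i (Or.inr hi))

/-- Bounded above complexes of projective `R_φ`-modules. -/
structure IsProjectiveComplex (P : FComplex φ) : Prop where
  projective : ∀ i, Projective (P.X i)
  exists_isStrictlyLE : ∃ n : ℤ, P.IsStrictlyLE n

theorem IsProjectiveComplex.isKProjective {P : FComplex φ} (h : IsProjectiveComplex P) :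
    P.IsKProjective := by
  obtain ⟨n, hn⟩ := h.exists_isStrictlyLE
  have := h.projective
  exact CochainComplex.isKProjective_of_projective P n

theorem isStrictlyLE_map {𝒞 : Type v} [Category.{w} 𝒞] [Abelian 𝒞] {𝒟 : Type v'}
    [Category.{w'} 𝒟] [Abelian 𝒟] (Φ : 𝒞 ⥤ 𝒟) [Φ.Additive] (K : CochainComplex 𝒞 ℤ) (n : ℤ)
    [K.IsStrictlyLE n] :
    CochainComplex.IsStrictlyLE ((Φ.mapHomologicalComplex (ComplexShape.up ℤ)).obj K) n :=
  (CochainComplex.isStrictlyLE_iff _ _).2 fun i hi =>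
    Φ.map_isZero ((CochainComplex.isStrictlyLE_iff K n).1 inferInstance i hi)

/-- Hence one resolution over R_φ also serves as a resolution over R, both for base change and for
nondegeneracy. -/
theorem IsProjectiveComplex.forget_isKProjective {P : FComplex φ} (h : IsProjectiveComplex P) :
    ((forgetComplex φ).obj P).IsKProjective := by
  obtain ⟨n, hn⟩ := h.exists_isStrictlyLE
  have := h.projective
  have := isStrictlyLE_map (forgetFrob φ) P n
  have : ∀ i, Projective (((forgetComplex φ).obj P).X i) :=
    fun i => (forgetFrob φ).projective_obj (P.X i)
  exact CochainComplex.isKProjective_of_projective _ n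

variable {S : Type u} [CommRing S] {ψ : S →+* S} (f : R →+* S) (hf : f.comp φ = ψ.comp f)

theorem IsProjectiveComplex.baseChange {P : FComplex φ} (h : IsProjectiveComplex P) :
    IsProjectiveComplex ((baseChangeComplex f hf).obj P) := by
  obtain ⟨n, hn⟩ := h.exists_isStrictlyLE
  refine ⟨fun i => ?_, n, isStrictlyLE_map (Dwork.baseChange f hf) P n⟩
  have := h.projective i
  exact (Dwork.baseChange f hf).projective_obj (P.X i)

theorem isRPerfect_baseChange {P : FComplex φ} (hP : isRPerfect φ P)
    [((forgetComplex φ).obj P).IsKProjective] :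
    isRPerfect ψ ((baseChangeComplex f hf).obj P) :=
  (IsPerfect.extendScalars f hP).of_quasiIso (baseChangeComplexForget f hf P).inv

/-- Perfectness over R bounds the cohomology above, which is all that a bounded above projective
resolution over R_φ requires. -/
theorem exists_isProjectiveComplex {C : FComplex φ} (hC : isRPerfect φ C) :
    ∃ (P : FComplex φ) (c : P ⟶ C), QuasiIso c ∧ IsProjectiveComplex P := by
  obtain ⟨n, hn⟩ := hC.exists_isLE
  have : C.IsLE n := (CochainComplex.isLE_iff _ _).2 fun i hi =>
    (exactAt_forgetComplex_iff C i).1 (hn i hi)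
  obtain ⟨P, c, hc, hP, hP'⟩ := exists_projective_quasiIso C n
  exact ⟨P, c, hc, hP, n, hP'⟩

theorem isRPerfect_of_quasiIso {C D : FComplex φ} (c : C ⟶ D) [hc : QuasiIso c]
    (hD : isRPerfect φ D) : isRPerfect φ C := by
  have := (quasiIso_forgetComplex_iff c).2 hc
  exact hD.of_quasiIso' ((forgetComplex φ).map c)

theorem quasiIso_baseChange {C D : FComplex φ} [((forgetComplex φ).obj C).IsKProjective]
    [((forgetComplex φ).obj D).IsKProjective] (c : C ⟶ D) [hc : QuasiIso c] :
    QuasiIso ((baseChangeComplex f hf).map c) := by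
  rw [← quasiIso_forgetComplex_iff]
  have := (quasiIso_forgetComplex_iff c).2 hc
  have h1 := quasiIso_map_of_isKProjective (ModuleCat.extendScalars f) ((forgetComplex φ).map c)
  have h2 : (baseChangeComplexForget f hf C).hom ≫
      ((ModuleCat.extendScalars f).mapHomologicalComplex (ComplexShape.up ℤ)).map
        ((forgetComplex φ).map c) ≫ (baseChangeComplexForget f hf D).inv =
      (forgetComplex ψ).map ((baseChangeComplex f hf).map c) := by
    rw [← Category.assoc, Iso.comp_inv_eq]
    refine HomologicalComplex.hom_ext _ _ fun i => ?_
    exact ((baseChangeForget f hf).hom.naturality (c.f i)).symm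
  rw [← h2]
  infer_instance

/-! ## Invariance of nondegeneracy -/

/-- Exactness of tensoring with ℚ: clear the denominator and torsion of a cocycle, take a primitive,
and divide back. -/
theorem acyclic_tensorRat {Y : CochainComplex (ModuleCat.{u} R) ℤ} (hY : Y.Acyclic) :
    (((tensorRat R).mapHomologicalComplex (ComplexShape.up ℤ)).obj Y).Acyclic := by
  intro j
  have h1 := hY j
  rw [HomologicalComplex.exactAt_iff' _ (j - 1) j (j + 1) (by simp) (by simp),
    ShortComplex.moduleCat_exact_iff] at h1 ⊢
  replace h1 : ∀ y : Y.X j, (Y.d j (j + 1)).hom y = 0 →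
    ∃ z : Y.X (j - 1), (Y.d (j - 1) j).hom z = y := h1
  intro (x : (tensorRat R).obj (Y.X j)) (hx : ((tensorRat R).map (Y.d j (j + 1))).hom x = 0)
  let ι : R →+* R ⊗[ℤ] ℚ := Algebra.TensorProduct.includeLeftRingHom
  obtain ⟨n, m, hn, e⟩ := exists_smul_eq_oneTmul_tensorRat (Y.X j) x
  obtain ⟨k, hk, e'⟩ := oneTmul_tensorRat_eq_zero (Y.X (j + 1)) ((Y.d j (j + 1)).hom m) (by
    refine (extendScalars_map_oneTmul (Y.d j (j + 1)) m).symm.trans ?_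
    refine (congrArg ((tensorRat R).map (Y.d j (j + 1))).hom e.symm).trans ?_
    rw [map_smul, hx, smul_zero])
  obtain ⟨z, hz⟩ := h1 ((k : R) • m) (by
    rw [map_smul, e'])
  have hkn : ((k * n : ℤ) : ℚ) ≠ 0 := Int.cast_ne_zero.2 (mul_ne_zero hk hn)
  let c : R ⊗[ℤ] ℚ := 1 ⊗ₜ ((k * n : ℤ) : ℚ)⁻¹
  have hc : c * ((k * n : ℤ) : R ⊗[ℤ] ℚ) = 1 := by
    have h2 : ((k * n : ℤ) : R ⊗[ℤ] ℚ) = (1 : R) ⊗ₜ[ℤ] ((k * n : ℤ) : ℚ) :=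
      (map_intCast (Algebra.TensorProduct.includeRight : ℚ →ₐ[ℤ] R ⊗[ℤ] ℚ) (k * n)).symm
    rw [h2, Algebra.TensorProduct.tmul_mul_tmul, inv_mul_cancel₀ hkn, one_mul]
    rfl
  refine ⟨c • oneTmul ι (Y.X (j - 1)) z, ?_⟩
  refine (((tensorRat R).map (Y.d (j - 1) j)).hom.map_smul c _).trans ?_
  have h3 : ((tensorRat R).map (Y.d (j - 1) j)).hom (oneTmul ι (Y.X (j - 1)) z) =
      ((k * n : ℤ) : R ⊗[ℤ] ℚ) • x := by
    refine (congrArg (oneTmul ι (Y.X j)) hz).trans ?_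
    rw [oneTmul_smul, ← e, smul_smul, map_intCast, Int.cast_mul]
  rw [h3, smul_smul, hc, one_smul]

theorem quasiIso_tensorRat {K L : CochainComplex (ModuleCat.{u} R) ℤ} (f : K ⟶ L) [hf : QuasiIso f] :
    QuasiIso (((tensorRat R).mapHomologicalComplex (ComplexShape.up ℤ)).map f) := by
  rw [acyclic_mappingCone_iff] at hf ⊢
  exact fun i => (acyclic_tensorRat hf i).of_iso
    (CochainComplex.mappingCone.mapHomologicalComplexIso f (tensorRat R))

/-- The resolution of C lifts through c up to homotopy, and naturality of the Frobenius compares the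
two composites after tensoring with ℚ. -/
theorem isNondegenerate_of_quasiIso {P C : FComplex φ} (c : P ⟶ C) [hc : QuasiIso c]
    [((forgetComplex φ).obj P).IsKProjective] (h : isNondegenerate φ C) :
    isNondegenerate φ P := by
  obtain ⟨K, f, hK, hf, h⟩ := h
  have hc' := (quasiIso_forgetComplex_iff c).2 hc
  obtain ⟨g, ⟨H⟩⟩ := exists_lift_of_quasiIso ((forgetComplex φ).map c) f
  have hg : QuasiIso g := by
    have : QuasiIso (g ≫ (forgetComplex φ).map c) := quasiIso_of_homotopy H.symm hf
    exact quasiIso_of_comp_right g ((forgetComplex φ).map c)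
  refine ⟨K, g, hK, hg, ?_⟩
  let Φ := (tensorRat R).mapHomologicalComplex (ComplexShape.up ℤ)
  have h1 : QuasiIso (Φ.map (((pull φ).map g ≫ frobLinComplex φ P) ≫ (forgetComplex φ).map c)) := by
    have h2 : ((pull φ).map g ≫ frobLinComplex φ P) ≫ (forgetComplex φ).map c =
        (pull φ).map (g ≫ (forgetComplex φ).map c) ≫ frobLinComplex φ C := by
      refine HomologicalComplex.hom_ext _ _ fun i => ?_
      have h3 := (frobLin φ).naturality (c.f i)
      have h4 := (ModuleCat.extendScalars φ).map_comp (g.f i) ((forgetFrob φ).map (c.f i))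
      refine (Category.assoc _ _ _).trans (Eq.trans ?_ (congrArg (· ≫ _) h4.symm))
      exact Eq.trans (congrArg _ h3.symm) (Category.assoc _ _ _).symm
    rw [h2]
    exact quasiIso_of_homotopy ((tensorRat R).mapHomotopy
      (((ModuleCat.extendScalars φ).mapHomotopy H).symm.compRight _)) h
  rw [Functor.map_comp] at h1
  have := quasiIso_tensorRat ((forgetComplex φ).map c)
  exact quasiIso_of_comp_right _ (Φ.map ((forgetComplex φ).map c))

end Resolutions

end Dwork

namespace Dwork

/-! ## Morphisms from K-projective complexes in the derived category -/

section Derived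

open DerivedCategory

universe u₁ u₂ v₁ v₂

variable {𝒞 : Type u₁} [Category.{v₁} 𝒞] [Abelian 𝒞] [HasDerivedCategory.{w} 𝒞]
  {P L : CochainComplex 𝒞 ℤ}

theorem Q_map_eq_of_homotopy {f g : P ⟶ L} (h : Homotopy f g) : Q.map f = Q.map g :=
  congrArg (Qh.map ·) (HomotopyCategory.eq_of_homotopy _ _ h)

variable [P.IsKProjective]

theorem Q_map_surjective : Function.Surjective (Q.map : (P ⟶ L) → (Q.obj P ⟶ Q.obj L)) := by
  intro m
  obtain ⟨g, hg⟩ := (CochainComplex.IsKProjective.Qh_map_bijective P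
    ((HomotopyCategory.quotient _ _).obj L)).surjective m
  obtain ⟨f, rfl⟩ := (HomotopyCategory.quotient _ _).map_surjective g
  exact ⟨f, hg⟩

theorem nonempty_homotopy_of_Q_map_eq {f g : P ⟶ L} (h : Q.map f = Q.map g) :
    Nonempty (Homotopy f g) :=
  ⟨HomotopyCategory.homotopyOfEq _ _
    ((CochainComplex.IsKProjective.Qh_map_bijective P _).injective h)⟩

theorem Q_map_mapHomologicalComplex_eq {𝒟 : Type u₂} [Category.{v₂} 𝒟] [Abelian 𝒟]
    [HasDerivedCategory.{w'} 𝒟] (Φ : 𝒞 ⥤ 𝒟) [Φ.Additive] {f g : P ⟶ L} (h : Q.map f = Q.map g) :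
    Q.map ((Φ.mapHomologicalComplex (ComplexShape.up ℤ)).map f) =
      Q.map ((Φ.mapHomologicalComplex (ComplexShape.up ℤ)).map g) :=
  Q_map_eq_of_homotopy (Φ.mapHomotopy (nonempty_homotopy_of_Q_map_eq h).some)

theorem exists_quasiIso_of_Q_iso (e : Q.obj P ≅ Q.obj L) : ∃ f : P ⟶ L, QuasiIso f ∧ Q.map f = e.hom := by
  obtain ⟨f, hf⟩ := Q_map_surjective (P := P) (L := L) e.hom
  refine ⟨f, (isIso_Q_map_iff_quasiIso _ f).1 ?_, hf⟩
  rw [hf]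
  infer_instance

theorem comp_square {𝒟 : Type u₂} [Category.{v₂} 𝒟] {A A' B B' C C' D D' : 𝒟} {a : A ⟶ A'}
    {b : B ⟶ B'} {c : C ⟶ C'} {d : D ⟶ D'} {f : A ⟶ B} {f' : A' ⟶ B'} {g : B ⟶ C} {g' : B' ⟶ C'}
    {h : C ⟶ D} {h' : C' ⟶ D'} (h₁ : a ≫ f' = f ≫ b) (h₂ : b ≫ g' = g ≫ c)
    (h₃ : c ≫ h' = h ≫ d) : a ≫ f' ≫ g' ≫ h' = (f ≫ g ≫ h) ≫ d := by
  rw [reassoc_of% h₁, reassoc_of% h₂, h₃, Category.assoc, Category.assoc]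

end Derived

/-! ## The left derived functor of base change -/

section LeftDerived

open DerivedCategory

variable {R : Type u} [CommRing R] {φ : R →+* R} [HasDerivedCategory.{w} (FMod φ)]

theorem exists_resolution (X : DPerf φ) : ∃ P : FComplex φ, IsProjectiveComplex P ∧
    isRPerfect φ P ∧ Nonempty (X.obj ≅ Q.obj P) := by
  obtain ⟨C, hC, ⟨e⟩⟩ := X.property
  obtain ⟨P, c, hc, hP⟩ := exists_isProjectiveComplex hC
  exact ⟨P, hP, isRPerfect_of_quasiIso c hC, ⟨e ≪≫ (asIso (Q.map c)).symm⟩⟩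

/-- A resolution by projective `R_φ`-modules. -/
def resolution (X : DPerf φ) : FComplex φ := (exists_resolution X).choose

theorem isProjectiveComplex_resolution (X : DPerf φ) : IsProjectiveComplex (resolution X) :=
  (exists_resolution X).choose_spec.1

theorem isRPerfect_resolution (X : DPerf φ) : isRPerfect φ (resolution X) :=
  (exists_resolution X).choose_spec.2.1

/-- The isomorphism from an object to its resolution. -/
def resolutionIso (X : DPerf φ) : X.obj ≅ Q.obj (resolution X) :=
  (exists_resolution X).choose_spec.2.2.some

instance (X : DPerf φ) : (resolution X).IsKProjective :=
  (isProjectiveComplex_resolution X).isKProjective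

instance (X : DPerf φ) : ((forgetComplex φ).obj (resolution X)).IsKProjective :=
  (isProjectiveComplex_resolution X).forget_isKProjective

/-- The action on resolutions of a morphism in the derived category. -/
def resolutionMap {X Y : DPerf φ} (m : X ⟶ Y) : resolution X ⟶ resolution Y :=
  (Q_map_surjective ((resolutionIso X).inv ≫ m.hom ≫ (resolutionIso Y).hom)).choose

@[simp]
theorem Q_map_resolutionMap {X Y : DPerf φ} (m : X ⟶ Y) :
    Q.map (resolutionMap m) = (resolutionIso X).inv ≫ m.hom ≫ (resolutionIso Y).hom :=
  (Q_map_surjective ((resolutionIso X).inv ≫ m.hom ≫ (resolutionIso Y).hom)).choose_spec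

theorem Q_map_resolutionMap_comp_inv {X Y : DPerf φ} (m : X ⟶ Y) :
    Q.map (resolutionMap m) ≫ (resolutionIso Y).inv = (resolutionIso X).inv ≫ m.hom := by
  rw [Q_map_resolutionMap, Category.assoc, Category.assoc, Iso.hom_inv_id, Category.comp_id]

/-- The morphism to a complex from its resolution. -/
def resolutionπ (C : (isRPerfect φ).FullSubcategory) : resolution ((perfQ φ).obj C) ⟶ C.obj :=
  (Q_map_surjective (L := C.obj) (resolutionIso ((perfQ φ).obj C)).inv).choose

theorem Q_map_resolutionπ (C : (isRPerfect φ).FullSubcategory) :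
    Q.map (resolutionπ C) = (resolutionIso ((perfQ φ).obj C)).inv :=
  (Q_map_surjective (L := C.obj) (resolutionIso ((perfQ φ).obj C)).inv).choose_spec

instance (C : (isRPerfect φ).FullSubcategory) : QuasiIso (resolutionπ C) := by
  rw [← isIso_Q_map_iff_quasiIso, Q_map_resolutionπ]
  exact Iso.isIso_inv (resolutionIso ((perfQ φ).obj C))

variable {S : Type u} [CommRing S] {ψ : S →+* S} [HasDerivedCategory.{w'} (FMod ψ)]
  (f : R →+* S) (hf : f.comp φ = ψ.comp f)

/-- The left derived functor of base change. -/
def leftDerived : DPerf φ ⥤ DPerf ψ where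
  obj X := ⟨Q.obj ((baseChangeComplex f hf).obj (resolution X)),
    (baseChangeComplex f hf).obj (resolution X),
    isRPerfect_baseChange f hf (isRPerfect_resolution X), ⟨Iso.refl _⟩⟩
  map m := (perfProp ψ).homMk (Q.map ((baseChangeComplex f hf).map (resolutionMap m)))
  -- `resolutionMap` is functorial only up to homotopy, which becomes invisible after base change
  -- followed by `Q`.
  map_id X := by
    refine InducedCategory.hom_ext ?_
    have h := Q_map_mapHomologicalComplex_eq (baseChange f hf)
      (f := resolutionMap (𝟙 X)) (g := 𝟙 _) (by simp)
    refine h.trans ?_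
    rw [CategoryTheory.Functor.map_id, CategoryTheory.Functor.map_id]
    rfl
  map_comp {X Y Z} m m' := by
    refine InducedCategory.hom_ext ?_
    have h := Q_map_mapHomologicalComplex_eq (baseChange f hf)
      (f := resolutionMap (m ≫ m')) (g := resolutionMap m ≫ resolutionMap m') (by simp)
    refine h.trans ?_
    rw [Functor.map_comp, Functor.map_comp]
    rfl

instance : (leftDerived f hf).Additive where
  map_add {X Y m m'} := by
    refine InducedCategory.hom_ext ?_
    have h := Q_map_mapHomologicalComplex_eq (baseChange f hf)
      (f := resolutionMap (m + m')) (g := resolutionMap m + resolutionMap m') (by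
        rw [Functor.map_add, Q_map_resolutionMap, Q_map_resolutionMap, Q_map_resolutionMap,
          ← Preadditive.comp_add, ← Preadditive.add_comp]
        rfl)
    refine h.trans ?_
    rw [Functor.map_add, Functor.map_add]
    rfl

/-- The natural transformation from the left derived functor to base change. -/
def leftDerivedCounit : perfQ φ ⋙ leftDerived f hf ⋙ (perfProp ψ).ι ⟶ perfBaseChange f hf where
  app C := Q.map ((baseChangeComplex f hf).map (resolutionπ C))
  naturality C D c := by
    have h := Q_map_mapHomologicalComplex_eq (baseChange f hf)
      (f := resolutionMap ((perfQ φ).map c) ≫ resolutionπ D) (g := resolutionπ C ≫ c.hom) (by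
        rw [Functor.map_comp, Functor.map_comp, Q_map_resolutionπ, Q_map_resolutionπ]
        exact Q_map_resolutionMap_comp_inv ((perfQ φ).map c))
    rw [Functor.map_comp, Functor.map_comp, Functor.map_comp, Functor.map_comp] at h
    exact h

theorem isIso_leftDerivedCounit_app (C : (isRPerfect φ).FullSubcategory)
    [((forgetComplex φ).obj C.obj).IsKProjective] :
    IsIso ((leftDerivedCounit f hf).app C) := by
  have : QuasiIso ((baseChangeComplex f hf).map (resolutionπ C)) := quasiIso_baseChange f hf _
  exact inferInstanceAs (IsIso (Q.map ((baseChangeComplex f hf).map (resolutionπ C))))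

/-- The resolution as an `R`-perfect complex. -/
def perfResolution (X : DPerf φ) : (isRPerfect φ).FullSubcategory :=
  ⟨resolution X, isRPerfect_resolution X⟩

instance (X : DPerf φ) : ((forgetComplex φ).obj (perfResolution X).obj).IsKProjective :=
  inferInstanceAs ((forgetComplex φ).obj (resolution X)).IsKProjective

/-- On resolutions the counit is invertible, and every derived morphism out of a resolution is a
morphism of complexes; these two facts give the universal property. -/
theorem isLeftDerivedBaseChange_leftDerived :
    IsLeftDerivedBaseChange f hf (leftDerived f hf) := by
  refine ⟨leftDerivedCounit f hf, isRightKanExtension_of_exists _ fun X =>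
    ⟨perfResolution X, ⟨(perfProp φ).isoMk (resolutionIso X).symm⟩,
      isIso_leftDerivedCounit_app f hf _, fun C m => ?_⟩⟩
  obtain ⟨c, hc⟩ := Q_map_surjective (P := resolution X) (L := C.obj) m.hom
  exact ⟨(isRPerfect φ).homMk c, InducedCategory.hom_ext hc⟩

/-! ### Nondegenerate objects -/

variable {p : ℕ} [Fact p.Prime]

theorem isFrobIsogeny_resolution (hp : PrimeToUnits R p) {X : DPerf φ} (hX : ndProp φ X) :
    IsFrobIsogeny p (resolution X) := by
  obtain ⟨C, hC, ⟨e⟩⟩ := hX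
  obtain ⟨c, hc, -⟩ := exists_quasiIso_of_Q_iso ((resolutionIso X).symm ≪≫ e)
  exact isFrobIsogeny_of_isNondegenerate hp (isRPerfect_resolution X)
    (isNondegenerate_of_quasiIso c hC)

theorem ndProp_leftDerived (hp : PrimeToUnits R p) (X : DPerf φ) (hX : ndProp φ X) :
    ndProp ψ ((leftDerived f hf).obj X) := by
  have := ((isProjectiveComplex_resolution X).baseChange f hf).forget_isKProjective
  exact ⟨_, ((isFrobIsogeny_resolution hp hX).baseChange f hf).isNondegenerate, ⟨Iso.refl _⟩⟩

/-! ### Composition with a retraction -/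

/-- The base change of a resolution as a perfect complex. -/
def baseChangeResolution (X : DPerf φ) : (isRPerfect ψ).FullSubcategory :=
  ⟨(baseChangeComplex f hf).obj (resolution X),
    isRPerfect_baseChange f hf (isRPerfect_resolution X)⟩

instance (X : DPerf φ) : ((forgetComplex ψ).obj (baseChangeResolution f hf X).obj).IsKProjective :=
  ((isProjectiveComplex_resolution X).baseChange f hf).forget_isKProjective

/-- The left derived functors of base change along a ring homomorphism and a retraction compose to
the identity. -/
def leftDerivedCompIso (g : S →+* R) (hg : g.comp ψ = φ.comp g) (hgf : g.comp f = RingHom.id R) :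
    leftDerived f hf ⋙ leftDerived g hg ≅ 𝟭 (DPerf φ) :=
  let θ := NatIso.mapHomologicalComplex (baseChangeSectionIso f hf g hg hgf) (ComplexShape.up ℤ)
  -- The base change of a resolution is again K-projective over the new ring, so the second derived
  -- functor is computed on it by plain base change.
  let ε (X : DPerf φ) := @asIso _ _ _ _ _
    (isIso_leftDerivedCounit_app g hg (baseChangeResolution f hf X))
  NatIso.ofComponents
    (fun X => (perfProp φ).isoMk
      (ε X ≪≫ Q.mapIso (θ.app (resolution X)) ≪≫ (resolutionIso X).symm))
    fun {X Y} m => by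
      let c : baseChangeResolution f hf X ⟶ baseChangeResolution f hf Y :=
        (isRPerfect ψ).homMk ((baseChangeComplex f hf).map (resolutionMap m))
      have h1 := (leftDerivedCounit g hg).naturality c
      have h2 : Q.map ((baseChangeComplex g hg).map c.hom) ≫ Q.map (θ.hom.app (resolution Y)) =
          Q.map (θ.hom.app (resolution X)) ≫ Q.map (resolutionMap m) :=
        (Q.map_comp _ _).symm.trans
          ((congrArg Q.map (θ.hom.naturality (resolutionMap m))).trans (Q.map_comp _ _))
      refine InducedCategory.hom_ext ?_
      exact comp_square h1 h2 (Q_map_resolutionMap_comp_inv m)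

end LeftDerived

end Dwork

namespace Dwork

open CochainComplex.HomComplex

/-! ## Reduction modulo `I` on cochains -/

section Reduction

variable {R : Type u} [CommRing R] {φ : R →+* R}

/-- N → S ⊗_R N is onto, so the map from the projective module M lifts. -/
theorem exists_baseChange_map_eq {S : Type u} [CommRing S] {ψ : S →+* S} (f : R →+* S)
    (hf : f.comp φ = ψ.comp f) (hsurj : Function.Surjective f) {M N : FMod φ} [Projective M]
    (g : (baseChange f hf).obj M ⟶ (baseChange f hf).obj N) :
    ∃ g' : M ⟶ N, (baseChange f hf).map g' = g := by
  have : Epi (baseUnit f hf N) :=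
    (ModuleCat.epi_iff_surjective _).2 (oneTmul_surjective hsurj ((forgetFrob φ).obj N))
  refine ⟨Projective.factorThru (baseUnit f hf M ≫ (restrictFrob f hf).map g) (baseUnit f hf N),
    baseChange_hom_ext f hf ?_⟩
  rw [← baseUnit_naturality, Projective.factorThru_comp]

variable {I : Ideal R} {ψ : R ⧸ I →+* R ⧸ I}
  (hf : (Ideal.Quotient.mk I).comp φ = ψ.comp (Ideal.Quotient.mk I))

theorem baseChange_map_eq_zero_iff {M N : FMod φ} (g : M ⟶ N) :
    (baseChange (Ideal.Quotient.mk I) hf).map g = 0 ↔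
      ∀ m : (forgetFrob φ).obj M, ((forgetFrob φ).map g).hom m ∈
        (I • ⊤ : Submodule R ((forgetFrob φ).obj N)) := by
  have h1 : ∀ m : (forgetFrob φ).obj M,
      (baseUnit (Ideal.Quotient.mk I) hf M ≫ (restrictFrob _ hf).map
        ((baseChange (Ideal.Quotient.mk I) hf).map g)).hom m =
      oneTmul (Ideal.Quotient.mk I) ((forgetFrob φ).obj N) (((forgetFrob φ).map g).hom m) :=
    fun m => rfl
  constructor
  · intro h m
    rw [← oneTmul_quotient_eq_zero_iff]
    refine (h1 m).symm.trans ?_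
    rw [h]
    rfl
  · intro h
    refine baseChange_hom_ext _ hf (ModuleCat.hom_ext (LinearMap.ext fun m => ?_))
    refine (h1 m).trans ?_
    rw [(oneTmul_quotient_eq_zero_iff I _ _).2 (h m)]
    rfl

variable {P' P : FComplex φ} {n : ℤ}

theorem mapCochain_baseChange_surjective (hP' : ∀ i, Projective (P'.X i)) :
    Function.Surjective (mapCochain (baseChange (Ideal.Quotient.mk I) hf) P' P n) := by
  intro z
  choose g hg using fun i j (h : i + n = j) =>
    have := hP' i
    exists_baseChange_map_eq (Ideal.Quotient.mk I) hf Ideal.Quotient.mk_surjective (z.v i j h)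
  refine ⟨Cochain.mk fun i j h => g i j h, Cochain.ext _ _ fun i j h => ?_⟩
  exact hg i j h

/-- Together with the surjectivity of reduction, this places the cochains with values in I P in a
short exact sequence of Hom complexes. -/
theorem mapCochain_baseChange_eq_zero_iff (z : Cochain P' P n) :
    mapCochain (baseChange (Ideal.Quotient.mk I) hf) P' P n z = 0 ↔
      forgetCochain P' P n z ∈ idealCochains I _ _ n := by
  constructor
  · intro h i j hij
    exact (baseChange_map_eq_zero_iff hf (z.v i j hij)).1
      (congrArg (fun t : Cochain _ _ n => t.v i j hij) h)
  · intro h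
    refine Cochain.ext _ _ fun i j hij => ?_
    exact (baseChange_map_eq_zero_iff hf (z.v i j hij)).2 (h i j hij)

variable {p : ℕ}

/-- Faithfulness: lift the nullhomotopy modulo I to a cochain z. Then m - dz is a cocycle with
values in I P, and a p-power multiple of it is a boundary. -/
theorem exists_homotopy_pow_smul (h : IsPAdicPair p I) (hnil : StronglyTopNilpotent p φ I)
    (hI : I ≤ I.comap φ) (hP' : ∀ i, Projective (P'.X i)) (hP'' : IsFrobIsogeny p P')
    (hP : IsHomotopyFinite ((forgetComplex φ).obj P)) (m : P' ⟶ P)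
    (H : Homotopy ((baseChangeComplex (Ideal.Quotient.mk I) hf).map m) 0) :
    ∃ N : ℕ, Nonempty (Homotopy (p ^ N • m) 0) := by
  obtain ⟨z, hz⟩ := Cochain.equivHomotopy _ _ H
  rw [Cochain.ofHom_zero, add_zero] at hz
  obtain ⟨z, rfl⟩ := mapCochain_baseChange_surjective hf hP' z
  have h1 : mapCochain (baseChange (Ideal.Quotient.mk I) hf) P' P 0
      (Cochain.ofHom m - diffHom P' P (-1) 0 z) = 0 := by
    rw [map_sub, ← diffHom_mapCochain, sub_eq_zero]
    refine Eq.trans ?_ hz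
    refine Cochain.ext₀ _ _ fun i => ?_
    rw [mapCochain_v, Cochain.ofHom_v, Cochain.ofHom_v]
    rfl
  obtain ⟨N, y, hy⟩ : ∃ (N : ℕ) (y : Cochain P' P (-1)), diffHom P' P (-1) 0 y = p ^ N • _ := by
    obtain ⟨N, y, -, hy⟩ := exists_pow_smul_eq_diffHom h hnil hI hP' hP'' hP _
      ((mapCochain_baseChange_eq_zero_iff hf _).1 h1) (by
        rw [map_sub, diffHom_apply, diffHom_apply, diffHom_apply, δ_ofHom, δ_δ, sub_zero])
    exact ⟨N, y, hy⟩
  refine ⟨N, ⟨(Cochain.equivHomotopy _ _).symm ⟨y + p ^ N • z, ?_⟩⟩⟩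
  rw [Cochain.ofHom_zero, add_zero]
  change _ = diffHom P' P (-1) 0 (y + p ^ N • z)
  rw [map_add, hy, map_nsmul, smul_sub, sub_add_cancel]
  exact map_nsmul (AddMonoidHom.mk' (Cochain.ofHom : (P' ⟶ P) → _) Cochain.ofHom_add) _ _

/-- Fullness: lift k to a cochain z. Its boundary is a cocycle of degree 1 with values in I P, so
p^N dz = dy with y valued in I P, and p^N z - y is a morphism reducing to p^N k. -/
theorem exists_baseChange_map_eq_pow_smul (h : IsPAdicPair p I)
    (hnil : StronglyTopNilpotent p φ I)
    (hI : I ≤ I.comap φ) (hP' : ∀ i, Projective (P'.X i)) (hP'' : IsFrobIsogeny p P')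
    (hP : IsHomotopyFinite ((forgetComplex φ).obj P))
    (k : (baseChangeComplex (Ideal.Quotient.mk I) hf).obj P' ⟶
      (baseChangeComplex (Ideal.Quotient.mk I) hf).obj P) :
    ∃ (N : ℕ) (m : P' ⟶ P), (baseChangeComplex (Ideal.Quotient.mk I) hf).map m = p ^ N • k := by
  obtain ⟨z, hz⟩ := mapCochain_baseChange_surjective hf hP' (Cochain.ofHom k)
  have h1 : mapCochain (baseChange (Ideal.Quotient.mk I) hf) P' P 1 (diffHom P' P 0 1 z) = 0 := by
    rw [← diffHom_mapCochain, hz]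
    exact δ_ofHom k
  obtain ⟨N, (y : Cochain P' P 0), hy', hy⟩ := exists_pow_smul_eq_diffHom h hnil hI hP' hP'' hP _
    ((mapCochain_baseChange_eq_zero_iff hf _).1 h1) (δ_δ 0 1 2 z)
  change diffHom P' P 0 1 y = _ at hy
  have h2 : mapCochain (baseChange (Ideal.Quotient.mk I) hf) P' P 0 (p ^ N • z - y) =
      p ^ N • Cochain.ofHom k := by
    have h3 : mapCochain (baseChange (Ideal.Quotient.mk I) hf) P' P 0 y = 0 :=
      (mapCochain_baseChange_eq_zero_iff hf y).2 hy'
    rw [map_sub, map_nsmul, hz, h3, sub_zero]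
  let c : Cocycle P' P 0 := Cocycle.mk (p ^ N • z - y) 1 rfl (by
    change diffHom P' P 0 1 _ = 0
    rw [map_sub, map_nsmul, hy, sub_self])
  refine ⟨N, c.homOf, HomologicalComplex.hom_ext _ _ fun i => ?_⟩
  have h4 : (baseChange (Ideal.Quotient.mk I) hf).map
      ((p ^ N • z - y).v i i (add_zero i)) = p ^ N • k.f i := by
    refine (congrArg (fun t : Cochain _ _ 0 => t.v i i (add_zero i)) h2).trans ?_
    refine (map_nsmul (AddMonoidHom.mk' (fun t : Cochain _ _ 0 => t.v i i (add_zero i))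
      fun _ _ => rfl) _ _).trans ?_
    exact congrArg (p ^ N • ·) (Cochain.ofHom_v k i)
  refine Eq.trans ?_ (h4.trans (HomologicalComplex.nsmul_f_apply _ _ _).symm)
  rfl

end Reduction

/-! ## Reduction modulo `I` in the derived category -/

section Derived

open DerivedCategory

variable {R : Type u} [CommRing R] {φ : R →+* R} [HasDerivedCategory.{w} (FMod φ)]
  {I : Ideal R} {ψ : R ⧸ I →+* R ⧸ I} [HasDerivedCategory.{w'} (FMod ψ)]
  (hf : (Ideal.Quotient.mk I).comp φ = ψ.comp (Ideal.Quotient.mk I)) {p : ℕ} [Fact p.Prime]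

instance {S : Type u} [CommRing S] {ψ : S →+* S} (f : R →+* S) (hf : f.comp φ = ψ.comp f)
    (X : DPerf φ) : ((baseChangeComplex f hf).obj (resolution X)).IsKProjective :=
  ((isProjectiveComplex_resolution X).baseChange f hf).isKProjective

theorem exists_pow_smul_eq_zero_of_leftDerived (hp : PrimeToUnits R p) (h : IsPAdicPair p I)
    (hnil : StronglyTopNilpotent p φ I) (hI : I ≤ I.comap φ) {X Y : DPerf φ} (hX : ndProp φ X)
    (m : X ⟶ Y) (hm : (leftDerived (Ideal.Quotient.mk I) hf).map m = 0) :
    ∃ N : ℕ, p ^ N • m = 0 := by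
  obtain ⟨H⟩ := nonempty_homotopy_of_Q_map_eq (g := 0)
    ((congrArg InducedCategory.Hom.hom hm).trans (Q.map_zero _ _).symm)
  obtain ⟨N, ⟨H'⟩⟩ := exists_homotopy_pow_smul hf h hnil hI
    (isProjectiveComplex_resolution X).projective (isFrobIsogeny_resolution hp hX)
    (isRPerfect_resolution Y).isHomotopyFinite (resolutionMap m) H
  refine ⟨N, InducedCategory.hom_ext ?_⟩
  have h1 := Q_map_eq_of_homotopy H'
  rw [Functor.map_nsmul, Functor.map_zero, Q_map_resolutionMap, ← Preadditive.comp_nsmul,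
    ← Preadditive.nsmul_comp, Preadditive.IsIso.comp_left_eq_zero,
    Preadditive.IsIso.comp_right_eq_zero] at h1
  exact h1

theorem exists_leftDerived_map_eq_pow_smul (hp : PrimeToUnits R p) (h : IsPAdicPair p I)
    (hnil : StronglyTopNilpotent p φ I) (hI : I ≤ I.comap φ) {X Y : DPerf φ} (hX : ndProp φ X)
    (k : (leftDerived (Ideal.Quotient.mk I) hf).obj X ⟶
      (leftDerived (Ideal.Quotient.mk I) hf).obj Y) :
    ∃ (N : ℕ) (m : X ⟶ Y), (leftDerived (Ideal.Quotient.mk I) hf).map m = p ^ N • k := by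
  obtain ⟨k', hk⟩ := Q_map_surjective (P := (baseChangeComplex _ hf).obj (resolution X))
    (L := (baseChangeComplex _ hf).obj (resolution Y)) k.hom
  obtain ⟨N, m, hm⟩ := exists_baseChange_map_eq_pow_smul hf h hnil hI
    (isProjectiveComplex_resolution X).projective (isFrobIsogeny_resolution hp hX)
    (isRPerfect_resolution Y).isHomotopyFinite k'
  let m' : X ⟶ Y :=
    (perfProp φ).homMk ((resolutionIso X).hom ≫ Q.map m ≫ (resolutionIso Y).inv)
  have h1 : Q.map (resolutionMap m') = Q.map m := by
    rw [Q_map_resolutionMap]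
    simp [m']
  refine ⟨N, m', InducedCategory.hom_ext ?_⟩
  refine (Q_map_mapHomologicalComplex_eq (baseChange _ hf) h1).trans ?_
  refine (congrArg Q.map hm).trans ?_
  rw [Functor.map_nsmul, hk]
  rfl

end Derived

end Dwork

namespace Dwork

/-! ## Equivalences of categories tensored with `ℚ` -/

section TensorRat

variable {A : Type w} [AddCommGroup A]

theorem exists_eq_tmul_inv (z : A ⊗[ℤ] ℚ) : ∃ (a : A) (n : ℤ), n ≠ 0 ∧ z = a ⊗ₜ (n : ℚ)⁻¹ := by
  induction z using TensorProduct.induction_on with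
  | zero => exact ⟨0, 1, one_ne_zero, (zero_tmul _ _).symm⟩
  | tmul a q =>
    refine ⟨q.num • a, q.den, Int.natCast_ne_zero.2 q.den_nz, ?_⟩
    rw [smul_tmul, zsmul_eq_mul, Int.cast_natCast, ← div_eq_mul_inv, Rat.num_div_den]
  | add x y hx hy =>
    obtain ⟨a, n, hn, rfl⟩ := hx
    obtain ⟨b, m, hm, rfl⟩ := hy
    refine ⟨m • a + n • b, n * m, mul_ne_zero hn hm, ?_⟩
    have hn' : (n : ℚ) ≠ 0 := Int.cast_ne_zero.2 hn
    have hm' : (m : ℚ) ≠ 0 := Int.cast_ne_zero.2 hm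
    rw [add_tmul, smul_tmul, smul_tmul, zsmul_eq_mul, zsmul_eq_mul, Int.cast_mul, mul_inv,
      mul_left_comm, mul_inv_cancel₀ hm', mul_inv_cancel_left₀ hn', mul_one]

theorem exists_zsmul_eq_zero_of_tmul_one (a : A) (h : a ⊗ₜ[ℤ] (1 : ℚ) = 0) :
    ∃ n : ℤ, n ≠ 0 ∧ n • a = 0 := by
  have h1 : IsLocalizedModule (nonZeroDivisors ℤ) (TensorProduct.mk ℤ ℚ A 1) :=
    (isLocalizedModule_iff_isBaseChange (nonZeroDivisors ℤ) ℚ _).2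
      (TensorProduct.isBaseChange ℤ A ℚ)
  have h2 : TensorProduct.mk ℤ ℚ A 1 a = 0 := by
    have := congrArg (TensorProduct.comm ℤ A ℚ) h
    rwa [TensorProduct.comm_tmul, map_zero] at this
  obtain ⟨n, hn⟩ := (IsLocalizedModule.eq_zero_iff (nonZeroDivisors ℤ) _).1 h2
  exact ⟨n, nonZeroDivisors.ne_zero n.2, hn⟩

theorem tmul_inv_eq_zero_iff (a : A) {n : ℤ} (hn : n ≠ 0) :
    a ⊗ₜ[ℤ] (n : ℚ)⁻¹ = 0 ↔ ∃ m : ℤ, m ≠ 0 ∧ m • a = 0 := by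
  have hn' : (n : ℚ) ≠ 0 := Int.cast_ne_zero.2 hn
  constructor
  · intro h
    refine exists_zsmul_eq_zero_of_tmul_one a ?_
    have := congrArg (fun z => n • z) h
    rwa [smul_zero, smul_tmul', smul_tmul, zsmul_eq_mul, mul_inv_cancel₀ hn'] at this
  · rintro ⟨m, hm, h⟩
    have hm' : (m : ℚ) ≠ 0 := Int.cast_ne_zero.2 hm
    have h1 : (n : ℚ)⁻¹ = m • ((m : ℚ)⁻¹ * (n : ℚ)⁻¹) := by
      rw [zsmul_eq_mul, mul_inv_cancel_left₀ hm']
    rw [h1, ← smul_tmul, h, zero_tmul]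

end TensorRat

namespace RatCat

variable {𝒜 : Type v} [Category.{w} 𝒜] [Preadditive 𝒜] {ℬ : Type v'} [Category.{w'} ℬ]
  [Preadditive ℬ]

/-- The functor `𝒜 → 𝒜 ⊗ ℚ`. -/
def of (𝒜 : Type v) [Category.{w} 𝒜] [Preadditive 𝒜] : 𝒜 ⥤ RatCat 𝒜 where
  obj X := ⟨X⟩
  map {X Y} f := (f ⊗ₜ 1 : (X ⟶ Y) ⊗[ℤ] ℚ)
  map_comp {X Y Z} f g := by
    refine Eq.trans ?_ (comp_tmul f 1 g 1).symm
    rw [mul_one]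

theorem map_tmul (F : 𝒜 ⥤ ℬ) [F.Additive] {X Y : RatCat 𝒜} (f : X.obj ⟶ Y.obj) (q : ℚ) :
    (map F).map (X := X) (Y := Y) (f ⊗ₜ[ℤ] q : (X.obj ⟶ Y.obj) ⊗[ℤ] ℚ) =
      (F.map f ⊗ₜ[ℤ] q : (F.obj X.obj ⟶ F.obj Y.obj) ⊗[ℤ] ℚ) := rfl

theorem map_injective_of_torsion (F : 𝒜 ⥤ ℬ) [F.Additive]
    (h : ∀ {X Y : 𝒜} (m : X ⟶ Y), F.map m = 0 → ∃ n : ℤ, n ≠ 0 ∧ n • m = 0) :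
    (map F).Faithful := by
  refine ⟨fun {X Y} => ?_⟩
  let Φ : ((X.obj ⟶ Y.obj) ⊗[ℤ] ℚ) →ₗ[ℤ] ((F.obj X.obj ⟶ F.obj Y.obj) ⊗[ℤ] ℚ) :=
    TensorProduct.map (F.mapAddHom (X := X.obj) (Y := Y.obj)).toIntLinearMap LinearMap.id
  change Function.Injective Φ
  refine (injective_iff_map_eq_zero Φ).2 fun z hz => ?_
  obtain ⟨a, n, hn, rfl⟩ := exists_eq_tmul_inv z
  obtain ⟨m, hm, h1⟩ := (tmul_inv_eq_zero_iff (F.map a) hn).1 hz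
  rw [← F.map_zsmul] at h1
  obtain ⟨k, hk, h2⟩ := h _ h1
  rw [smul_smul] at h2
  exact (tmul_inv_eq_zero_iff a hn).2 ⟨k * m, mul_ne_zero hk hm, h2⟩

theorem map_full_of_torsion (F : 𝒜 ⥤ ℬ) [F.Additive]
    (h : ∀ {X Y : 𝒜} (k : F.obj X ⟶ F.obj Y), ∃ (n : ℤ) (m : X ⟶ Y), n ≠ 0 ∧ F.map m = n • k) :
    (map F).Full := by
  refine ⟨fun {X Y} (z : (F.obj X.obj ⟶ F.obj Y.obj) ⊗[ℤ] ℚ) => ?_⟩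
  obtain ⟨a, n, hn, rfl⟩ := exists_eq_tmul_inv z
  obtain ⟨k, m, hk, h1⟩ := h a
  refine ⟨(m ⊗ₜ ((k : ℚ)⁻¹ * (n : ℚ)⁻¹) : (X.obj ⟶ Y.obj) ⊗[ℤ] ℚ), (map_tmul F _ _).trans ?_⟩
  rw [h1, smul_tmul, zsmul_eq_mul, mul_inv_cancel_left₀ (Int.cast_ne_zero.2 hk)]

/-- A left inverse of a functor induces a left inverse after tensoring with `ℚ`. -/
def mapCompIso (F : 𝒜 ⥤ ℬ) [F.Additive] (G : ℬ ⥤ 𝒜) [G.Additive] (θ : F ⋙ G ≅ 𝟭 𝒜) :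
    map F ⋙ map G ≅ 𝟭 (RatCat 𝒜) :=
  NatIso.ofComponents (fun X => (of 𝒜).mapIso (θ.app X.obj)) fun {X Y}
      (z : (X.obj ⟶ Y.obj) ⊗[ℤ] ℚ) => by
    obtain ⟨f, n, -, rfl⟩ := exists_eq_tmul_inv z
    refine (comp_tmul (G.map (F.map f)) (n : ℚ)⁻¹ (θ.hom.app Y.obj) 1).trans ?_
    refine Eq.trans ?_ (comp_tmul (θ.hom.app X.obj) 1 f (n : ℚ)⁻¹).symm
    rw [mul_one, one_mul]
    exact congrArg (fun t => t ⊗ₜ[ℤ] (n : ℚ)⁻¹) (θ.hom.naturality f)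

/-- The torsion conditions make `map G` faithful and full, and θ makes it essentially surjective.
Being a one-sided inverse of an equivalence, `map F` is its quasi-inverse. -/
theorem exists_equivalence (F : 𝒜 ⥤ ℬ) [F.Additive] (G : ℬ ⥤ 𝒜) [G.Additive]
    (θ : F ⋙ G ≅ 𝟭 𝒜)
    (h₁ : ∀ {X Y : ℬ} (m : X ⟶ Y), G.map m = 0 → ∃ n : ℤ, n ≠ 0 ∧ n • m = 0)
    (h₂ : ∀ {X Y : ℬ} (k : G.obj X ⟶ G.obj Y), ∃ (n : ℤ) (m : X ⟶ Y),
      n ≠ 0 ∧ G.map m = n • k) :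
    ∃ e : RatCat 𝒜 ≌ RatCat ℬ, Nonempty (e.functor ≅ map F) ∧ Nonempty (e.inverse ≅ map G) := by
  have := map_injective_of_torsion G h₁
  have := map_full_of_torsion G h₂
  have : (map G).EssSurj := ⟨fun X => ⟨_, ⟨(mapCompIso F G θ).app X⟩⟩⟩
  have : (map G).IsEquivalence := { }
  let e := (map G).asEquivalence
  refine ⟨e.symm, ⟨?_⟩, ⟨Iso.refl _⟩⟩
  exact (Functor.leftUnitor _).symm ≪≫ Functor.isoWhiskerRight (mapCompIso F G θ).symm _ ≪≫
    Functor.associator _ _ _ ≪≫ Functor.isoWhiskerLeft _ e.unitIso.symm ≪≫ Functor.rightUnitor _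

end RatCat

/-! ## Nondegenerate objects -/

section Nondegenerate

variable {R S : Type u} [CommRing R] [CommRing S] {φ : R →+* R} {ψ : S →+* S}
  [HasDerivedCategory.{w} (FMod φ)] [HasDerivedCategory.{w'} (FMod ψ)]

/-- A left inverse of a functor restricts to nondegenerate objects. -/
def ndRestrictCompIso (F : DPerf φ ⥤ DPerf ψ) (hF : ∀ X, ndProp φ X → ndProp ψ (F.obj X))
    (G : DPerf ψ ⥤ DPerf φ) (hG : ∀ X, ndProp ψ X → ndProp φ (G.obj X)) (θ : F ⋙ G ≅ 𝟭 _) :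
    ndRestrict F hF ⋙ ndRestrict G hG ≅ 𝟭 (DPerfNd φ) :=
  NatIso.ofComponents (fun X => (ndProp φ).isoMk (θ.app X.obj)) fun m =>
    InducedCategory.hom_ext (θ.hom.naturality m.hom)

end Nondegenerate

/-! ## Ideals with quotient a discrete valuation ring of mixed characteristic -/

section Quotient

variable {R : Type u} [CommRing R] {p : ℕ} {I : Ideal R} [IsDomain (R ⧸ I)]
  [IsDiscreteValuationRing (R ⧸ I)] [MixedCharZero (R ⧸ I) p]

/-- Krull's intersection theorem; p lies in a proper ideal because some nonzero quotient has
characteristic p. -/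
theorem eq_zero_of_forall_mem_span_pow (x : R ⧸ I)
    (hx : ∀ k, x ∈ Ideal.span {(p : R ⧸ I)} ^ k) : x = 0 := by
  obtain ⟨J, hJ, hJ'⟩ := (MixedCharZero.charP_quotient (R := R ⧸ I) (p := p))
  have h1 : Ideal.span {(p : R ⧸ I)} ≤ J := by
    rw [Ideal.span_singleton_le_iff_mem, ← Ideal.Quotient.eq_zero_iff_mem, map_natCast]
    exact CharP.cast_eq_zero _ p
  have h2 := Ideal.iInf_pow_eq_bot_of_isDomain _ (ne_top_of_le_ne_top hJ h1)
  rw [← Ideal.mem_bot, ← h2, Submodule.mem_iInf]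
  exact hx

theorem isPAdicPair [hp : Fact p.Prime] [hR : IsAdicComplete (Ideal.span {(p : R)}) R]
    (htors : ∃ c : ℕ, ∀ (n : ℕ) (x : R), (p : R) ^ n * x = 0 → (p : R) ^ c * x = 0) :
    IsPAdicPair p I where
  complete := hR
  torsion := htors
  separated x hx := by
    refine Ideal.Quotient.eq_zero_iff_mem.1 (eq_zero_of_forall_mem_span_pow (p := p) _ fun k => ?_)
    obtain ⟨y, hy⟩ := hx k
    rw [Ideal.span_singleton_pow, Ideal.mem_span_singleton]
    exact ⟨Ideal.Quotient.mk I y, by simpa using Ideal.Quotient.eq.2 hy⟩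
  saturated n x hx := by
    have : CharZero (R ⧸ I) := MixedCharZero.toCharZero p
    rw [← Ideal.Quotient.eq_zero_iff_mem] at hx ⊢
    rw [map_mul, map_pow, map_natCast] at hx
    exact (mul_eq_zero.1 hx).resolve_left (pow_ne_zero _ (Nat.cast_ne_zero.2 hp.1.ne_zero))

end Quotient

end Dwork

end

/-! ### The comparison theorem -/

open Dwork in
theorem proposition1p13 {R : Type u} [CommRing R] (p : ℕ) [Fact p.Prime]
    [IsAdicComplete (Ideal.span {(p : R)}) R]
    (htors : ∃ c : ℕ, ∀ (n : ℕ) (x : R), (p : R) ^ n * x = 0 → (p : R) ^ c * x = 0)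
    (φ : R →+* R) (I : Ideal R) (hclosed : IsPadicClosed p I) (hI : I ≤ I.comap φ)
    (hbij : Function.Bijective (Ideal.quotientMap I φ hI))
    [IsDomain (R ⧸ I)] [IsDiscreteValuationRing (R ⧸ I)] [MixedCharZero (R ⧸ I) p]
    (hnil : StronglyTopNilpotent p φ I)
    [HasDerivedCategory.{w} (FMod φ)]
    [HasDerivedCategory.{w'} (FMod (Ideal.quotientMap I φ hI))] :
    ∃ (s : R ⧸ I →+* R) (hs : s.comp (Ideal.quotientMap I φ hI) = φ.comp s),
      (Ideal.Quotient.mk I).comp s = RingHom.id (R ⧸ I) ∧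
      (∀ t : R ⧸ I → R, (∀ x, Ideal.Quotient.mk I (t x) = x) →
        (∀ x, t (Ideal.quotientMap I φ hI x) = φ (t x)) → t = s) ∧
      ∃ (Lπ : DPerf (Ideal.quotientMap I φ hI) ⥤ DPerf φ)
        (Li : DPerf φ ⥤ DPerf (Ideal.quotientMap I φ hI))
        (_ : Lπ.Additive) (_ : Li.Additive)
        (hπ : ∀ X, ndProp (Ideal.quotientMap I φ hI) X → ndProp φ (Lπ.obj X))
        (hi : ∀ X, ndProp φ X → ndProp (Ideal.quotientMap I φ hI) (Li.obj X)),
        IsLeftDerivedBaseChange s hs Lπ ∧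
        IsLeftDerivedBaseChange (Ideal.Quotient.mk I)
          (Ideal.quotientMap_comp_mk hI).symm Li ∧
        ∃ e : RatCat (DPerfNd (Ideal.quotientMap I φ hI)) ≌ RatCat (DPerfNd φ),
          Nonempty (e.functor ≅ RatCat.map (ndRestrict Lπ hπ)) ∧
          Nonempty (e.inverse ≅ RatCat.map (ndRestrict Li hi)) := by
  have hpair : IsPAdicPair p I := isPAdicPair htors
  have hp : PrimeToUnits R p := primeToUnits_of_isAdicComplete p
  obtain ⟨s, hs, hsI⟩ := exists_section φ hnil hI hbij (eq_zero_of_forall_mem_span_pow (p := p))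
  have hi := (Ideal.quotientMap_comp_mk hI).symm
  let Lπ := leftDerived s hs
  let Li := leftDerived (Ideal.Quotient.mk I) hi
  have hpW : PrimeToUnits (R ⧸ I) p := hp.map (Ideal.Quotient.mk I)
  refine ⟨s, hs, hsI, fun t ht ht' => section_unique φ hnil hI hbij.surjective
    (fun x => RingHom.congr_fun hsI x) ht (fun x => RingHom.congr_fun hs x) ht',
    Lπ, Li, inferInstance, inferInstance, ndProp_leftDerived s hs hpW,
    ndProp_leftDerived (Ideal.Quotient.mk I) hi hp, isLeftDerivedBaseChange_leftDerived s hs,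
    isLeftDerivedBaseChange_leftDerived _ hi, ?_⟩
  have hpow (N : ℕ) : ((p ^ N : ℕ) : ℤ) ≠ 0 :=
    Int.natCast_ne_zero.2 (pow_ne_zero _ (Fact.out : p.Prime).ne_zero)
  -- Here `Li` is the functor shown to be fully faithful up to p-powers, and `Lπ` supplies the
  -- objects that make it essentially surjective.
  refine RatCat.exists_equivalence _ _
    (ndRestrictCompIso _ _ _ _ (leftDerivedCompIso s hs _ hi hsI)) (fun {X Y} m hm => ?_)
    fun {X Y} k => ?_
  · have hm' := congrArg InducedCategory.Hom.hom hm
    obtain ⟨N, hN⟩ :=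
      exists_pow_smul_eq_zero_of_leftDerived hi hp hpair hnil hI X.property m.hom hm'
    refine ⟨(p ^ N : ℕ), hpow N, InducedCategory.hom_ext ?_⟩
    rw [natCast_zsmul]
    exact hN
  · obtain ⟨N, m, hm⟩ := exists_leftDerived_map_eq_pow_smul hi hp hpair hnil hI X.property k.hom
    refine ⟨(p ^ N : ℕ), (ndProp φ).homMk m, hpow N, InducedCategory.hom_ext ?_⟩
    rw [natCast_zsmul]
    exact hm
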